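/- Let $F=F(a,b)$ be the free group of rank two, let $\varphi$ be its automorphism $a\mapsto aba$, $b\mapsto a$, and for a fixed integer $n\ge 1$ let $$A=F\rtimes_{\varphi^n}\langle t\rangle=\langle a,b,t\mid tat^{-1}=\varphi^n(a),\ tbt^{-1}=\varphi^n(b)\rangle .$$ Let $A_x,A_y,A_z$ be copies of $A$ with generators $x_1,x_2,t_x$, resp. $y_1,y_2,t_y$, resp. $z_1,z_2,t_z$ in place of $a,b,t$. Let $C$ be a CAT(0) group, that is, a group acting properly discontinuously and cocompactly by isometries on a proper CAT(0) space $X$. Let $A_d\le C$ be a subgroup isomorphic to $A$, with generators $d_1,d_2,t_d$ corresponding to $a,b,t$, which preserves a nonempty convex subset $Y\subseteq X$ and acts cocompactly on $Y$. Define $$B_1=\bigl[C\ast_{\langle d_i=x_iy_i^{-1},\,t_d=t_xt_y\rangle}(A_x\times A_y\times A_z)\bigr]\times\langle s_1\rangle,$$ $$B_2=\langle B_1,s_2\mid s_2^{-1}(x_iz_i)s_2=y_iz_i\ (i=1,2),\ s_2^{-1}(t_xt_z)s_2=t_yt_z\rangle,$$ $$B_m=\langle B_{m-1},s_m\mid s_m^{-1}s_1s_m=s_{m-1}\rangle\qquad(m\ge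 3),$$ where $s_1$ generates an infinite cyclic group. For functions $f,g$ on the positive reals write $f\preceq g$ if there are constants $\lambda,\mu,\kappa>0$ with $f(r)\le g(\lambda r)+\mu r$ for all $r>\kappa$, and $f\sim g$ if $f\preceq g\preceq f$. In a geodesic space with base point $x_0$ let $d_r(x,y)$ be the infimum of the lengths of the paths from $x$ to $y$ outside the open ball $B(x_0,r)$. For a finitely generated group $G$ with finite generating set $S$ and $\rho\in(0,1]$ let $\delta_\rho(r)$ be the supremum of $d_{\rho r}(x_1,x_2)$ over all $x_1,x_2$ on the sphere of radius $r$ about $x_0=1$ in the Cayley graph $\Gamma(G,S)$ with $d_{\rho r}(x_1,x_2)<\infty$; one writes $\mathrm{Div}_G\sim f$ if there is $b\in(0,1]$ with $\delta_\rho\sim f$ for all $\rho\in(0,b]$. For $c\in S$ such that $\langle c\rangle$ is infinite and undistorted, the unit speed path $\alpha$ in $\Gamma(G,S)$ through $\alpha(0)=1$ with all edges labeled by $c$ is an $(L,K)$-quasi-geodesic for some $L\ge 1$, $K\ge 0$, and $\mathrm{Div}^G_{\langle c\rangle}(r)$ is the infimum of the lengths of the paths from $\alpha(-r)$ to $\alpha(r)$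 outside the open ball $B(\alpha(0),r/L-K)$. **Proposition.** For every $m\ge 1$ the group $B_m$ is finitely generated, $\langle s_m\rangle$ is infinite and undistorted in $B_m$, and $$\mathrm{Div}^{B_m}_{\langle s_m\rangle}\sim r^m\qquad\text{and}\qquad \mathrm{Div}_{B_m}\sim r^m,$$ for every choice of the finite generating set $S$ of $B_m$ (with $s_m\in S$ for the first statement) and of the quasi-geodesic constants $L,K$. -/

import Mathlib

open scoped ENNReal

noncomputable section

namespace CatDiv

/-! ### Comparing growth functions -/

/-- `f ≼ g`: there are `A, B, K > 0` with `f x ≤ g (A x) + B x` for all `x > K`. Functions take values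
in `[0, ∞]`, and only their values at positive reals matter. -/
def Dominated (f g : ℝ → ℝ≥0∞) : Prop :=
  ∃ A B K : ℝ, 0 < A ∧ 0 < B ∧ 0 < K ∧ ∀ x : ℝ, K < x → f x ≤ g (A * x) + ENNReal.ofReal (B * x)

/-- `f ∼ g`. -/
def Equivalent (f g : ℝ → ℝ≥0∞) : Prop :=
  Dominated f g ∧ Dominated g f

/-- A family `δ_ρ`, `ρ ∈ (0,1]`, is equivalent to a function `f` if `δ_ρ ∼ f` for all small `ρ`. -/
def FamilyEquivalent (δ : ℝ → ℝ → ℝ≥0∞) (f : ℝ → ℝ≥0∞) : Prop :=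
  ∃ b : ℝ, 0 < b ∧ b ≤ 1 ∧ ∀ ρ : ℝ, 0 < ρ → ρ ≤ b → Equivalent (δ ρ) f

/-- The function `r ↦ r ^ m`. -/
def powFun (m : ℕ) : ℝ → ℝ≥0∞ := fun r => ENNReal.ofReal (r ^ m)

/-! ### Divergence in metric spaces -/

section Metric

variable {X : Type*} [MetricSpace X]

/-- The infimum of the lengths of the paths from `x` to `y` in the complement of the open ball of
radius `r` about `x₀` (it is `∞` if there is no rectifiable such path). -/
def avoidDist (x₀ : X) (r : ℝ) (x y : X) : ℝ≥0∞ :=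
  ⨅ (γ : Path x y) (_ : ∀ t, γ t ∉ Metric.ball x₀ r), eVariationOn γ Set.univ

/-- The functions `δ_ρ` of the divergence of `X`: `δ_ρ(r)` is the supremum of `d_{ρr}(x₁, x₂)` over
the pairs on the sphere of radius `r` for which it is finite. -/
def divergenceFamily (x₀ : X) (ρ r : ℝ) : ℝ≥0∞ :=
  ⨆ (x₁ : X) (x₂ : X) (_ : x₁ ∈ Metric.sphere x₀ r) (_ : x₂ ∈ Metric.sphere x₀ r)
    (_ : avoidDist x₀ (ρ * r) x₁ x₂ < ∞), avoidDist x₀ (ρ * r) x₁ x₂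

/-- `α` is an `(L, C)`-bi-infinite quasi-geodesic. -/
def IsQuasiGeodesic (L C : ℝ) (α : ℝ → X) : Prop :=
  1 ≤ L ∧ 0 ≤ C ∧ ∀ s t : ℝ,
    |s - t| / L - C ≤ dist (α s) (α t) ∧ dist (α s) (α t) ≤ L * |s - t| + C

/-- The divergence of an `(L, C)`-bi-infinite quasi-geodesic. -/
def quasiGeodesicDivergence (L C : ℝ) (α : ℝ → X) (r : ℝ) : ℝ≥0∞ :=
  avoidDist (α 0) (r / L - C) (α (-r)) (α r)

end Metric

/-! ### CAT(0) spaces -/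

section CAT0

variable {X : Type*} [MetricSpace X]

/-- `c`, restricted to `[0,1]`, is a geodesic from `x` to `y`, parametrized proportionally to
arc length. -/
def IsGeodesic (c : ℝ → X) (x y : X) : Prop :=
  c 0 = x ∧ c 1 = y ∧ ∀ s ∈ Set.Icc (0 : ℝ) 1, ∀ t ∈ Set.Icc (0 : ℝ) 1,
    dist (c s) (c t) = |s - t| * dist x y

/-- A CAT(0) space: a geodesic space in which points on two sides of a geodesic triangle are at most
as far apart as the corresponding points of a Euclidean comparison triangle. (Two sides of a triangle
always share a vertex, here called `x`.) -/
def IsCAT0 (X : Type*) [MetricSpace X] : Prop :=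
  (∀ x y : X, ∃ c : ℝ → X, IsGeodesic c x y) ∧
  ∀ (x y z : X) (c c' : ℝ → X), IsGeodesic c x y → IsGeodesic c' x z →
    ∀ x' y' z' : EuclideanSpace ℝ (Fin 2),
      dist x' y' = dist x y → dist x' z' = dist x z → dist y' z' = dist y z →
      ∀ s ∈ Set.Icc (0 : ℝ) 1, ∀ t ∈ Set.Icc (0 : ℝ) 1,
        dist (c s) (c' t) ≤ dist (AffineMap.lineMap x' y' s) (AffineMap.lineMap x' z' t)

/-- A (geodesically) convex subset. -/
def IsGeodesicallyConvex (Y : Set X) : Prop :=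
  ∀ x ∈ Y, ∀ y ∈ Y, ∀ c : ℝ → X, IsGeodesic c x y → ∀ t ∈ Set.Icc (0 : ℝ) 1, c t ∈ Y

/-- The elements `f a`, `a : A`, map `Y` to itself, and some compact subset of `Y` meets all the
orbits of this action in `Y`. -/
def ActsCocompactlyOn {A C : Type*} [Group A] [Group C] [MulAction C X]
    (f : A →* C) (Y : Set X) : Prop :=
  (∀ a : A, ∀ y ∈ Y, f a • y ∈ Y) ∧
  ∃ K : Set X, K ⊆ Y ∧ IsCompact K ∧ ∀ y ∈ Y, ∃ a : A, ∃ k ∈ K, f a • k = y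

/-- `C` acts on the proper metric space `X` geometrically: by isometries, properly discontinuously and
cocompactly. -/
def ActsGeometrically (C X : Type*) [Group C] [MetricSpace X] [MulAction C X] : Prop :=
  IsIsometricSMul C X ∧ ProperlyDiscontinuousSMul C X ∧
    ActsCocompactlyOn (X := X) (MonoidHom.id C) Set.univ

end CAT0

/-! ### Cayley graphs as geodesic spaces -/

section MetricGraph

variable {V : Type*} {H : SimpleGraph V}

/-- A point of the geometric realization of a simple graph in which every edge is a unit interval, given
as the point at parameter `t` of the oriented edge from `src` to `tgt`; the case `src = tgt` describes
a vertex. Such descriptions of a point are not unique. -/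
structure GraphPt (H : SimpleGraph V) where
  src : V
  tgt : V
  edge : src = tgt ∨ H.Adj src tgt
  t : ℝ
  t_mem : t ∈ Set.Icc (0 : ℝ) 1

namespace GraphPt

/-- The length (`0` or `1`) of the segment carrying `p`. -/
def len (p : GraphPt H) : ℝ := H.dist p.src p.tgt

/-- The endpoints of the segment carrying `p`. -/
def vert (p : GraphPt H) (e : Bool) : V := if e then p.tgt else p.src

/-- The distance from `p` to the endpoint `e` along the segment carrying `p`. -/
def off (p : GraphPt H) (e : Bool) : ℝ := (if e then 1 - p.t else p.t) * p.len

/-- The length of a shortest connection from `p` to `q` through an endpoint of the segment of `p` and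
an endpoint of the segment of `q`. -/
def viaVertices (p q : GraphPt H) : ℝ :=
  ⨅ e : Bool × Bool, (p.off e.1 + H.dist (p.vert e.1) (q.vert e.2) + q.off e.2)

open Classical in
/-- The path-length distance: along the edge for two points of one edge, otherwise through vertices. -/
def d (p q : GraphPt H) : ℝ :=
  if p.src = q.src ∧ p.tgt = q.tgt then |p.t - q.t| * p.len
  else if p.src = q.tgt ∧ p.tgt = q.src then |p.t - (1 - q.t)| * p.len
  else p.viaVertices q

theorem len_nonneg (p : GraphPt H) : 0 ≤ p.len := Nat.cast_nonneg _

theorem off_nonneg (p : GraphPt H) (e : Bool) : 0 ≤ p.off e := by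
  have h := p.t_mem
  cases e
  · simpa [off] using mul_nonneg h.1 p.len_nonneg
  · simpa [off] using mul_nonneg (sub_nonneg.2 h.2) p.len_nonneg

theorem off_add (p : GraphPt H) (e : Bool) : p.off e + p.off (!e) = p.len := by
  cases e <;> simp [off] <;> ring

theorem dist_symm (u v : V) : (H.dist u v : ℝ) = H.dist v u := by
  rw [SimpleGraph.dist_comm]

theorem dist_tri (hH : H.Connected) (u v w : V) :
    (H.dist u w : ℝ) ≤ H.dist u v + H.dist v w := by
  exact_mod_cast hH.dist_triangle

theorem dist_vert_le (p : GraphPt H) (e e' : Bool) :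
    (H.dist (p.vert e) (p.vert e') : ℝ) ≤ p.off e + p.off e' := by
  have h0 := p.off_nonneg e
  have h1 := p.off_add e
  rcases e with _ | _ <;> rcases e' with _ | _ <;> simp [vert, len] at h0 h1 ⊢
  all_goals first | linarith | (rw [dist_symm]; linarith)

theorem viaVertices_le (p q : GraphPt H) (e e' : Bool) :
    p.viaVertices q ≤ p.off e + H.dist (p.vert e) (q.vert e') + q.off e' :=
  ciInf_le (f := fun e : Bool × Bool => p.off e.1 + H.dist (p.vert e.1) (q.vert e.2) + q.off e.2)
    (Set.finite_range _).bddBelow (e, e')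

theorem exists_viaVertices_eq (p q : GraphPt H) : ∃ e e' : Bool,
    p.viaVertices q = p.off e + H.dist (p.vert e) (q.vert e') + q.off e' := by
  obtain ⟨⟨e, e'⟩, h⟩ := exists_eq_ciInf_of_finite
    (f := fun e : Bool × Bool => p.off e.1 + H.dist (p.vert e.1) (q.vert e.2) + q.off e.2)
  exact ⟨e, e', h.symm⟩

theorem viaVertices_comm (p q : GraphPt H) : p.viaVertices q = q.viaVertices p := by
  apply le_antisymm
  · obtain ⟨e, e', h⟩ := exists_viaVertices_eq q p
    have := viaVertices_le p q e' e
    rw [dist_symm] at this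
    linarith
  · obtain ⟨e, e', h⟩ := exists_viaVertices_eq p q
    have := viaVertices_le q p e' e
    rw [dist_symm] at this
    linarith

/-- `p` and `q` are described through the same edge, with the same orientation or, if `o` is `true`,
with opposite orientations. -/
def SameEdge (o : Bool) (p q : GraphPt H) : Prop := ∀ e : Bool, p.vert e = q.vert (xor o e)

theorem SameEdge.symm {o : Bool} {p q : GraphPt H} (h : SameEdge o p q) : SameEdge o q p := by
  intro e
  rw [h]
  simp

theorem SameEdge.trans {o o' : Bool} {p q r : GraphPt H} (h : SameEdge o p q)
    (h' : SameEdge o' q r) : SameEdge (xor o' o) p r := by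
  intro e
  rw [h, h', Bool.xor_assoc]

theorem SameEdge.len_eq {o : Bool} {p q : GraphPt H} (h : SameEdge o p q) : p.len = q.len := by
  have h1 := h false
  have h2 := h true
  cases o <;> simp [vert] at h1 h2 <;> simp [len, h1, h2, dist_symm]

theorem sameEdge_d {o : Bool} {p q : GraphPt H} (h : SameEdge o p q) (e : Bool) :
    p.d q = |p.off e - q.off (xor o e)| := by
  have hl := h.len_eq
  have hn := q.len_nonneg
  have h1 := h false
  have h2 := h true
  have key : ∀ a : ℝ, |a| * q.len = |a * q.len| := fun a => by rw [abs_mul, abs_of_nonneg hn]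
  unfold d
  cases o
  · simp [vert] at h1 h2
    rw [if_pos ⟨h1, h2⟩, hl, key]
    cases e
    · simp [off, hl, sub_mul]
    · simp only [off, hl]
      rw [← abs_neg]
      congr 1
      simp
      ring
  · simp [vert] at h1 h2
    by_cases h3 : p.src = q.src ∧ p.tgt = q.tgt
    · have : q.len = 0 := by
        have : q.src = q.tgt := by rw [← h3.1, h1]
        simp [len, this]
      rw [if_pos h3]
      simp [off, hl, this]
    · rw [if_neg h3, if_pos ⟨h1, h2⟩, hl, key]
      cases e
      · simp [off, hl, sub_mul]
      · simp only [off, hl]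
        rw [← abs_neg]
        congr 1
        simp
        ring

theorem sameEdge_or (p q : GraphPt H) : (∃ o, SameEdge o p q) ∨ p.d q = p.viaVertices q := by
  by_cases h1 : p.src = q.src ∧ p.tgt = q.tgt
  · exact Or.inl ⟨false, fun e => by cases e <;> simp [vert, h1]⟩
  by_cases h2 : p.src = q.tgt ∧ p.tgt = q.src
  · exact Or.inl ⟨true, fun e => by cases e <;> simp [vert, h2]⟩
  right
  simp [d, h1, h2]

theorem d_le_viaVertices (p q : GraphPt H) : p.d q ≤ p.viaVertices q := by
  rcases sameEdge_or p q with ⟨o, h⟩ | h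
  · obtain ⟨e, e', he⟩ := exists_viaVertices_eq p q
    have hd : (0 : ℝ) ≤ H.dist (p.vert e) (q.vert e') := Nat.cast_nonneg _
    rw [sameEdge_d h e, he, abs_le]
    have hq := q.off_add e'
    have hp := p.off_add e
    have hpe := p.off_nonneg e
    have hpe' := p.off_nonneg (!e)
    have hqe := q.off_nonneg e'
    have hqe' := q.off_nonneg (!e')
    have hl := h.len_eq
    rcases eq_or_ne e' (xor o e) with rfl | hne
    · constructor <;> linarith
    · have h4 : xor o e = !e' := by revert hne; cases e' <;> cases o <;> cases e <;> simp
      have h5 : (H.dist (p.vert e) (q.vert e') : ℝ) = q.len := by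
        rw [h e, h4]
        cases e' <;> simp [vert, len, dist_symm]
      rw [h4]
      constructor <;> linarith
  · exact h.le

theorem d_comm (p q : GraphPt H) : p.d q = q.d p := by
  rcases sameEdge_or p q with ⟨o, h⟩ | h
  · rw [sameEdge_d h false, sameEdge_d h.symm (xor o false), abs_sub_comm]
    simp
  · rcases sameEdge_or q p with ⟨o, h'⟩ | h'
    · rw [sameEdge_d h' false, sameEdge_d h'.symm (xor o false), abs_sub_comm]
      simp
    · rw [h, h', viaVertices_comm]

theorem d_triangle_aux {o : Bool} {p q r : GraphPt H} (h : SameEdge o p q)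
    (h' : q.d r = q.viaVertices r) : p.d r ≤ p.d q + q.d r := by
  obtain ⟨e, e', he⟩ := exists_viaVertices_eq q r
  have h1 := (d_le_viaVertices p r).trans (viaVertices_le p r (xor o e) e')
  rw [h (xor o e)] at h1
  rw [h', he, sameEdge_d h (xor o e)]
  simp only [← Bool.xor_assoc, Bool.xor_self, Bool.false_xor] at *
  have h2 := le_abs_self (p.off (xor o e) - q.off e)
  linarith

theorem d_triangle (hH : H.Connected) (p q r : GraphPt H) : p.d r ≤ p.d q + q.d r := by
  rcases sameEdge_or p q with ⟨o, h⟩ | h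
  · rcases sameEdge_or q r with ⟨o', h'⟩ | h'
    · rw [sameEdge_d h false, sameEdge_d h' (xor o false), sameEdge_d (h.trans h') false,
        Bool.xor_assoc]
      exact abs_sub_le _ _ _
    · exact d_triangle_aux h h'
  · rcases sameEdge_or q r with ⟨o', h'⟩ | h'
    · rw [d_comm p r, d_comm p q, d_comm q r, add_comm]
      exact d_triangle_aux h'.symm (by rw [d_comm, h, viaVertices_comm])
    · obtain ⟨e1, e2, h12⟩ := exists_viaVertices_eq p q
      obtain ⟨e3, e4, h34⟩ := exists_viaVertices_eq q r
      have h1 := (d_le_viaVertices p r).trans (viaVertices_le p r e1 e4)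
      have h2 := dist_vert_le q e2 e3
      have h3 := dist_tri hH (p.vert e1) (q.vert e2) (r.vert e4)
      have h4 := dist_tri hH (q.vert e2) (q.vert e3) (r.vert e4)
      rw [h, h', h12, h34]
      linarith

end GraphPt

/-- Descriptions of points of the realization of a connected graph, with the path-length distance. -/
def PreMetricGraph {H : SimpleGraph V} (_hH : H.Connected) : Type _ := GraphPt H

instance PreMetricGraph.instPseudoMetricSpace (hH : H.Connected) :
    PseudoMetricSpace (PreMetricGraph hH) where
  dist p q := GraphPt.d p q
  dist_self p := by simp [GraphPt.d]
  dist_comm p q := GraphPt.d_comm p q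
  dist_triangle p q r := GraphPt.d_triangle hH p q r

/-- The geometric realization of a connected graph with edges of length one, as a metric space with
the path-length metric: descriptions at distance zero describe the same point. -/
abbrev MetricGraph {H : SimpleGraph V} (hH : H.Connected) : Type _ :=
  SeparationQuotient (PreMetricGraph hH)

/-- The point described by `p`. -/
def MetricGraph.mk (hH : H.Connected) (p : GraphPt H) : MetricGraph hH :=
  SeparationQuotient.mk (X := PreMetricGraph hH) p

/-- The vertex `v` as a point. -/
def MetricGraph.vertex (hH : H.Connected) (v : V) : MetricGraph hH :=
  MetricGraph.mk hH ⟨v, v, Or.inl rfl, 0, by simp⟩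

end MetricGraph

section Cayley

variable {G : Type*} [Group G] {S : Set G}

theorem mulCayley_connected (hS : Subgroup.closure S = ⊤) :
    (SimpleGraph.mulCayley S).Connected := by
  have key : ∀ g ∈ Subgroup.closure S, ∀ u : G, (SimpleGraph.mulCayley S).Reachable u (u * g) := by
    intro g hg
    induction hg using Subgroup.closure_induction with
    | mem x hx =>
      intro u
      by_cases h : u = u * x
      · rw [← h]
      · exact SimpleGraph.Adj.reachable ((SimpleGraph.mulCayley_adj S u (u * x)).2
          ⟨h, Or.inl (by simpa using hx)⟩)
    | one => intro u; simp
    | mul x y _ _ hx hy =>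
      intro u
      rw [← mul_assoc]
      exact (hx u).trans (hy (u * x))
    | inv x _ hx =>
      intro u
      simpa using (hx (u * x⁻¹)).symm
  refine ⟨fun u v => ?_⟩
  have := key (u⁻¹ * v) (by rw [hS]; trivial) u
  simpa using this

/-- The Cayley graph of `G` for the generating set `S`, as a geodesic metric space. (It has one edge
between `g` and `g * s` for `s ∈ S`, `s ≠ 1`.) -/
abbrev CayleyGraph (hS : Subgroup.closure S = ⊤) : Type _ := MetricGraph (mulCayley_connected hS)

/-- The vertex `g` of the Cayley graph. -/
def CayleyGraph.vertex (hS : Subgroup.closure S = ⊤) (g : G) : CayleyGraph hS :=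
  MetricGraph.vertex _ g

/-- The bi-infinite path through the identity with all edges labeled by `c ∈ S`, traversed at unit
speed. -/
def CayleyGraph.cyclicPath (hS : Subgroup.closure S = ⊤) {c : G} (hc : c ∈ S) (x : ℝ) :
    CayleyGraph hS :=
  MetricGraph.mk _
    { src := c ^ ⌊x⌋
      tgt := c ^ (⌊x⌋ + 1)
      edge := by
        by_cases h : c ^ ⌊x⌋ = c ^ (⌊x⌋ + 1)
        · exact Or.inl h
        · exact Or.inr ((SimpleGraph.mulCayley_adj S _ _).2
            ⟨h, Or.inl (by simpa [zpow_add] using hc)⟩)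
      t := Int.fract x
      t_mem := ⟨Int.fract_nonneg x, (Int.fract_lt_one x).le⟩ }

/-- The divergence of the group `G` is equivalent to `f`: this is the case for the divergence of the
Cayley graph of every finite generating set (of which there is at least one). -/
def GroupDivergenceEquivalent (G : Type*) [Group G] (f : ℝ → ℝ≥0∞) : Prop :=
  Group.FG G ∧ ∀ (S : Set G) (hS : Subgroup.closure S = ⊤), S.Finite →
    FamilyEquivalent (divergenceFamily (CayleyGraph.vertex hS 1)) f

/-- The cyclic subgroup `⟨c⟩` of the finitely generated group `G` is infinite and undistorted, that is,
the paths in Cayley graphs with all edges labeled by `c` are quasi-geodesics, and its divergence, that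
of such a quasi-geodesic, is equivalent to `f`. -/
def CyclicDivergenceEquivalent {G : Type*} [Group G] (c : G) (f : ℝ → ℝ≥0∞) : Prop :=
  Group.FG G ∧ ∀ (S : Set G) (hS : Subgroup.closure S = ⊤) (hc : c ∈ S), S.Finite →
    (∃ L C : ℝ, IsQuasiGeodesic L C (CayleyGraph.cyclicPath hS hc)) ∧
    ∀ L C : ℝ, IsQuasiGeodesic L C (CayleyGraph.cyclicPath hS hc) →
      Equivalent (quasiGeodesicDivergence L C (CayleyGraph.cyclicPath hS hc)) f

end Cayley

/-! ### The free-by-cyclic groups -/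

/-- The free group on `a`, `b`. -/
abbrev F₂ : Type := FreeGroup (Fin 2)

/-- The automorphism `a ↦ a b a`, `b ↦ a` of the free group on `a = of 0`, `b = of 1`. -/
def palAut : MulAut F₂ :=
  MonoidHom.toMulEquiv
    (FreeGroup.lift ![FreeGroup.of 0 * FreeGroup.of 1 * FreeGroup.of 0, FreeGroup.of 0])
    (FreeGroup.lift ![FreeGroup.of 1,
      (FreeGroup.of 1)⁻¹ * FreeGroup.of 0 * (FreeGroup.of 1)⁻¹])
    (by ext i; fin_cases i <;> simp [mul_assoc])
    (by ext i; fin_cases i <;> simp [mul_assoc])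

/-- The endomorphism `a ↦ a⁻¹`, `b ↦ b⁻¹` of the free group. -/
def flipHom : F₂ →* F₂ := FreeGroup.lift fun i => (FreeGroup.of i)⁻¹

/-- `A = F₂ ⋊ ⟨t⟩` with `t w t⁻¹ = φⁿ(w)` for `w ∈ F₂`, where `φ` is `palAut`. -/
abbrev FreeByCyclic (n : ℕ) : Type :=
  F₂ ⋊[zpowersHom (MulAut F₂) (palAut ^ n)] Multiplicative ℤ

theorem flipHom_palAut (w : F₂) : flipHom (palAut w) = palAut (flipHom w) := by
  have : flipHom.comp palAut.toMonoidHom = palAut.toMonoidHom.comp flipHom := by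
    ext i
    fin_cases i <;> simp [flipHom, palAut, mul_assoc]
  exact DFunLike.congr_fun this w

/-- The endomorphism `τ` of `A` with `a ↦ a⁻¹`, `b ↦ b⁻¹`, `t ↦ t`. -/
def tau (n : ℕ) : FreeByCyclic n →* FreeByCyclic n :=
  SemidirectProduct.map flipHom (MonoidHom.id _) <| by
    have hmem : ∀ ψ : MulAut F₂, ψ ∈ Subgroup.zpowers (palAut ^ n) →
        ∀ w, flipHom (ψ w) = ψ (flipHom w) := by
      let P : Subgroup (MulAut F₂) :=
        { carrier := {ψ | ∀ w, flipHom (ψ w) = ψ (flipHom w)}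
          one_mem' := fun w => rfl
          mul_mem' := fun {x y} hx hy w => by
            rw [MulAut.mul_apply, hx, hy, MulAut.mul_apply]
          inv_mem' := fun {x} hx w => by
            apply x.injective
            rw [← hx, MulAut.apply_inv_self, MulAut.apply_inv_self] }
      have : palAut ^ n ∈ P := P.pow_mem flipHom_palAut n
      exact fun ψ hψ => (Subgroup.zpowers_le.2 this) hψ
    intro g
    ext1 i
    exact hmem _ ⟨Multiplicative.toAdd g, rfl⟩ _

/-! ### The groups `B_m` -/

/-- The relative presentation `⟨G, t | t f(k) t⁻¹ = g(k) for k ∈ K⟩` for injective homomorphisms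
`f, g : K → G`: the HNN extension of `G` with `f(K)` and `g(K)` associated. -/
abbrev HNN {G K : Type*} [Group G] [Group K] (f g : K →* G) (hf : Function.Injective f)
    (hg : Function.Injective g) : Type _ :=
  HNNExtension G f.range g.range
    ((MonoidHom.ofInjective hf).symm.trans (MonoidHom.ofInjective hg))

section Tower

variable {n : ℕ} {C : Type} [Group C]

/-- The vertex groups `C` and `A_x × A_y × A_z` of the amalgam. -/
def VertexGroup (n : ℕ) (C : Type) : Bool → Type
  | false => C
  | true => FreeByCyclic n × FreeByCyclic n × FreeByCyclic n

instance VertexGroup.instGroup : ∀ i, Group (VertexGroup n C i)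
  | false => inferInstanceAs (Group C)
  | true => inferInstanceAs (Group (FreeByCyclic n × FreeByCyclic n × FreeByCyclic n))

/-- The maps of the edge group `A_d` to the vertex groups: to `C` by `ι`, and to `A_x × A_y × A_z` by
`d_i ↦ x_i y_i⁻¹`, `t_d ↦ t_x t_y`. -/
def edgeMap (ι : FreeByCyclic n →* C) : ∀ i, FreeByCyclic n →* VertexGroup n C i
  | false => ι
  | true => (MonoidHom.id (FreeByCyclic n)).prod ((tau n).prod 1)

/-- `C ∗_{A_d} (A_x × A_y × A_z)`. -/
abbrev Amalgam (ι : FreeByCyclic n →* C) : Type := Monoid.PushoutI (edgeMap ι)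

/-- `B₁ = (C ∗_{A_d} (A_x × A_y × A_z)) × ⟨s₁⟩`. -/
abbrev BaseGroup (ι : FreeByCyclic n →* C) : Type := Amalgam ι × Multiplicative ℤ

/-- The inclusion of `A_x × A_y × A_z`. -/
def triple (ι : FreeByCyclic n →* C) :
    FreeByCyclic n × FreeByCyclic n × FreeByCyclic n →* BaseGroup ι :=
  (MonoidHom.inl (Amalgam ι) (Multiplicative ℤ)).comp
    (Monoid.PushoutI.of (φ := edgeMap ι) true)

/-- `A → A_{xz}`: `a ↦ x₁z₁`, `b ↦ x₂z₂`, `t ↦ t_x t_z`. -/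
def diagXZ (ι : FreeByCyclic n →* C) : FreeByCyclic n →* BaseGroup ι :=
  (triple ι).comp ((MonoidHom.id _).prod ((1 : FreeByCyclic n →* FreeByCyclic n).prod
    (MonoidHom.id _)))

/-- `A → A_{yz}`: `a ↦ y₁z₁`, `b ↦ y₂z₂`, `t ↦ t_y t_z`. -/
def diagYZ (ι : FreeByCyclic n →* C) : FreeByCyclic n →* BaseGroup ι :=
  (triple ι).comp ((1 : FreeByCyclic n →* FreeByCyclic n).prod ((MonoidHom.id _).prod
    (MonoidHom.id _)))

/-- The projection of the vertex groups to `A_z`, trivial on `C`. -/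
def projZVertex : ∀ i, VertexGroup n C i →* FreeByCyclic n
  | false => (1 : C →* FreeByCyclic n)
  | true => (MonoidHom.snd (FreeByCyclic n) (FreeByCyclic n)).comp
      (MonoidHom.snd (FreeByCyclic n) (FreeByCyclic n × FreeByCyclic n))

/-- The retraction of `B₁` to `A_z`. -/
def projZ (ι : FreeByCyclic n →* C) : BaseGroup ι →* FreeByCyclic n :=
  (Monoid.PushoutI.lift (φ := edgeMap ι) projZVertex 1 (by
    intro i
    cases i
    · rfl
    · rfl)).comp (MonoidHom.fst _ _)

theorem projZ_triple (ι : FreeByCyclic n →* C)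
    (p : FreeByCyclic n × FreeByCyclic n × FreeByCyclic n) : projZ ι (triple ι p) = p.2.2 := by
  simp only [projZ, triple, MonoidHom.comp_apply, MonoidHom.coe_fst]
  erw [Monoid.PushoutI.lift_of]
  rfl

theorem diagXZ_injective (ι : FreeByCyclic n →* C) : Function.Injective (diagXZ ι) :=
  Function.LeftInverse.injective (g := projZ ι) fun _ => projZ_triple ι _

theorem diagYZ_injective (ι : FreeByCyclic n →* C) : Function.Injective (diagYZ ι) :=
  Function.LeftInverse.injective (g := projZ ι) fun _ => projZ_triple ι _

/-- A group with two distinguished elements of infinite order, in the role of `B_m`, `s₁`, `s_m`. -/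
structure Stage where
  carrier : Type
  [group : Group carrier]
  s₁ : carrier
  s : carrier
  s₁_inj : Function.Injective (zpowersHom carrier s₁)
  s_inj : Function.Injective (zpowersHom carrier s)

attribute [instance] Stage.group

theorem HNN.t_inj {G K : Type*} [Group G] [Group K] (f g : K →* G) (hf : Function.Injective f)
    (hg : Function.Injective g) :
    Function.Injective (zpowersHom (HNN f g hf hg) HNNExtension.t) := by
  let p : HNN f g hf hg →* Multiplicative ℤ :=
    HNNExtension.lift 1 (Multiplicative.ofAdd 1) (by intro a; simp)
  refine Function.LeftInverse.injective (g := p) fun k => ?_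
  rw [zpowersHom_apply, map_zpow, HNNExtension.lift_t, ← ofAdd_zsmul]
  simp

theorem HNN.of_inj {G K : Type*} [Group G] [Group K] (f g : K →* G) (hf : Function.Injective f)
    (hg : Function.Injective g) {c : G} (hc : Function.Injective (zpowersHom G c)) :
    Function.Injective (zpowersHom (HNN f g hf hg) (HNNExtension.of c)) := by
  intro k l h
  apply hc
  apply HNNExtension.of_injective
    (φ := (MonoidHom.ofInjective hf).symm.trans (MonoidHom.ofInjective hg))
  simpa [zpowersHom_apply, map_zpow] using h

theorem base_inj (ι : FreeByCyclic n →* C) :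
    Function.Injective (zpowersHom (BaseGroup ι) (1, Multiplicative.ofAdd 1)) :=
  Function.LeftInverse.injective (g := MonoidHom.snd _ _) fun k => by
    rw [zpowersHom_apply, map_zpow, MonoidHom.coe_snd, ← ofAdd_zsmul]
    simp

/-- `B₁` with `s₁`. -/
abbrev stage₁ (ι : FreeByCyclic n →* C) : Stage where
  carrier := BaseGroup ι
  s₁ := (1, Multiplicative.ofAdd 1)
  s := (1, Multiplicative.ofAdd 1)
  s₁_inj := base_inj ι
  s_inj := base_inj ι

/-- `B₂ = ⟨B₁, s₂ | s₂⁻¹ (x_i z_i) s₂ = y_i z_i, s₂⁻¹ (t_x t_z) s₂ = t_y t_z⟩` with `s₁`, `s₂`. -/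
abbrev stage₂ (ι : FreeByCyclic n →* C) : Stage where
  carrier := HNN (diagYZ ι) (diagXZ ι) (diagYZ_injective ι) (diagXZ_injective ι)
  s₁ := HNNExtension.of (stage₁ ι).s₁
  s := HNNExtension.t
  s₁_inj := HNN.of_inj _ _ _ _ (stage₁ ι).s₁_inj
  s_inj := HNN.t_inj _ _ _ _

/-- `B_{m+1} = ⟨B_m, s_{m+1} | s_{m+1}⁻¹ s₁ s_{m+1} = s_m⟩` with `s₁`, `s_{m+1}`. -/
abbrev Stage.next (T : Stage) : Stage where
  carrier := HNN (zpowersHom T.carrier T.s) (zpowersHom T.carrier T.s₁) T.s_inj T.s₁_inj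
  s₁ := HNNExtension.of T.s₁
  s := HNNExtension.t
  s₁_inj := HNN.of_inj _ _ _ _ T.s₁_inj
  s_inj := HNN.t_inj _ _ _ _

/-- The groups `B_m` for `m ≥ 1` (with `B₀ = B₁` by convention). -/
def tower (ι : FreeByCyclic n →* C) : ℕ → Stage
  | 0 => stage₁ ι
  | 1 => stage₁ ι
  | 2 => stage₂ ι
  | m + 3 => (tower ι (m + 2)).next

/-- The group `B_m`. -/
abbrev B (ι : FreeByCyclic n →* C) (m : ℕ) : Type := (tower ι m).carrier

/-- The element `s_m` of `B_m`. -/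
def s (ι : FreeByCyclic n →* C) (m : ℕ) : B ι m := (tower ι m).s

end Tower

end CatDiv

end

noncomputable section

namespace CatDiv

/-! ### Walks with costs -/

/-! Both bounds climb the tower by induction and gain one factor of r per stage.

Upper bound. Write u = s₁. In each B_m it lies in a flat ⟨u, p⟩ on which two homomorphisms η, θ to ℤ
are coordinates, and |η| + |θ| is at most a constant times the word norm. `FlatData` with exponent e
says that u^N and w u^N, for w a generator, are joined far out in these coordinates by walks of
length O(N^e). A point g of norm about r is joined to u^N, N = Mr, by running along g⟨u⟩ to g u^N
and then erasing the O(r) letters of g one at a time, for O(r^e) each; the total is O(r^(e+1))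
(`FlatData.exists_far_walk`). In B₁ the element u is central and e = 0. For s₂ one walks through two
flats, at linear cost. For later letters t the relation t s_m^N = u^N t reduces the task to joining
s_m^N to u^N, which costs one more power of N (`FlatData.walk_pow`). Hence e = m - 1 in B_m.

Lower bound. Let t be the stable letter of an HNN extension with associated subgroups A and B.
`LineBound` concerns walks from a base group element g ≠ 1 to the line ⟨t⟩, where jumps inside
cosets of the base group must stay far from 1 but steps along t are free everywhere. The line is
first reached by a jump, hence at t^l with |l| ≥ r, so the walk crosses about ρ consecutive edges of
the axis of t in the Bass-Serre tree. Between two of them it goes from t^i a to t^i b with a in A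
and b in B, not both trivial. If it stays far from t^i inside the coset t^i G, excursions out of the
coset can be replaced by jumps along A and B, and a lower bound between A and B in the base group
applies (`SubgroupBound`). If it meets the coset near t^i, translating the meeting point to 1 gives
another walk to the line, and the line bound already known applies (`crossing_bound`). So the
exponent of the line bound grows by one at a time until it exceeds that of the subgroup bound by one
(`lineBound_succ`). Because steps along t are free, a line bound is in turn a subgroup bound for ⟨t⟩
and ⟨s₁⟩ (`subgroupBound_of_lineBound`), the subgroups associated at the next stage.

The induction starts with the retraction of B₁ to C, which kills A_yz and maps A_xz isomorphically
to A_d. The latter is undistorted in C by the Milnor-Schwarz argument, so the distance between far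
points of A_yz and A_xz is at least linear. Finally, a walk from s_m^(-k) to s_m^l must cross the
edge from 1 to s_m, and its remainder is a walk to the line (`axisBound_of_lineBound`). For m = 1
the linear term in the definition of ≼ makes the lower bound trivial. Paths in Cayley graphs are
compared with these walks by cutting them into jumps of bounded length. -/

/-- `CostWalk R x y n`: there is a walk from `x` to `y` of total cost `n`, where `R p q k` means that a
step from `p` to `q` of cost `k` is allowed. -/
inductive CostWalk {V : Type*} (R : V → V → ℕ → Prop) : V → V → ℕ → Prop
  | nil (x : V) : CostWalk R x x 0
  | cons {x y z : V} {k n : ℕ} (h : R x y k) (w : CostWalk R y z n) : CostWalk R x z (k + n)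

namespace CostWalk

variable {V W : Type*} {R R' : V → V → ℕ → Prop} {x y z : V} {k m n : ℕ}

theorem single (h : R x y k) : CostWalk R x y k := by
  simpa using cons h (nil y)

theorem append (w : CostWalk R x y m) (w' : CostWalk R y z n) : CostWalk R x z (m + n) := by
  induction w with
  | nil => simpa using w'
  | cons h _ ih =>
    rw [add_assoc]
    exact cons h (ih w')

theorem reverse (hR : ∀ x y k, R x y k → R y x k) (w : CostWalk R x y n) : CostWalk R y x n := by
  induction w with
  | nil => exact nil _
  | cons h _ ih =>
    rw [add_comm]
    exact ih.append (single (hR _ _ _ h))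

theorem map {R' : W → W → ℕ → Prop} (f : V → W) (h : ∀ x y k, R x y k → R' (f x) (f y) k)
    (w : CostWalk R x y n) : CostWalk R' (f x) (f y) n := by
  induction w with
  | nil => exact nil _
  | cons hs _ ih => exact cons (h _ _ _ hs) ih

theorem mono (h : ∀ x y k, R x y k → R' x y k) (w : CostWalk R x y n) : CostWalk R' x y n :=
  w.map id h

/-- Walks of different kinds are compared through this lemma. The factor `c` that it loses is
regained by applying bounds at scale cρ, since (cρ)^e ≥ c ρ^e for e ≥ 1. -/
theorem refine {R' : W → W → ℕ → Prop} (f : V → W) (c : ℕ)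
    (h : ∀ x y k, R x y k → ∃ k' ≤ c * k, CostWalk R' (f x) (f y) k')
    (w : CostWalk R x y n) : ∃ n' ≤ c * n, CostWalk R' (f x) (f y) n' := by
  induction w with
  | nil => exact ⟨0, by simp, nil _⟩
  | cons hs _ ih =>
    obtain ⟨k', hk', w'⟩ := h _ _ _ hs
    obtain ⟨n', hn', w''⟩ := ih
    exact ⟨k' + n', by rw [mul_add]; omega, w'.append w''⟩

/-- A function that grows along a walk grows along some step of it. -/
theorem exists_step_lt (f : V → ℤ) (w : CostWalk R x y n) (h : f x < f y) :
    ∃ p q k n₁ n₂, CostWalk R x p n₁ ∧ R p q k ∧ f p < f q ∧ CostWalk R q y n₂ ∧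
      n = n₁ + k + n₂ := by
  induction w with
  | nil => exact absurd h (lt_irrefl _)
  | @cons x z y k n hs w ih =>
    by_cases h1 : f x < f z
    · exact ⟨x, z, k, 0, n, nil _, hs, h1, w, by omega⟩
    · obtain ⟨p, q, k', n₁, n₂, h2, h3, h4, h5, h6⟩ := ih (by omega)
      exact ⟨p, q, k', k + n₁, n₂, cons hs h2, h3, h4, h5, by omega⟩

/-- A walk that ends in `Z` can be stopped at its first visit to `Z`. -/
theorem first_visit (Z : Set V) (w : CostWalk R x y n) (hy : y ∈ Z) :
    ∃ z ∈ Z, ∃ m ≤ n, CostWalk (fun p q k => R p q k ∧ p ∉ Z) x z m := by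
  induction w with
  | nil => exact ⟨_, hy, 0, le_rfl, nil _⟩
  | @cons x z y k n hs w ih =>
    by_cases h1 : x ∈ Z
    · exact ⟨x, h1, 0, by omega, nil _⟩
    · obtain ⟨z', hz', m, hm, w'⟩ := ih hy
      exact ⟨z', hz', k + m, by omega, cons ⟨hs, h1⟩ w'⟩

/-- The last step of a nontrivial walk. -/
theorem exists_last (w : CostWalk R x y n) (hxy : x ≠ y) : ∃ p k m, CostWalk R x p m ∧ R p y k ∧
    n = m + k := by
  have key : (x = y ∧ n = 0) ∨ ∃ p k m, CostWalk R x p m ∧ R p y k ∧ n = m + k := by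
    clear hxy
    induction w with
    | nil => exact Or.inl ⟨rfl, rfl⟩
    | @cons x z y k n hs w ih =>
      right
      rcases ih with ⟨rfl, rfl⟩ | ⟨p, k', m, h2, h3, h4⟩
      · exact ⟨x, k, 0, nil _, hs, by omega⟩
      · exact ⟨p, k', k + m, cons hs h2, h3, by omega⟩
  exact key.resolve_left fun h => hxy h.1

/-- Either all steps of a walk have good endpoints, or the walk passes through a bad point. -/
theorem good_or_split (Q : V → Prop) (w : CostWalk R x y n) :
    CostWalk (fun p q k => R p q k ∧ Q p ∧ Q q) x y n ∨
      ∃ z n₁ n₂, ¬ Q z ∧ CostWalk R x z n₁ ∧ CostWalk R z y n₂ ∧ n = n₁ + n₂ := by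
  induction w with
  | nil => exact Or.inl (nil _)
  | @cons x z y k n hs w ih =>
    rcases ih with h | ⟨z', n₁, n₂, h1, h2, h3, h4⟩
    · by_cases hx : Q x
      · by_cases hz : Q z
        · exact Or.inl (cons ⟨hs, hx, hz⟩ h)
        · exact Or.inr ⟨z, k, n, hz, single hs, w, rfl⟩
      · exact Or.inr ⟨x, 0, k + n, hx, nil _, cons hs w, by omega⟩
    · exact Or.inr ⟨z', k + n₁, n₂, h1, cons hs h2, h3, by omega⟩

/-- A walk on integers translated to a walk along `f`. -/
theorem of_nat (f : ℕ → V) (N : ℕ) (h : ∀ i < N, R (f i) (f (i + 1)) 1) :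
    CostWalk R (f 0) (f N) N := by
  induction N with
  | zero => exact nil _
  | succ N ih => exact (ih fun i hi => h i (by omega)).append (single (h N (by omega)))

end CostWalk

/-! ### Word norms -/

section Norm

variable {G : Type*} [Group G]

/-- The word norm of `g` for the generating set `S`. -/
def nrm (S : Set G) (g : G) : ℕ := (SimpleGraph.mulCayley S).dist 1 g

/-- Multiplication by a generator or its inverse, with cost one. -/
def GenStep (S : Set G) (x y : G) (k : ℕ) : Prop := (x⁻¹ * y ∈ S ∨ y⁻¹ * x ∈ S) ∧ k = 1

theorem GenStep.symm {S : Set G} {x y : G} {k : ℕ} (h : GenStep S x y k) : GenStep S y x k :=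
  ⟨h.1.symm, h.2⟩

variable {S : Set G}

theorem walk_of_connected (x y : G) (w : (SimpleGraph.mulCayley S).Walk x y) :
    CostWalk (GenStep S) x y w.length := by
  induction w with
  | nil => exact CostWalk.nil _
  | cons h p ih =>
    rw [SimpleGraph.Walk.length_cons, add_comm]
    exact CostWalk.cons ⟨((SimpleGraph.mulCayley_adj S _ _).1 h).2, rfl⟩ ih

theorem dist_le_of_walk (hS : Subgroup.closure S = ⊤) {x y : G} {n : ℕ}
    (w : CostWalk (GenStep S) x y n) : (SimpleGraph.mulCayley S).dist x y ≤ n := by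
  induction w with
  | nil => simp
  | @cons x z y k n h _ ih =>
    refine ((mulCayley_connected hS).dist_triangle (v := z)).trans (add_le_add ?_ ih)
    by_cases hxz : x = z
    · simp [hxz]
    · rw [SimpleGraph.dist_eq_one_iff_adj.2 ((SimpleGraph.mulCayley_adj S _ _).2 ⟨hxz, h.1⟩), h.2]

theorem exists_genWalk (hS : Subgroup.closure S = ⊤) (x y : G) :
    CostWalk (GenStep S) x y ((SimpleGraph.mulCayley S).dist x y) := by
  obtain ⟨w, hw⟩ := (mulCayley_connected hS).exists_walk_length_eq_dist x y
  rw [← hw]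
  exact walk_of_connected _ _ w

theorem genWalk_mul_left (g : G) {x y : G} {n : ℕ} (w : CostWalk (GenStep S) x y n) :
    CostWalk (GenStep S) (g * x) (g * y) n :=
  w.map (fun x => g * x) fun x y k h => by simpa [GenStep, mul_assoc] using h

theorem dist_eq_nrm (hS : Subgroup.closure S = ⊤) (x y : G) :
    (SimpleGraph.mulCayley S).dist x y = nrm S (x⁻¹ * y) := by
  apply le_antisymm
  · have := dist_le_of_walk hS (genWalk_mul_left x (exists_genWalk hS 1 (x⁻¹ * y)))
    simpa [nrm] using this
  · have := dist_le_of_walk hS (genWalk_mul_left x⁻¹ (exists_genWalk hS x y))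
    simpa [nrm] using this

@[simp] theorem nrm_one : nrm S 1 = 0 := by simp [nrm]

theorem nrm_mul (hS : Subgroup.closure S = ⊤) (x y : G) : nrm S (x * y) ≤ nrm S x + nrm S y := by
  have := (mulCayley_connected hS).dist_triangle (u := 1) (v := x) (w := x * y)
  rw [dist_eq_nrm hS x] at this
  simpa [nrm] using this

theorem nrm_inv (hS : Subgroup.closure S = ⊤) (x : G) : nrm S x⁻¹ = nrm S x := by
  have := dist_eq_nrm hS x 1
  rw [mul_one, SimpleGraph.dist_comm] at this
  exact this.symm

theorem nrm_le_of_walk (hS : Subgroup.closure S = ⊤) {x y : G} {n : ℕ}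
    (w : CostWalk (GenStep S) x y n) : nrm S (x⁻¹ * y) ≤ n := by
  rw [← dist_eq_nrm hS]
  exact dist_le_of_walk hS w

theorem nrm_le_one (hS : Subgroup.closure S = ⊤) {x : G} (hx : x ∈ S) : nrm S x ≤ 1 := by
  have := nrm_le_of_walk hS (CostWalk.single (R := GenStep S) (x := 1) (y := x) (k := 1)
    ⟨Or.inl (by simpa using hx), rfl⟩)
  simpa using this

theorem nrm_eq_zero (hS : Subgroup.closure S = ⊤) {x : G} : nrm S x = 0 ↔ x = 1 := by
  rw [nrm, (mulCayley_connected hS).dist_eq_zero_iff, eq_comm]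

theorem nrm_walk (hS : Subgroup.closure S = ⊤) (x : G) : CostWalk (GenStep S) 1 x (nrm S x) :=
  exists_genWalk hS 1 x

theorem nrm_zpow (hS : Subgroup.closure S = ⊤) (x : G) (k : ℤ) :
    nrm S (x ^ k) ≤ k.natAbs * nrm S x := by
  have key : ∀ k : ℕ, nrm S (x ^ k) ≤ k * nrm S x := by
    intro k
    induction k with
    | zero => simp
    | succ k ih =>
      rw [pow_succ]
      refine (nrm_mul hS _ _).trans ?_
      rw [add_mul, one_mul]
      omega
  obtain ⟨k, rfl | rfl⟩ := k.eq_nat_or_neg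
  · simpa using key k
  · simpa [nrm_inv hS] using key k

theorem nrm_sub_le (hS : Subgroup.closure S = ⊤) (x y : G) :
    nrm S x ≤ nrm S y + nrm S (y⁻¹ * x) := by
  have := nrm_mul hS y (y⁻¹ * x)
  simpa using this

/-- A subadditive function that is bounded on a generating set is bounded by a multiple of the word
norm. -/
theorem le_mul_nrm (hS : Subgroup.closure S = ⊤) (ν : G → ℝ) (D : ℝ) (h1 : ν 1 ≤ 0)
    (hmul : ∀ x y, ν (x * y) ≤ ν x + ν y) (hs : ∀ s ∈ S, ν s ≤ D ∧ ν s⁻¹ ≤ D) (g : G) :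
    ν g ≤ D * nrm S g := by
  have key : ∀ {x y : G} {n : ℕ}, CostWalk (GenStep S) x y n → ν (x⁻¹ * y) ≤ D * n := by
    intro x y n w
    induction w with
    | nil => simpa using h1
    | @cons x z y k n h _ ih =>
      have h2 := hmul (x⁻¹ * z) (z⁻¹ * y)
      have h3 : ν (x⁻¹ * z) ≤ D := by
        rcases h.1 with h | h
        · exact (hs _ h).1
        · simpa using (hs _ h).2
      rw [h.2]
      push_cast
      simp only [mul_assoc, mul_inv_cancel_left] at h2
      linarith
  simpa using key (nrm_walk hS g)

theorem exists_le_mul_nrm (hS : Subgroup.closure S = ⊤) (hfin : S.Finite) (ν : G → ℕ)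
    (h1 : ν 1 = 0) (hmul : ∀ x y, ν (x * y) ≤ ν x + ν y) (hinv : ∀ x, ν x⁻¹ = ν x) :
    ∃ D : ℕ, 1 ≤ D ∧ ∀ g, ν g ≤ D * nrm S g := by
  obtain ⟨D, hD⟩ := (hfin.image ν).bddAbove
  refine ⟨D + 1, by omega, fun g => ?_⟩
  have hb : ∀ s ∈ S, ν s ≤ D := fun s hs => hD ⟨s, hs, rfl⟩
  have := le_mul_nrm hS (fun g => (ν g : ℝ)) (D + 1 : ℕ) (by simp [h1])
    (fun x y => by exact_mod_cast hmul x y)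
    (fun s hs => by
      have := hb s hs
      constructor
      · exact_mod_cast this.trans (by omega)
      · rw [hinv]; exact_mod_cast this.trans (by omega)) g
  exact_mod_cast this

/-- Homomorphisms from finitely generated groups are Lipschitz. -/
theorem exists_nrm_map_le {H : Type*} [Group H] {T : Set H} (hS : Subgroup.closure S = ⊤)
    (hfin : S.Finite) (hT : Subgroup.closure T = ⊤) (f : G →* H) :
    ∃ D : ℕ, 1 ≤ D ∧ ∀ g, nrm T (f g) ≤ D * nrm S g :=
  exists_le_mul_nrm hS hfin (fun g => nrm T (f g)) (by simp)
    (fun x y => by rw [map_mul]; exact nrm_mul hT _ _)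
    (fun x => by rw [map_inv]; exact nrm_inv hT _)

end Norm

end CatDiv
end

/-! ### Walls of the Bass-Serre tree and walks in HNN extensions -/

noncomputable section

namespace CatDiv

/-- A length function on a group. -/
structure IsNorm {G : Type*} [Group G] (N : G → ℕ) : Prop where
  one : N 1 = 0
  mul : ∀ x y, N (x * y) ≤ N x + N y
  inv : ∀ x, N x⁻¹ = N x

theorem isNorm_nrm {G : Type*} [Group G] {S : Set G} (hS : Subgroup.closure S = ⊤) :
    IsNorm (nrm S) :=
  ⟨nrm_one, nrm_mul hS, nrm_inv hS⟩

/-- A jump by an element of `J` between points at norm at least `r`; the cost is the norm of the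
jump. -/
def JumpStep {G : Type*} [Group G] (N : G → ℕ) (J : Set G) (r : ℕ) (x y : G) (k : ℕ) : Prop :=
  x⁻¹ * y ∈ J ∧ r ≤ N x ∧ r ≤ N y ∧ k = N (x⁻¹ * y)

section HNN

open HNNExtension

variable {G : Type*} [Group G] {A B : Subgroup G} {φ : A ≃* B}

/-- The exponent sum of the stable letter. -/
def stableExp : HNNExtension G A B φ →* Multiplicative ℤ :=
  HNNExtension.lift 1 (Multiplicative.ofAdd 1) (by intro a; simp)

@[simp] theorem stableExp_of (g : G) : stableExp (φ := φ) (of g) = 1 := by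
  simp [stableExp]

@[simp] theorem stableExp_t : stableExp (φ := φ) t = Multiplicative.ofAdd 1 := by
  simp [stableExp]

@[simp] theorem toAdd_stableExp_zpow (l : ℤ) :
    Multiplicative.toAdd (stableExp (φ := φ) (t ^ l)) = l := by
  rw [map_zpow, stableExp_t, ← ofAdd_zsmul]
  simp

open Classical in
/-- The signed number of crossings of the edge from `1` to `t` of the Bass-Serre tree. -/
theorem exists_wall : ∃ w : HNNExtension G A B φ → ℤ, w 1 = 0 ∧ (∀ x g, w (x * of g) = w x) ∧
    ∀ x, w (x * t) = w x + if ∃ b ∈ B, x = of b then 1 else 0 := by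
  -- The function sought is a crossed homomorphism, so it is read off a homomorphism to the
  -- semidirect product of the group of functions with the HNN extension. The relation for t is
  -- respected because the indicator `f₀` of B is invariant under left translation by B.
  let f₀ : HNNExtension G A B φ → Multiplicative ℤ := fun x =>
    if ∃ b ∈ B, x = of b then Multiplicative.ofAdd 1 else 1
  have hf₀ : ∀ b ∈ B, ∀ x : HNNExtension G A B φ, f₀ (of b * x) = f₀ x := by
    intro b hb x
    have : (∃ b' ∈ B, (of b : HNNExtension G A B φ) * x = of b') ↔ ∃ b' ∈ B, x = of b' := by
      constructor
      · rintro ⟨b', hb', h⟩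
        exact ⟨b⁻¹ * b', B.mul_mem (B.inv_mem hb) hb', by rw [map_mul, ← h]; simp⟩
      · rintro ⟨b', hb', rfl⟩
        exact ⟨b * b', B.mul_mem hb hb', by simp⟩
    simp only [f₀, this]
  let act : HNNExtension G A B φ →* MulAut (HNNExtension G A B φ → Multiplicative ℤ) := mulAutArrow
  have hact : ∀ (g : HNNExtension G A B φ) (f : HNNExtension G A B φ → Multiplicative ℤ) (x : HNNExtension G A B φ), act g f x = f (g⁻¹ * x) :=
    fun g f x => rfl
  let F : HNNExtension G A B φ →*
      (HNNExtension G A B φ → Multiplicative ℤ) ⋊[act] HNNExtension G A B φ :=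
    HNNExtension.lift (SemidirectProduct.inr.comp of) ⟨f₀, t⟩ (by
      intro a
      apply SemidirectProduct.ext
      · funext x
        have := hf₀ ((φ a : G)⁻¹) (B.inv_mem (φ a).2) x
        rw [map_inv] at this
        simp [hact, this]
      · simp [t_mul_of])
  have hFr : ∀ x : HNNExtension G A B φ, (F x).right = x := by
    have : SemidirectProduct.rightHom.comp F = MonoidHom.id (HNNExtension G A B φ) :=
      hom_ext (by ext g; simp [F]) (by simp [F])
    exact fun x => DFunLike.congr_fun this x
  refine ⟨fun x => Multiplicative.toAdd ((F x).left 1), by simp, fun x g => ?_, fun x => ?_⟩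
  · show Multiplicative.toAdd ((F (x * of g)).left 1) = _
    have h1 : F (of g) = SemidirectProduct.inr (of g) := by simp [F]
    rw [map_mul, SemidirectProduct.mul_left, h1]
    simp
  · have h1 : F t = ⟨f₀, t⟩ := lift_t _ _ _
    have h2 : (∃ b ∈ B, (x⁻¹ : HNNExtension G A B φ) = of b) ↔ ∃ b ∈ B, x = of b := by
      constructor
      · rintro ⟨b, hb, h⟩
        exact ⟨b⁻¹, B.inv_mem hb, by rw [map_inv, ← h, inv_inv]⟩
      · rintro ⟨b, hb, rfl⟩
        exact ⟨b⁻¹, B.inv_mem hb, by simp⟩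
    have h3 : f₀ x⁻¹ = f₀ x := by simp only [f₀, h2]
    show Multiplicative.toAdd ((F (x * t)).left 1) = _
    rw [map_mul, SemidirectProduct.mul_left, h1]
    simp only [Pi.mul_apply, hact, hFr, mul_one, h3, toAdd_mul]
    congr 1

/-- A choice of the crossing number of `exists_wall`. -/
def wall (x : HNNExtension G A B φ) : ℤ := exists_wall.choose x

@[simp] theorem wall_one : wall (1 : HNNExtension G A B φ) = 0 := exists_wall.choose_spec.1

@[simp] theorem wall_mul_of (x : HNNExtension G A B φ) (g : G) : wall (x * of g) = wall x :=
  exists_wall.choose_spec.2.1 x g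

@[simp] theorem wall_of (g : G) : wall (of g : HNNExtension G A B φ) = 0 := by
  rw [← one_mul (of g), wall_mul_of, wall_one]

theorem wall_mul_t_of_mem {x : HNNExtension G A B φ} {b : G} (hb : b ∈ B) (hx : x = of b) :
    wall (x * t) = wall x + 1 := by
  classical
  have := exists_wall.choose_spec.2.2 x
  rw [if_pos ⟨b, hb, hx⟩] at this
  exact this

theorem wall_mul_t_of_notMem {x : HNNExtension G A B φ} (hx : ¬ ∃ b ∈ B, x = of b) :
    wall (x * t) = wall x := by
  classical
  have := exists_wall.choose_spec.2.2 x
  rw [if_neg hx, add_zero] at this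
  exact this

theorem t_zpow_ne_of {l : ℤ} (hl : l ≠ 0) (g : G) : (t ^ l : HNNExtension G A B φ) ≠ of g := by
  intro h
  have := congrArg (fun x => Multiplicative.toAdd (stableExp x)) h
  simp [hl] at this

theorem of_mem_zpowers_t {g : G} (h : (of g : HNNExtension G A B φ) ∈ Subgroup.zpowers t) :
    g = 1 := by
  obtain ⟨l, hl⟩ := h
  by_cases h0 : l = 0
  · apply of_injective (φ := φ)
    simp [← hl, h0]
  · exact absurd hl (t_zpow_ne_of h0 g)

/-- Only the first step of the ray 1, t, t², … starts in B; the later points have nonzero exponent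
sum and so lie outside the base group. -/
theorem wall_t_pow_succ (k : ℕ) : wall (t ^ (k + 1) : HNNExtension G A B φ) = 1 := by
  induction k with
  | zero =>
    have := wall_mul_t_of_mem (φ := φ) B.one_mem (map_one of).symm
    simpa using this
  | succ k ih =>
    rw [pow_succ, wall_mul_t_of_notMem, ih]
    rintro ⟨b, _, h⟩
    exact t_zpow_ne_of (l := (k + 1 : ℕ)) (by omega) b (by rw [zpow_natCast]; exact h)

theorem wall_t_pow_neg (k : ℕ) : wall ((t ^ k)⁻¹ : HNNExtension G A B φ) = 0 := by
  induction k with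
  | zero => simp
  | succ k ih =>
    have : ((t ^ k)⁻¹ : HNNExtension G A B φ) = (t ^ (k + 1))⁻¹ * t := by
      rw [pow_succ', mul_inv_rev]; simp
    rw [this, wall_mul_t_of_notMem] at ih
    · exact ih
    rintro ⟨b, _, h⟩
    exact t_zpow_ne_of (l := -(k + 1 : ℕ)) (by omega) b (by rw [zpow_neg, zpow_natCast]; exact h)

theorem wall_t_zpow_pos {l : ℤ} (hl : 0 < l) : wall (t ^ l : HNNExtension G A B φ) = 1 := by
  obtain ⟨k, rfl⟩ : ∃ k : ℕ, l = (k + 1 : ℕ) := ⟨(l - 1).toNat, by omega⟩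
  rw [zpow_natCast]
  exact wall_t_pow_succ k

theorem wall_t_zpow_nonpos {l : ℤ} (hl : l ≤ 0) : wall (t ^ l : HNNExtension G A B φ) = 0 := by
  obtain ⟨k, rfl⟩ : ∃ k : ℕ, l = -(k : ℤ) := ⟨(-l).toNat, by omega⟩
  rw [zpow_neg, zpow_natCast]
  exact wall_t_pow_neg k

/-- A step in an HNN extension: either a jump by an element of `J` between points at norm at least `r`,
or a step along a line of the stable letter, which is unrestricted and has cost one. -/
def HNNStep (N : HNNExtension G A B φ → ℕ) (J : Set G) (r : ℕ) (x y : HNNExtension G A B φ)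
    (k : ℕ) : Prop :=
  (∃ h ∈ J, y = x * of h ∧ r ≤ N x ∧ r ≤ N y ∧ k = N (of h)) ∨ ((y = x * t ∨ x = y * t) ∧ k = 1)

variable {N' : HNNExtension G A B φ → ℕ} {N : G → ℕ} {J : Set G} {r k n : ℕ}
  {x y : HNNExtension G A B φ}

theorem HNNStep.symm (hN : IsNorm N') (hJ : ∀ h ∈ J, h⁻¹ ∈ J) (h : HNNStep N' J r x y k) :
    HNNStep N' J r y x k := by
  rcases h with ⟨h, hh, rfl, h1, h2, rfl⟩ | ⟨h, rfl⟩
  · exact Or.inl ⟨h⁻¹, hJ h hh, by simp, h2, h1, by rw [map_inv, hN.inv]⟩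
  · exact Or.inr ⟨h.symm, rfl⟩

/-- Translation by `c` changes norms by at most `N' c`, and steps along t carry no norm condition
that could be lost. -/
theorem HNNStep.translate (hN : IsNorm N') {r' : ℕ} {c : HNNExtension G A B φ}
    (hc : N' c + r' ≤ r) (h : HNNStep N' J r x y k) : HNNStep N' J r' (c * x) (c * y) k := by
  have key : ∀ z, r ≤ N' z → r' ≤ N' (c * z) := by
    intro z hz
    have := hN.mul c⁻¹ (c * z)
    rw [inv_mul_cancel_left, hN.inv] at this
    omega
  rcases h with ⟨h, hh, rfl, h1, h2, rfl⟩ | ⟨rfl | rfl, rfl⟩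
  · exact Or.inl ⟨h, hh, by rw [mul_assoc], key _ h1, key _ h2, rfl⟩
  · exact Or.inr ⟨Or.inl (by rw [mul_assoc]), rfl⟩
  · exact Or.inr ⟨Or.inr (by rw [mul_assoc]), rfl⟩

/-- Jumps do not change `wall`. Since `x ↦ wall (c * x)` counts crossings of the edge translated by
c⁻¹, an increase reveals a step along t through exactly this edge. -/
theorem HNNStep.wall_lt {c : HNNExtension G A B φ} (h : HNNStep N' J r x y k)
    (hw : wall (c * x) < wall (c * y)) : y = x * t ∧ ∃ b ∈ B, c * x = of b := by
  rcases h with ⟨h, _, rfl, _⟩ | ⟨rfl | rfl, _⟩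
  · rw [← mul_assoc, wall_mul_of] at hw
    omega
  · refine ⟨rfl, ?_⟩
    by_contra hb
    rw [← mul_assoc, wall_mul_t_of_notMem hb] at hw
    omega
  · exfalso
    rw [← mul_assoc] at hw
    by_cases hb : ∃ b ∈ B, c * y = of b
    · obtain ⟨b, hb, hy⟩ := hb
      rw [wall_mul_t_of_mem hb hy] at hw
      omega
    · rw [wall_mul_t_of_notMem hb] at hw
      omega

theorem HNNStep.lt_wall {c : HNNExtension G A B φ} (h : HNNStep N' J r x y k)
    (hw : -wall (c * x) < -wall (c * y)) : x = y * t ∧ ∃ b ∈ B, c * y = of b := by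
  rcases h with ⟨h, _, rfl, _⟩ | ⟨rfl | rfl, _⟩
  · rw [← mul_assoc, wall_mul_of] at hw
    omega
  · exfalso
    rw [← mul_assoc] at hw
    by_cases hb : ∃ b ∈ B, c * x = of b
    · obtain ⟨b, hb, hy⟩ := hb
      rw [wall_mul_t_of_mem hb hy] at hw
      omega
    · rw [wall_mul_t_of_notMem hb] at hw
      omega
  · refine ⟨rfl, ?_⟩
    by_contra hb
    rw [← mul_assoc, wall_mul_t_of_notMem hb] at hw
    omega

theorem norm_le_of_hnnWalk (hN : IsNorm N') (ht : N' t ≤ 1)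
    (w : CostWalk (HNNStep N' J r) x y n) : N' (x⁻¹ * y) ≤ n := by
  induction w with
  | nil => simp [hN.one]
  | @cons x z y k n h _ ih =>
    have h1 := hN.mul (x⁻¹ * z) (z⁻¹ * y)
    rw [mul_assoc, mul_inv_cancel_left] at h1
    refine h1.trans (add_le_add ?_ ih)
    rcases h with ⟨h, _, rfl, _, _, rfl⟩ | ⟨rfl | rfl, rfl⟩
    · simp
    · simpa using ht
    · rw [← hN.inv]
      simpa using ht

theorem natAbs_stableExp_le_of_hnnWalk (w : CostWalk (HNNStep N' J r) x y n) :
    (Multiplicative.toAdd (stableExp y) - Multiplicative.toAdd (stableExp x)).natAbs ≤ n := by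
  induction w with
  | nil => simp
  | @cons x z y k n h _ ih =>
    rcases h with ⟨h, _, rfl, _, _, rfl⟩ | ⟨rfl | rfl, rfl⟩
    · rw [map_mul, stableExp_of, mul_one] at ih
      omega
    · rw [map_mul, stableExp_t, toAdd_mul, toAdd_ofAdd] at ih
      omega
    · rw [map_mul, stableExp_t, toAdd_mul, toAdd_ofAdd]
      omega

/-- An excursion that leaves a coset of the base group through an edge returns through this edge. -/
theorem mem_of_excursion {g h : G}
    (w : CostWalk (fun p q k => HNNStep N' J r p q k ∧ p ∉ Set.range (of (φ := φ)))
      (of g * t) (of h) n) : g⁻¹ * h ∈ B := by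
  -- The function is -1 at the start and 0 on the base group, so some step returns through the edge
  -- from g to g t. It ends in the base group at q = g b, and no step may start there, so q is the
  -- endpoint.
  obtain ⟨p, q, k, n₁, n₂, -, ⟨hs, -⟩, hlt, w', -⟩ :=
    w.exists_step_lt (fun x => -wall (of g⁻¹ * x)) (by
      have := wall_mul_t_of_mem (φ := φ) B.one_mem (map_one of).symm
      simp only [← mul_assoc, ← map_mul, inv_mul_cancel, wall_of, map_one, this, wall_one]
      norm_num)
  obtain ⟨-, b, hb, hq⟩ := hs.lt_wall hlt
  have hq' : q = of (g * b) := by rw [map_mul, ← hq]; simp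
  have : q = of h := by
    cases w' with
    | nil => rfl
    | cons h' _ => exact absurd ⟨_, hq'.symm⟩ h'.2
  have := of_injective (φ := φ) (hq'.symm.trans this)
  rw [← this]
  simpa using hb

/-- The mirror image for excursions that leave by t⁻¹. The base group endpoints of the translates of
this edge by its stabilizer form the coset g A, because t⁻¹ B t = A. -/
theorem mem_of_excursion_inv {g h : G}
    (w : CostWalk (fun p q k => HNNStep N' J r p q k ∧ p ∉ Set.range (of (φ := φ)))
      (of g * t⁻¹) (of h) n) : g⁻¹ * h ∈ A := by
  obtain ⟨p, q, k, n₁, n₂, -, ⟨hs, -⟩, hlt, w', -⟩ :=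
    w.exists_step_lt (fun x => wall (t * of g⁻¹ * x)) (by
      have := wall_mul_t_of_mem (φ := φ) B.one_mem (map_one of).symm
      rw [one_mul, wall_one] at this
      rw [wall_mul_of, wall_mul_of, mul_assoc t, ← mul_assoc (of g⁻¹), ← map_mul]
      simp [this])
  obtain ⟨hq, b, hb, hp⟩ := hs.wall_lt hlt
  have hq' : q = of (g * φ.symm ⟨b, hb⟩) := by
    have h1 : p = of g * t⁻¹ * of b := by rw [← hp]; simp [mul_assoc]
    have h2 := of_mul_t (φ := φ) ⟨b, hb⟩
    rw [hq, h1, mul_assoc, h2, map_mul]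
    simp [mul_assoc]
  have : q = of h := by
    cases w' with
    | nil => rfl
    | cons h' _ => exact absurd ⟨_, hq'.symm⟩ h'.2
  have := of_injective (φ := φ) (hq'.symm.trans this)
  rw [← this]
  simp

theorem of_mul_t_notMem_range (g : G) : (of g * t : HNNExtension G A B φ) ∉ Set.range of := by
  rintro ⟨h, hh⟩
  have := congrArg (fun x => Multiplicative.toAdd (stableExp x)) hh
  simp at this

theorem of_mul_inv_t_notMem_range (g : G) :
    (of g * t⁻¹ : HNNExtension G A B φ) ∉ Set.range of := by
  rintro ⟨h, hh⟩
  have := congrArg (fun x => Multiplicative.toAdd (stableExp x)) hh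
  simp at this

/-- A walk in an HNN extension between points of the base group, of which all points in the base group
are at norm at least `ρ`, can be replaced by a walk in the base group that jumps along the associated
subgroups. -/
theorem exists_jumpWalk (hN' : IsNorm N') (ht : N' t ≤ 1)
    (hle : ∀ g, N' (of g) ≤ N g) {c : ℕ} (hc : ∀ h ∈ J ∪ A ∪ B, N h ≤ c * N' (of h)) {ρ : ℕ}
    {g g' : G}
    (w : CostWalk (fun p q k => HNNStep N' J r p q k ∧ (∀ g, p = of g → ρ ≤ N' p) ∧
      (∀ g, q = of g → ρ ≤ N' q)) (of g) (of g') n) :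
    ∃ n' ≤ c * n, CostWalk (JumpStep N (J ∪ A ∪ B) ρ) g g' n' := by
  -- Induction from the end of the walk. The second alternative treats tails that start outside the
  -- base group: they split at the first return `h` into the rest of an excursion and a tail that is
  -- already converted.
  have key : ∀ {x y : HNNExtension G A B φ} {n : ℕ},
      CostWalk (fun p q k => HNNStep N' J r p q k ∧ (∀ g, p = of g → ρ ≤ N' p) ∧
        (∀ g, q = of g → ρ ≤ N' q)) x y n → ∀ g', y = of g' →
      (∀ g, x = of g → ∃ n' ≤ c * n, CostWalk (JumpStep N (J ∪ A ∪ B) ρ) g g' n') ∧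
      (x ∉ Set.range (of (φ := φ)) → ∃ h n₁ n₂, n₁ + n₂ ≤ n ∧ ρ ≤ N h ∧
        CostWalk (fun p q k => HNNStep N' J r p q k ∧ p ∉ Set.range (of (φ := φ))) x (of h) n₁ ∧
        ∃ n' ≤ c * n₂, CostWalk (JumpStep N (J ∪ A ∪ B) ρ) h g' n') := by
    intro x y n w
    induction w with
    | nil x =>
      intro g' hg'
      refine ⟨fun g hg => ?_, fun hx => absurd ⟨g', hg'.symm⟩ hx⟩
      rw [of_injective (φ := φ) (hg.symm.trans hg')]
      exact ⟨0, by omega, CostWalk.nil _⟩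
    | @cons x z y k n hs w ih =>
      obtain ⟨hs, hx, hz⟩ := hs
      intro g' hg'
      obtain ⟨ih1, ih2⟩ := ih g' hg'
      refine ⟨fun g hg => ?_, fun hxr => ?_⟩
      · have hρ : ρ ≤ N g := by
          have := (hx g hg).trans_eq (congrArg N' hg)
          exact this.trans (hle g)
        -- A whole excursion becomes one jump. Its cost in the base group is at most `c` times the
        -- norm of g⁻¹h in the extension, which the length of the excursion bounds; this is where
        -- undistortion of A and B enters.
        have excursion : ∀ h n₁ n₂ n', n₁ + n₂ ≤ n → k = 1 → ρ ≤ N h → g⁻¹ * h ∈ J ∪ A ∪ B →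
            N' (x⁻¹ * of h) ≤ 1 + n₁ → n' ≤ c * n₂ →
            CostWalk (JumpStep N (J ∪ A ∪ B) ρ) h g' n' →
            ∃ n' ≤ c * (k + n), CostWalk (JumpStep N (J ∪ A ∪ B) ρ) g g' n' := by
          intro h n₁ n₂ n' h1 hk h2 h3 h4 h5 h6
          refine ⟨_, ?_, CostWalk.cons ⟨h3, hρ, h2, rfl⟩ h6⟩
          have h7 := hc _ h3
          rw [map_mul, map_inv, ← hg] at h7
          have h8 := h7.trans (Nat.mul_le_mul_left c h4)
          calc _ ≤ c * (1 + n₁) + c * n₂ := add_le_add h8 h5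
            _ = c * (1 + (n₁ + n₂)) := by ring
            _ ≤ _ := Nat.mul_le_mul_left c (by omega)
        have hcost : ∀ h n₁, HNNStep N' J r x z 1 →
            CostWalk (fun p q k => HNNStep N' J r p q k ∧ p ∉ Set.range (of (φ := φ)))
              z (of h) n₁ → N' (x⁻¹ * of h) ≤ 1 + n₁ := fun h n₁ h1 h2 =>
          norm_le_of_hnnWalk hN' ht (CostWalk.cons h1 (h2.mono fun _ _ _ h => h.1))
        have hs' := hs
        rcases hs with ⟨h, hh, hz', -, -, rfl⟩ | ⟨hz' | hz', rfl⟩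
        · have hz'' : z = of (g * h) := by rw [hz', hg, map_mul]
          obtain ⟨n', hn', w'⟩ := ih1 _ hz''
          have hρz : ρ ≤ N (g * h) := by
            have := (hz _ hz'').trans_eq (congrArg N' hz'')
            exact this.trans (hle _)
          refine ⟨_, ?_, CostWalk.cons ⟨?_, hρ, hρz, rfl⟩ w'⟩
          · rw [inv_mul_cancel_left, mul_add]
            exact add_le_add (hc _ (Or.inl (Or.inl hh))) hn'
          · rw [inv_mul_cancel_left]
            exact Or.inl (Or.inl hh)
        · subst hg
          obtain ⟨h, n₁, n₂, h1, h2, h3, n', h4, h5⟩ :=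
            ih2 (by rw [hz']; exact of_mul_t_notMem_range g)
          have h6 := hcost h n₁ hs' h3
          rw [hz'] at h3
          exact excursion h n₁ n₂ n' h1 rfl h2 (Or.inr (mem_of_excursion h3)) h6 h4 h5
        · subst hg
          have hz'' : z = of g * t⁻¹ := by rw [hz']; simp
          obtain ⟨h, n₁, n₂, h1, h2, h3, n', h4, h5⟩ :=
            ih2 (by rw [hz'']; exact of_mul_inv_t_notMem_range g)
          have h6 := hcost h n₁ hs' h3
          rw [hz''] at h3
          exact excursion h n₁ n₂ n' h1 rfl h2 (Or.inl (Or.inr (mem_of_excursion_inv h3))) h6 h4 h5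
      · by_cases hzr : z ∈ Set.range (of (φ := φ))
        · obtain ⟨h, hh⟩ := hzr
          obtain ⟨n', hn', w'⟩ := ih1 h hh.symm
          have hρz : ρ ≤ N h := by
            have := (hz _ hh.symm).trans_eq (congrArg N' hh.symm)
            exact this.trans (hle _)
          exact ⟨h, k, n, le_rfl, hρz, CostWalk.single ⟨hh ▸ hs, hxr⟩, n', hn', w'⟩
        · obtain ⟨h, n₁, n₂, h1, h2, h3, h4⟩ := ih2 hzr
          exact ⟨h, k + n₁, n₂, by omega, h2, CostWalk.cons ⟨hs, hxr⟩ h3, h4⟩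
  exact (key w g' rfl).1 g rfl

/-- A walk to the line of the stable letter can be stopped at its first visit to this line, which
happens at norm at least `r`. -/
theorem exists_walk_to_line {g : G} (hg : g ≠ 1) {l : ℤ}
    (w : CostWalk (HNNStep N' J r) (of g) (t ^ l) n) :
    ∃ (l' : ℤ) (n' : ℕ), n' ≤ n ∧ r ≤ N' (t ^ l') ∧
      CostWalk (fun p q k => HNNStep N' J r p q k ∧ p ∉ Subgroup.zpowers t)
        (of g) (t ^ l') n' := by
  obtain ⟨z, hz, m, hm, w'⟩ := w.first_visit (Subgroup.zpowers (t : HNNExtension G A B φ) : Set (HNNExtension G A B φ)) ⟨l, rfl⟩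
  have hne : of g ≠ z := by
    rintro rfl
    exact hg (of_mem_zpowers_t hz)
  obtain ⟨p, k, m', -, ⟨hs, hp⟩, -⟩ := w'.exists_last hne
  have hz' := hz
  obtain ⟨l', rfl⟩ := hz
  refine ⟨l', m, hm, ?_, w'⟩
  -- A step along t that ends on the line also starts on it, so the first visit is made by a jump,
  -- and jumps land at norm at least `r`.
  rcases hs with ⟨h, _, _, _, h2, _⟩ | ⟨h | h, _⟩
  · exact h2
  · exfalso
    apply hp
    have : p = t ^ (l' - 1) := by
      rw [zpow_sub_one]
      exact eq_mul_inv_of_mul_eq h.symm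
    exact ⟨l' - 1, this.symm⟩
  · exfalso
    apply hp
    exact ⟨l' + 1, by rw [h]; exact zpow_add_one _ _⟩

theorem norm_t_zpow_le (hN : IsNorm N') (ht : N' t ≤ 1) (l : ℤ) : N' (t ^ l) ≤ l.natAbs := by
  have key : ∀ k : ℕ, N' (t ^ k) ≤ k := by
    intro k
    induction k with
    | zero => simp [hN.one]
    | succ k ih =>
      rw [pow_succ]
      have := hN.mul (t ^ k) t
      omega
  obtain ⟨k, rfl | rfl⟩ := l.eq_nat_or_neg
  · simpa using key k
  · simpa [hN.inv] using key k

end HNN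

end CatDiv
end

/-! ### Lower bounds for walks to the stable line -/

noncomputable section

namespace CatDiv

section HNN

open HNNExtension

variable {G : Type*} [Group G] {A B : Subgroup G} {φ : A ≃* B}

/-- Walks in an HNN extension with jumps from the base group to the stable line that avoid the ball of
radius `κ ρ` cost at least `ρ ^ e`. -/
def LineBound (N' : HNNExtension G A B φ → ℕ) (J : Set G) (e : ℕ) : Prop :=
  ∃ κ : ℕ, 1 ≤ κ ∧ ∀ (ρ r n : ℕ) (g : G) (l : ℤ), κ * ρ ≤ r → g ≠ 1 →
    CostWalk (HNNStep N' J r) (of g) (t ^ l) n → ρ ^ e ≤ n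

/-- Walks with jumps from `A` to `B` that avoid the ball of radius `κ ρ` cost at least `ρ ^ e`. -/
def SubgroupBound {G : Type*} [Group G] (N : G → ℕ) (J : Set G) (A B : Subgroup G) (e : ℕ) : Prop :=
  ∃ κ : ℕ, 1 ≤ κ ∧ ∀ ρ r n : ℕ, ∀ a ∈ A, ∀ b ∈ B, κ * ρ ≤ r → r ≤ N a → r ≤ N b →
    CostWalk (JumpStep N (J ∪ A ∪ B) r) a b n → ρ ^ e ≤ n

variable {N' : HNNExtension G A B φ → ℕ} {N : G → ℕ} {J : Set G}

/-- The first visit `t ^ l'` has norm at least `r`, so |l'| ≥ r, while the exponent sum starts at 0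
and changes by at most one per unit of cost. -/
theorem lineBound_one (hN' : IsNorm N') (ht : N' t ≤ 1) : LineBound N' J 1 := by
  refine ⟨1, le_rfl, fun ρ r n g l hr hg w => ?_⟩
  obtain ⟨l', n', h1, h2, h3⟩ := exists_walk_to_line hg w
  have h4 := norm_t_zpow_le hN' ht l'
  have h5 := natAbs_stableExp_le_of_hnnWalk (h3.mono fun _ _ _ h => h.1)
  rw [toAdd_stableExp_zpow, stableExp_of, toAdd_one, sub_zero] at h5
  rw [pow_one]
  omega

/-- Each crossing of the space between two consecutive edges of the stable line is expensive. -/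
theorem crossing_bound (hN' : IsNorm N') (ht : N' t ≤ 1) (hle : ∀ g, N' (of g) ≤ N g)
    (hJ : ∀ h ∈ J, h⁻¹ ∈ J) {c : ℕ} (hc1 : 1 ≤ c) (hc : ∀ h ∈ J ∪ A ∪ B, N h ≤ c * N' (of h))
    (hAB : A ⊓ B = ⊥) {e j : ℕ} (hj : 1 ≤ j) (hje : j ≤ e) (H : SubgroupBound N J A B e)
    (hQ : LineBound N' J j) : ∃ κ : ℕ, 1 ≤ κ ∧ ∀ ρ r n : ℕ, ∀ a ∈ A, ∀ b ∈ B, κ * ρ ≤ r →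
      (a ≠ 1 ∨ b ≠ 1) → CostWalk (HNNStep N' J r) (of a) (of b) n → ρ ^ j ≤ n := by
  obtain ⟨κ₁, hκ₁, H⟩ := H
  obtain ⟨κ₂, hκ₂, hQ⟩ := hQ
  refine ⟨κ₁ * c + κ₂, by omega, fun ρ r n a ha b hb hr hne w => ?_⟩
  have hab : a ≠ b := by
    rintro rfl
    have : a ∈ A ⊓ B := ⟨ha, hb⟩
    rw [hAB, Subgroup.mem_bot] at this
    simp [this] at hne
  -- The bound in the base group is used at scale cρ, because jump walks cost up to `c` times more.
  -- The remaining radius κ₂ρ is reserved for the line bound.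
  let σ := κ₁ * (c * ρ)
  have hr' : σ + κ₂ * ρ ≤ r := by
    refine le_trans (le_of_eq ?_) hr
    simp only [σ]
    ring
  rcases Nat.eq_zero_or_pos ρ with rfl | hρ
  · rw [zero_pow (by omega)]
    exact Nat.zero_le _
  -- If the walk meets the base group at q of norm below σ, translation by q⁻¹ still leaves radius
  -- κ₂ρ. At least one of a, b differs from q, and the part of the walk between it and q becomes a
  -- walk to 1 = t⁰, to which the line bound applies.
  have bad : ∀ z n₁ n₂, (¬ ∀ g, z = of g → σ ≤ N' z) → CostWalk (HNNStep N' J r) (of a) z n₁ →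
      CostWalk (HNNStep N' J r) z (of b) n₂ → n = n₁ + n₂ → ρ ^ j ≤ n := by
    intro z n₁ n₂ hz w₁ w₂ hn
    push Not at hz
    obtain ⟨q, rfl, hq⟩ := hz
    have key : ∀ x m, x ≠ q → CostWalk (HNNStep N' J r) (of x) (of q) m → ρ ^ j ≤ m := by
      intro x m hx w
      have w' := w.map (R' := HNNStep N' J (κ₂ * ρ)) (fun x => of q⁻¹ * x)
        fun _ _ _ h => h.translate hN' (by rw [map_inv, hN'.inv]; omega)
      rw [← map_mul, ← map_mul, inv_mul_cancel, map_one, ← zpow_zero t] at w'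
      exact hQ ρ _ m _ 0 le_rfl (fun h => hx (inv_mul_eq_one.1 h).symm) w'
    by_cases haq : a = q
    · have := key b n₂ (by rw [← haq]; exact hab.symm)
        (w₂.reverse fun _ _ _ h => h.symm hN' hJ)
      omega
    · have := key a n₁ haq w₁
      omega
  by_cases hQa : ∀ g, of a = of (φ := φ) g → σ ≤ N' (of a)
  · by_cases hQb : ∀ g, of b = of (φ := φ) g → σ ≤ N' (of b)
    · rcases w.good_or_split (fun z => ∀ g, z = of g → σ ≤ N' z) with w' | ⟨z, n₁, n₂, h⟩
      · obtain ⟨n', hn', w''⟩ := exists_jumpWalk hN' ht hle hc w'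
        have h1 := H (c * ρ) σ n' a ha b hb le_rfl ((hQa a rfl).trans (hle a))
          ((hQb b rfl).trans (hle b)) w''
        have h2 : c * ρ ^ e ≤ (c * ρ) ^ e := by
          rw [mul_pow]
          exact Nat.mul_le_mul_right _ (Nat.le_self_pow (by omega) c)
        have h3 : c * ρ ^ e ≤ c * n := h2.trans (h1.trans hn')
        have h4 : ρ ^ j ≤ ρ ^ e := Nat.pow_le_pow_right hρ hje
        exact h4.trans (Nat.le_of_mul_le_mul_left h3 hc1)
      · exact bad z n₁ n₂ h.1 h.2.1 h.2.2.1 h.2.2.2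
    · exact bad (of b) n 0 hQb w (CostWalk.nil _) (by omega)
  · exact bad (of a) 0 n hQa (CostWalk.nil _) w (by omega)

/-- Before its first visit to the line the walk passes ρ spaces between consecutive edges of the
axis. Each costs ρ^j by `crossing_bound` after translation by t^(∓i) with i ≤ ρ; the summand 1 in κ
+ 1 pays for this translation. -/
theorem lineBound_succ (hN' : IsNorm N') (ht : N' t ≤ 1) (hle : ∀ g, N' (of g) ≤ N g)
    (hJ : ∀ h ∈ J, h⁻¹ ∈ J) {c : ℕ} (hc1 : 1 ≤ c) (hc : ∀ h ∈ J ∪ A ∪ B, N h ≤ c * N' (of h))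
    (hAB : A ⊓ B = ⊥) {e j : ℕ} (hj : 1 ≤ j) (hje : j ≤ e) (H : SubgroupBound N J A B e)
    (hQ : LineBound N' J j) : LineBound N' J (j + 1) := by
  obtain ⟨κ, hκ, hX⟩ := crossing_bound hN' ht hle hJ hc1 hc hAB hj hje H hQ
  refine ⟨κ + 1, by omega, fun ρ r n g l hr hg w => ?_⟩
  rcases Nat.eq_zero_or_pos ρ with rfl | hρ
  · simp
  obtain ⟨l', n', h1, h2, w⟩ := exists_walk_to_line hg w
  refine le_trans ?_ h1
  have h4 := h2.trans (norm_t_zpow_le hN' ht l')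
  have hrρ : κ * ρ + ρ ≤ r := by rw [add_mul, one_mul] at hr; exact hr
  have hκρ : ρ ≤ κ * ρ := Nat.le_mul_of_pos_left ρ hκ
  have hmul : ∀ i : ℤ, ∀ x : G, x ≠ 1 ↔
      (t ^ i * of x : HNNExtension G A B φ) ∉ Subgroup.zpowers t := by
    intro i x
    rw [ne_eq, not_iff_not, Subgroup.mul_mem_cancel_left _ (Subgroup.zpow_mem_zpowers t i)]
    exact ⟨by rintro rfl; rw [map_one]; exact Subgroup.one_mem _, of_mem_zpowers_t⟩
  have hcr : ∀ i : ℤ, i.natAbs ≤ ρ → ∀ x y m, CostWalk (HNNStep N' J r) (t ^ i * of x)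
      (t ^ i * of y) m → CostWalk (HNNStep N' J (κ * ρ)) (of x) (of y) m := by
    intro i hi x y m w
    have := w.map (R' := HNNStep N' J (κ * ρ)) (fun x => t ^ (-i) * x) fun _ _ _ h =>
      h.translate hN' (by
        have := norm_t_zpow_le hN' ht (-i)
        rw [Int.natAbs_neg] at this
        omega)
    simpa only [zpow_neg, inv_mul_cancel_left] using this
  rcases le_or_gt 0 l' with hl | hl
  -- `d` counts the spaces still to be crossed, and the tail starts just behind the edge that ends
  -- at t^i. The condition i + d ≤ ρ + 1 ensures i ≤ ρ whenever d > 0.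
  · have claim : ∀ (d i m : ℕ) (a : G), 1 ≤ i → i + d ≤ ρ + 1 → a ∈ A →
        CostWalk (fun p q k => HNNStep N' J r p q k ∧ p ∉ Subgroup.zpowers t)
          (t ^ (i : ℤ) * of a) (t ^ l') m → d * ρ ^ j ≤ m := by
      intro d
      induction d with
      | zero => intros; omega
      | succ d ih =>
        intro i m a hi hid ha w
        obtain ⟨p, q, k, n₁, n₂, w₁, hs, hlt, w₂, rfl⟩ :=
          w.exists_step_lt (fun x => wall (t ^ (-(i : ℤ)) * x)) (by
            simp only [zpow_neg, inv_mul_cancel_left, wall_of]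
            rw [← zpow_neg, ← zpow_add, wall_t_zpow_pos (by omega)]
            exact one_pos)
        obtain ⟨hq, b, hb, hp⟩ := hs.1.wall_lt hlt
        have hp' : p = t ^ (i : ℤ) * of b := by rw [← hp]; simp
        have hq' : q = t ^ ((i + 1 : ℕ) : ℤ) * of (φ.symm ⟨b, hb⟩ : G) := by
          have := of_mul_t (φ := φ) ⟨b, hb⟩
          rw [hq, hp', mul_assoc, this, Nat.cast_succ, zpow_add_one, mul_assoc]
        have hk : 1 ≤ k := by
          rcases hs.1 with ⟨h, _, h', _⟩ | ⟨_, rfl⟩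
          · exfalso
            have h5 := congrArg (fun x => Multiplicative.toAdd (stableExp x)) (hq.symm.trans h')
            simp at h5
          · exact le_rfl
        have h3 := ih (i + 1) n₂ _ (by omega) (by omega) (φ.symm ⟨b, hb⟩).2 (hq' ▸ w₂)
        -- The point t^i b is not on the line, as the walk was stopped at its first visit.
        have hb1 : b ≠ 1 := (hmul i b).2 (hp' ▸ hs.2)
        have h5 := hX ρ _ n₁ a ha b hb le_rfl (Or.inr hb1)
          (hcr i (by omega) a b n₁ (hp' ▸ w₁.mono fun _ _ _ h => h.1))
        rw [add_mul, one_mul]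
        omega
    obtain ⟨p, q, k, n₁, n₂, w₁, hs, hlt, w₂, rfl⟩ := w.exists_step_lt (fun x => wall (1 * x)) (by
      simp only [one_mul, wall_of]
      rw [wall_t_zpow_pos (by omega)]
      exact one_pos)
    obtain ⟨hq, b, hb, hp⟩ := hs.1.wall_lt hlt
    have hq' : q = t ^ ((1 : ℕ) : ℤ) * of (φ.symm ⟨b, hb⟩ : G) := by
      rw [one_mul] at hp
      have := of_mul_t (φ := φ) ⟨b, hb⟩
      rw [hq, hp, this, Nat.cast_one, zpow_one]
    have := claim ρ 1 n₂ _ le_rfl (by omega) (φ.symm ⟨b, hb⟩).2 (hq' ▸ w₂)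
    rw [pow_succ']
    omega
  -- For l' < 0 the edges are crossed against their orientation. Hence `-wall` is followed, the edge
  -- considered runs from t^(-(i+1)) to t^(-i), and A and B change roles.
  · have claim : ∀ (d i m : ℕ) (b : G), 1 ≤ i → i + d ≤ ρ + 1 → b ∈ B →
        CostWalk (fun p q k => HNNStep N' J r p q k ∧ p ∉ Subgroup.zpowers t)
          (t ^ (-(i : ℤ)) * of b) (t ^ l') m → d * ρ ^ j ≤ m := by
      intro d
      induction d with
      | zero => intros; omega
      | succ d ih =>
        intro i m b hi hid hb w
        obtain ⟨p, q, k, n₁, n₂, w₁, hs, hlt, w₂, rfl⟩ :=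
          w.exists_step_lt (fun x => -wall (t ^ ((i + 1 : ℕ) : ℤ) * x)) (by
            have h1 : (t ^ ((i + 1 : ℕ) : ℤ) * (t ^ (-(i : ℤ)) * of b) : HNNExtension G A B φ)
                = t ^ (1 : ℤ) * of b := by
              rw [← mul_assoc, ← zpow_add]
              congr 2
              push_cast
              ring
            rw [h1, wall_mul_of, wall_t_zpow_pos one_pos, ← zpow_add,
              wall_t_zpow_nonpos (by push_cast; omega)]
            norm_num)
        obtain ⟨hp, b', hb', hq⟩ := hs.1.lt_wall hlt
        have hq' : q = t ^ (-((i + 1 : ℕ) : ℤ)) * of b' := by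
          rw [← hq, zpow_neg, inv_mul_cancel_left]
        have hp' : p = t ^ (-(i : ℤ)) * of (φ.symm ⟨b', hb'⟩ : G) := by
          have := of_mul_t (φ := φ) ⟨b', hb'⟩
          rw [hp, hq', mul_assoc, this, ← mul_assoc, ← zpow_add_one]
          congr 2
          push_cast
          ring
        have hk : 1 ≤ k := by
          rcases hs.1 with ⟨h, _, h', _⟩ | ⟨_, rfl⟩
          · exfalso
            rw [hp] at h'
            have h5 := congrArg (fun x => Multiplicative.toAdd (stableExp x)) h'
            simp at h5
          · exact le_rfl
        have h3 := ih (i + 1) n₂ _ (by omega) (by omega) hb' (hq' ▸ w₂)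
        have ha1 : (φ.symm ⟨b', hb'⟩ : G) ≠ 1 := (hmul (-i) _).2 (hp' ▸ hs.2)
        have h5 := hX ρ _ n₁ _ (φ.symm ⟨b', hb'⟩).2 b hb le_rfl (Or.inl ha1)
          ((hcr (-i) (by omega) b _ n₁ (hp' ▸ w₁.mono fun _ _ _ h => h.1)).reverse
            fun _ _ _ h => h.symm hN' hJ)
        rw [add_mul, one_mul]
        omega
    obtain ⟨p, q, k, n₁, n₂, w₁, hs, hlt, w₂, rfl⟩ :=
      w.exists_step_lt (fun x => -wall (t ^ ((1 : ℕ) : ℤ) * x)) (by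
        rw [wall_mul_of, wall_t_zpow_pos (by norm_num), ← zpow_add,
          wall_t_zpow_nonpos (by push_cast; omega)]
        norm_num)
    obtain ⟨-, b, hb, hq⟩ := hs.1.lt_wall hlt
    have hq' : q = t ^ (-((1 : ℕ) : ℤ)) * of b := by rw [← hq]; simp
    have := claim ρ 1 n₂ _ le_rfl (by omega) hb (hq' ▸ w₂)
    rw [pow_succ']
    omega

/-- The lower bound for the stable line from a lower bound between the associated subgroups. -/
theorem lineBound_of_subgroupBound (hN' : IsNorm N') (ht : N' t ≤ 1)
    (hle : ∀ g, N' (of g) ≤ N g) (hJ : ∀ h ∈ J, h⁻¹ ∈ J) {c : ℕ} (hc1 : 1 ≤ c)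
    (hc : ∀ h ∈ J ∪ A ∪ B, N h ≤ c * N' (of h)) (hAB : A ⊓ B = ⊥) {e : ℕ}
    (H : SubgroupBound N J A B e) : LineBound N' J (e + 1) := by
  have key : ∀ j ≤ e, LineBound N' J (j + 1) := by
    intro j
    induction j with
    | zero => intro _; exact lineBound_one hN' ht
    | succ j ih =>
      intro hj
      exact lineBound_succ hN' ht hle hJ hc1 hc hAB (by omega) hj H (ih (by omega))
  exact key e le_rfl

/-- A bound for walks to the stable line gives a bound for walks with jumps along this line and along
a subgroup of the base group. -/
theorem subgroupBound_of_lineBound (hN' : IsNorm N') (hJ : ∀ h ∈ J, h⁻¹ ∈ J) {c : ℕ} (hc1 : 1 ≤ c)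
    (hc : ∀ l : ℤ, l.natAbs ≤ c * N' (t ^ l)) {D : Subgroup G} (hD : (D : Set G) ⊆ J) {e : ℕ}
    (he : 1 ≤ e) (H : LineBound N' J e) :
    SubgroupBound N' (of '' J ∪ {t, t⁻¹}) (Subgroup.zpowers t) (D.map of) e := by
  obtain ⟨κ, hκ, H⟩ := H
  refine ⟨κ * c, Nat.mul_pos hκ hc1, fun ρ r n a ha b hb hr ha' hb' w => ?_⟩
  rcases Nat.eq_zero_or_pos ρ with rfl | hρ
  · rw [zero_pow (by omega)]
    exact Nat.zero_le _
  -- A jump along ⟨t⟩ unfolds into steps along t even where these enter the ball, since such steps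
  -- are unrestricted.
  have line : ∀ (x : HNNExtension G A B φ) (l : ℤ),
      CostWalk (HNNStep N' J r) x (x * t ^ l) l.natAbs := by
    have key : ∀ (k : ℕ) (x : HNNExtension G A B φ), CostWalk (HNNStep N' J r) x (x * t ^ k) k := by
      intro k x
      have := CostWalk.of_nat (R := HNNStep N' J r) (fun i => x * t ^ i) k fun i _ =>
        Or.inr ⟨Or.inl (by rw [pow_succ, mul_assoc]), rfl⟩
      simpa using this
    intro x l
    obtain ⟨k, rfl | rfl⟩ := l.eq_nat_or_neg
    · simpa using key k x
    · have := (key k (x * t ^ (-(k : ℤ)))).reverse fun _ _ _ h => h.symm hN' hJ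
      simpa using this
  obtain ⟨n', hn', w'⟩ := w.refine (R' := HNNStep N' J r) (fun x => x) c (by
    intro x y k ⟨hxy, hx, hy, hk⟩
    have hjump : ∀ h ∈ J, x⁻¹ * y = of h → ∃ k' ≤ c * k, CostWalk (HNNStep N' J r) x y k' := by
      intro h hh hxy
      exact ⟨k, Nat.le_mul_of_pos_left k hc1,
        CostWalk.single (Or.inl ⟨h, hh, by rw [← hxy]; simp, hx, hy, by rw [hk, hxy]⟩)⟩
    have hline : ∀ l : ℤ, x⁻¹ * y = t ^ l → ∃ k' ≤ c * k, CostWalk (HNNStep N' J r) x y k' := by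
      intro l hxy
      refine ⟨l.natAbs, by rw [hk, hxy]; exact hc l, ?_⟩
      have := line x l
      rwa [← hxy, mul_inv_cancel_left] at this
    rcases hxy with ((⟨h, hh, hxy⟩ | hxy | hxy) | ⟨l, hxy⟩) | ⟨h, hh, hxy⟩
    · exact hjump h hh hxy.symm
    · exact hline 1 (by simpa using hxy)
    · exact hline (-1) (by simpa using hxy)
    · exact hline l hxy.symm
    · exact hjump h (hD hh) hxy.symm)
  obtain ⟨l, rfl⟩ := ha
  obtain ⟨d, hd, rfl⟩ := hb
  have hd1 : d ≠ 1 := by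
    rintro rfl
    rw [map_one, hN'.one] at hb'
    have : 0 < κ * c * ρ := Nat.mul_pos (Nat.mul_pos hκ hc1) hρ
    omega
  have h1 := H (c * ρ) r n' d l (by rw [← mul_assoc]; exact hr) hd1
    (w'.reverse fun _ _ _ h => h.symm hN' hJ)
  have h2 : c * ρ ^ e ≤ (c * ρ) ^ e := by
    rw [mul_pow]
    exact Nat.mul_le_mul_right _ (Nat.le_self_pow (by omega) c)
  exact Nat.le_of_mul_le_mul_left (h2.trans (h1.trans hn')) hc1

end HNN

end CatDiv
end

/-! ### Upper bounds from flats -/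

noncomputable section

namespace CatDiv

section Upper

variable {G : Type*} [Group G]

/-- A generator step between points with `|η| + |θ| ≥ R`. -/
def RegionStep (S : Set G) (η θ : G → ℤ) (R : ℕ) (x y : G) (k : ℕ) : Prop :=
  GenStep S x y k ∧ R ≤ (η x).natAbs + (θ x).natAbs ∧ R ≤ (η y).natAbs + (θ y).natAbs

theorem RegionStep.symm {S : Set G} {η θ : G → ℤ} {R : ℕ} {x y : G} {k : ℕ}
    (h : RegionStep S η θ R x y k) : RegionStep S η θ R y x k :=
  ⟨h.1.symm, h.2.2, h.2.1⟩

/-- A finite generating set `S`, with additive functions `η`, `θ` and a flat `⟨u, p⟩` on which these are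
coordinates, such that translates of `u ^ N` by generators are joined to `u ^ N` by walks of length
`O(N ^ e)` far from the identity. -/
structure FlatData (G : Type*) [Group G] (u : G) (e : ℕ) where
  S : Set G
  finite : S.Finite
  closure : Subgroup.closure S = ⊤
  η : G → ℤ
  θ : G → ℤ
  η_mul : ∀ x y, η (x * y) = η x + η y
  θ_mul : ∀ x y, θ (x * y) = θ x + θ y
  p : G
  u_mem : u ∈ S
  p_mem : p ∈ S
  comm : Commute p u
  η_u : η u = 1
  θ_u : θ u = 0
  η_p : η p = 0
  θ_p : θ p = 1
  bound : ℕ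
  walk : ∀ w ∈ S, ∀ N, 1 ≤ N → ∃ n ≤ bound * N ^ e,
    CostWalk (RegionStep S η θ (N - 1)) (u ^ N) (w * u ^ N) n

theorem map_pow_of_additive {η : G → ℤ} (h : ∀ x y, η (x * y) = η x + η y) (x : G) (k : ℕ) :
    η (x ^ k) = k * η x := by
  induction k with
  | zero =>
    have := h 1 1
    rw [mul_one] at this
    rw [pow_zero]
    push_cast
    omega
  | succ k ih => rw [pow_succ, h, ih]; push_cast; ring

theorem map_inv_of_additive {η : G → ℤ} (h : ∀ x y, η (x * y) = η x + η y) (x : G) :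
    η x⁻¹ = -η x := by
  have h1 := map_pow_of_additive h x 0
  have h2 := h x⁻¹ x
  rw [inv_mul_cancel] at h2
  simp only [pow_zero] at h1
  push_cast at h1
  omega

variable {S : Set G} {η θ : G → ℤ}

/-- Walking along powers of a generator. -/
theorem regionWalk_pow (x s : G) (hs : s ∈ S) (N R : ℕ)
    (h : ∀ i ≤ N, R ≤ (η (x * s ^ i)).natAbs + (θ (x * s ^ i)).natAbs) :
    CostWalk (RegionStep S η θ R) x (x * s ^ N) N := by
  have := CostWalk.of_nat (R := RegionStep S η θ R) (fun i => x * s ^ i) N fun i hi =>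
    ⟨⟨Or.inl (by simpa [pow_succ, mul_assoc] using hs), rfl⟩, h i hi.le, h (i + 1) hi⟩
  simpa using this

theorem RegionStep.translate (hη : ∀ x y, η (x * y) = η x + η y) (hθ : ∀ x y, θ (x * y) = θ x + θ y)
    {R R' : ℕ} {c x y : G} {k : ℕ} (hc : R' + (η c).natAbs + (θ c).natAbs ≤ R)
    (h : RegionStep S η θ R x y k) : RegionStep S η θ R' (c * x) (c * y) k := by
  refine ⟨⟨by simpa [mul_assoc] using h.1.1, h.1.2⟩, ?_, ?_⟩
  · have := h.2.1
    rw [hη, hθ]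
    omega
  · have := h.2.2
    rw [hη, hθ]
    omega

theorem RegionStep.mono {R R' : ℕ} {x y : G} {k : ℕ} (hR : R' ≤ R)
    (h : RegionStep S η θ R x y k) : RegionStep S η θ R' x y k :=
  ⟨h.1, hR.trans h.2.1, hR.trans h.2.2⟩

namespace FlatData

variable {u : G} {e : ℕ} (D : FlatData G u e)

theorem η_u_pow (k : ℕ) : D.η (u ^ k) = k := by rw [map_pow_of_additive D.η_mul, D.η_u, mul_one]

theorem θ_u_pow (k : ℕ) : D.θ (u ^ k) = 0 := by rw [map_pow_of_additive D.θ_mul, D.θ_u, mul_zero]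

theorem η_p_pow (k : ℕ) : D.η (D.p ^ k) = 0 := by rw [map_pow_of_additive D.η_mul, D.η_p, mul_zero]

theorem θ_p_pow (k : ℕ) : D.θ (D.p ^ k) = k := by rw [map_pow_of_additive D.θ_mul, D.θ_p, mul_one]

/-- The powers `u ^ (-N)` and `u ^ N` are joined in the flat. -/
theorem walk_neg (N : ℕ) :
    CostWalk (RegionStep D.S D.η D.θ N) ((u ^ N)⁻¹) (u ^ N) (4 * N) := by
  have hi : D.η (u ^ N)⁻¹ = -N := by rw [map_inv_of_additive D.η_mul, D.η_u_pow]
  have hi' : D.θ (u ^ N)⁻¹ = 0 := by rw [map_inv_of_additive D.θ_mul, D.θ_u_pow, neg_zero]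
  have w₁ := regionWalk_pow (S := D.S) (η := D.η) (θ := D.θ) (u ^ N)⁻¹ D.p D.p_mem N N fun i _ => by
    rw [D.η_mul, D.θ_mul, hi, hi', D.η_p_pow, D.θ_p_pow]
    omega
  have w₂ := regionWalk_pow (S := D.S) (η := D.η) (θ := D.θ) ((u ^ N)⁻¹ * D.p ^ N) u D.u_mem (2 * N)
    N fun i _ => by
      rw [D.θ_mul, D.θ_mul, hi', D.θ_p_pow, D.θ_u_pow]
      omega
  have w₃ := (regionWalk_pow (S := D.S) (η := D.η) (θ := D.θ) (u ^ N) D.p D.p_mem N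
    N fun i _ => by
      rw [D.η_mul, D.η_p_pow, D.η_u_pow]
      omega).reverse fun _ _ _ h => h.symm
  have h1 : (u ^ N)⁻¹ * D.p ^ N * u ^ (2 * N) = u ^ N * D.p ^ N := by
    rw [mul_assoc, (D.comm.pow_pow N (2 * N)).eq, two_mul, pow_add]
    group
  rw [h1] at w₂
  have := (w₁.append w₂).append w₃
  rwa [show N + 2 * N + N = 4 * N by ring] at this

/-- The powers of `s` and of `u` are joined by walks of length `O(N ^ (e + 1))`. -/
theorem walk_pow {s : G} (hs : s ∈ D.S) (hη : D.η s = 1) (hθ : D.θ s = 0) :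
    ∃ K, ∀ N, 1 ≤ N → ∃ n ≤ K * N ^ (e + 1),
      CostWalk (RegionStep D.S D.η D.θ N) (s ^ N) (u ^ N) n := by
  refine ⟨3 + D.bound * 3 ^ e + 3, fun N hN => ?_⟩
  have hηs : ∀ k : ℕ, D.η (s ^ k) = k := fun k => by
    rw [map_pow_of_additive D.η_mul, hη, mul_one]
  have hθs : ∀ k : ℕ, D.θ (s ^ k) = 0 := fun k => by
    rw [map_pow_of_additive D.θ_mul, hθ, mul_zero]
  -- The route is s^N, s^N u^(3N), u^(3N), u^N; its middle part removes one letter s at a time.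
  -- Translation by s^k with k < N lowers the coordinate bound by k, and 3N - 1 - k ≥ N.
  obtain ⟨n₀, hn₀, w₀⟩ := D.walk s hs (3 * N) (by omega)
  have w₁ := regionWalk_pow (S := D.S) (η := D.η) (θ := D.θ) (s ^ N) u D.u_mem (3 * N) N fun i _ => by
    rw [D.η_mul, D.η_u_pow, hηs]
    omega
  have w₂ : ∀ k ≤ N, CostWalk (RegionStep D.S D.η D.θ N) (s ^ k * u ^ (3 * N)) (u ^ (3 * N))
      (k * n₀) := by
    intro k
    induction k with
    | zero => intro _; simpa using CostWalk.nil _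
    | succ k ih =>
      intro hk
      have w := (w₀.map (R' := RegionStep D.S D.η D.θ N) (fun x => s ^ k * x) fun _ _ _ h =>
        h.translate D.η_mul D.θ_mul (by rw [hηs, hθs]; omega)).reverse fun _ _ _ h => h.symm
      rw [← mul_assoc, ← pow_succ] at w
      have := w.append (ih (by omega))
      rwa [show n₀ + k * n₀ = (k + 1) * n₀ by ring] at this
  have w₃ := (regionWalk_pow (S := D.S) (η := D.η) (θ := D.θ) (u ^ N) u D.u_mem (2 * N) N fun i _ => by
    rw [← pow_add, D.η_u_pow]
    omega).reverse fun _ _ _ h => h.symm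
  rw [← pow_add, show N + 2 * N = 3 * N by ring] at w₃
  refine ⟨_, ?_, (w₁.append (w₂ N le_rfl)).append w₃⟩
  have h1 : N ≤ N ^ (e + 1) := Nat.le_self_pow (by omega) N
  calc 3 * N + N * n₀ + 2 * N ≤ 3 * N + N * (D.bound * (3 * N) ^ e) + 3 * N := by gcongr; omega
    _ = 3 * N + D.bound * 3 ^ e * N ^ (e + 1) + 3 * N := by rw [mul_pow]; ring
    _ ≤ 3 * N ^ (e + 1) + D.bound * 3 ^ e * N ^ (e + 1) + 3 * N ^ (e + 1) := by gcongr
    _ = _ := by ring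

end FlatData

/-! ### Walks far from the identity in a word norm -/

/-- A step of norm at most `D` between points at norm at least `R`. -/
def FarStep (S : Set G) (D R : ℕ) (x y : G) (k : ℕ) : Prop :=
  nrm S (x⁻¹ * y) ≤ D ∧ R ≤ nrm S x ∧ R ≤ nrm S y ∧ k = 1

theorem FarStep.symm {S : Set G} (hS : Subgroup.closure S = ⊤) {D R : ℕ} {x y : G} {k : ℕ}
    (h : FarStep S D R x y k) : FarStep S D R y x k :=
  ⟨by rw [← nrm_inv hS]; simpa using h.1, h.2.2.1, h.2.1, h.2.2.2⟩

theorem exists_natAbs_le_nrm {T : Set G} (hT : Subgroup.closure T = ⊤) (hfin : T.Finite)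
    {η : G → ℤ} (hη : ∀ x y, η (x * y) = η x + η y) :
    ∃ c : ℕ, 1 ≤ c ∧ ∀ g, (η g).natAbs ≤ c * nrm T g := by
  refine exists_le_mul_nrm hT hfin (fun g => (η g).natAbs) ?_ (fun x y => ?_) (fun x => ?_)
  · have := map_pow_of_additive hη 1 0
    simp at this
    simp [this]
  · rw [hη]
    exact Int.natAbs_add_le _ _
  · rw [map_inv_of_additive hη, Int.natAbs_neg]

/-- One of the two rays of g⟨u⟩ from g avoids the ball of radius r, and g u^N is then taken to u^N
letter by letter. The constant `κ` is fixed before `E`, because applications choose `E` in terms of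
`κ`. -/
theorem FlatData.exists_far_walk {u : G} {e : ℕ} (D : FlatData G u e) {T : Set G}
    (hT : Subgroup.closure T = ⊤) (hfin : T.Finite) :
    ∃ κ : ℕ, 1 ≤ κ ∧ ∀ E : ℕ, ∃ M K L : ℕ, ∀ r, 1 ≤ r → ∀ g, κ * r ≤ nrm T g → nrm T g ≤ E * r →
      ∃ n ≤ K * r ^ (e + 1), CostWalk (FarStep T L r) g (u ^ (M * r)) n := by
  obtain ⟨c₁, hc₁, hη⟩ := exists_natAbs_le_nrm hT hfin D.η_mul
  obtain ⟨c₂, hc₂, hθ⟩ := exists_natAbs_le_nrm hT hfin D.θ_mul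
  obtain ⟨L, hL1, hL⟩ := exists_nrm_map_le D.closure D.finite hT (MonoidHom.id G)
  obtain ⟨c₃, hc₃, hc⟩ := exists_nrm_map_le hT hfin D.closure (MonoidHom.id G)
  simp only [MonoidHom.id_apply] at hL hc
  have hψ : ∀ g, (D.η g).natAbs + (D.θ g).natAbs ≤ (c₁ + c₂) * nrm T g := fun g => by
    rw [add_mul]; exact add_le_add (hη g) (hθ g)
  refine ⟨1 + 2 * c₁ * nrm T u, by omega, fun E => ?_⟩
  -- `E' * r` bounds the `T`-norm of prefixes of a shortest word for `g` in `D.S`. With this `M`,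
  -- points with |η| + |θ| ≥ N - 1 have norm at least (E' + E) r + r, so translates by `g` and by
  -- prefixes stay at norm at least r.
  let E' := L * (c₃ * E)
  let M := (c₁ + c₂) * (E' + E + 1) + 1
  refine ⟨M, 5 * M + c₃ * E * (D.bound * M ^ e), L, fun r hr g hg hgE => ?_⟩
  let N := M * r
  have hM : 1 ≤ M := by simp only [M]; omega
  have hN : 1 ≤ N := Nat.mul_pos hM hr
  have hgen : ∀ {x y k}, GenStep D.S x y k → nrm T (x⁻¹ * y) ≤ L := by
    intro x y k h
    have h1 := nrm_le_of_walk D.closure (CostWalk.single h)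
    rw [h.2] at h1
    exact (hL _).trans (by nlinarith)
  -- translating walks in the region
  have trans : ∀ h, nrm T h ≤ (E' + E) * r → ∀ x y n, CostWalk (RegionStep D.S D.η D.θ (N - 1)) x y n →
      CostWalk (FarStep T L r) (h * x) (h * y) n := by
    intro h hh x y n w
    have key : ∀ x, N - 1 ≤ (D.η x).natAbs + (D.θ x).natAbs → r ≤ nrm T (h * x) := by
      intro x hx
      have h1 := hx.trans (hψ x)
      have h2 : nrm T x ≤ nrm T h + nrm T (h * x) := by
        have := nrm_mul hT h⁻¹ (h * x)
        rwa [inv_mul_cancel_left, nrm_inv hT] at this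
      have h3 : (c₁ + c₂) * ((E' + E) * r + r) ≤ (c₁ + c₂) * nrm T x := by
        refine le_trans ?_ h1
        have : N = (c₁ + c₂) * ((E' + E) * r + r) + r := by simp only [N, M]; ring
        omega
      have h4 := Nat.le_of_mul_le_mul_left h3 (by omega)
      omega
    refine w.map _ fun x y k hs => ⟨?_, key _ hs.2.1, key _ hs.2.2, hs.1.2⟩
    rw [mul_inv_rev, mul_assoc, inv_mul_cancel_left]
    exact hgen hs.1
  -- along the line of `u`
  have line : (∀ k : ℕ, r ≤ nrm T (g * u ^ k)) ∨ ∀ k : ℕ, r ≤ nrm T (g * (u ^ k)⁻¹) := by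
    -- If g u^k and g u^(-k') both had norm below r, then k + k' ≤ 2 c₁ r because η detects powers
    -- of u, and g would have norm below r + 2 c₁ r ‖u‖ = κ r.
    by_contra hcon
    push Not at hcon
    obtain ⟨⟨k, hk⟩, k', hk'⟩ := hcon
    have h1 : nrm T (u ^ (k + k')) ≤ nrm T (g * u ^ k) + nrm T (g * (u ^ k')⁻¹) := by
      have := nrm_mul hT (g * (u ^ k')⁻¹)⁻¹ (g * u ^ k)
      rw [nrm_inv hT] at this
      rw [add_comm k k', pow_add]
      have h2 : (g * (u ^ k')⁻¹)⁻¹ * (g * u ^ k) = u ^ k' * u ^ k := by group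
      rw [h2] at this
      omega
    have h2 := hη (u ^ (k + k'))
    rw [D.η_u_pow, Int.natAbs_natCast] at h2
    have h3 : nrm T g ≤ nrm T (g * u ^ k) + k * nrm T u := by
      have h4 := nrm_mul hT (g * u ^ k) (u ^ k)⁻¹
      have h5 := nrm_zpow hT u k
      rw [zpow_natCast, Int.natAbs_natCast] at h5
      rw [mul_inv_cancel_right, nrm_inv hT] at h4
      omega
    have h4 : k ≤ c₁ * (2 * r) := by
      have : c₁ * nrm T (u ^ (k + k')) ≤ c₁ * (2 * r) := Nat.mul_le_mul_left _ (by omega)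
      omega
    have h5 : k * nrm T u ≤ c₁ * (2 * r) * nrm T u := Nat.mul_le_mul_right _ h4
    have h6 : (1 + 2 * c₁ * nrm T u) * r = r + c₁ * (2 * r) * nrm T u := by ring
    omega
  have hu : nrm T u ≤ L := by
    have := hgen (x := 1) (y := u) (k := 1) ⟨Or.inl (by simpa using D.u_mem), rfl⟩
    simpa using this
  have hgE' : nrm T g ≤ (E' + E) * r := by rw [add_mul]; omega
  have w₁ : ∃ n ≤ 5 * N, CostWalk (FarStep T L r) g (g * u ^ N) n := by
    rcases line with hl | hl
    · refine ⟨N, by omega, ?_⟩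
      have := CostWalk.of_nat (R := FarStep T L r) (fun i => g * u ^ i) N fun i _ =>
        ⟨by simpa [pow_succ, mul_assoc] using hu, hl _, hl _, rfl⟩
      simpa using this
    · have h1 := CostWalk.of_nat (R := FarStep T L r) (fun i => g * (u ^ i)⁻¹) N fun i _ =>
        ⟨by
          have : (g * (u ^ i)⁻¹)⁻¹ * (g * (u ^ (i + 1))⁻¹) = u⁻¹ := by rw [pow_succ']; group
          rw [this, nrm_inv hT]
          exact hu, hl _, hl _, rfl⟩
      simp only [pow_zero, inv_one, mul_one] at h1
      -- If only the negative ray is known to be safe, it is followed to g u^(-N), and the translate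
      -- of the flat by g leads around to g u^N.
      have h2 := trans g hgE' _ _ _ ((D.walk_neg N).mono fun _ _ _ h => h.mono (by omega))
      exact ⟨N + 4 * N, by omega, h1.append h2⟩
  obtain ⟨n₁, hn₁, w₁⟩ := w₁
  have w₂ : ∀ {x y : G} {q : ℕ}, CostWalk (GenStep D.S) x y q → nrm D.S x + q ≤ c₃ * (E * r) →
      ∃ n ≤ q * (D.bound * N ^ e), CostWalk (FarStep T L r) (x * u ^ N) (y * u ^ N) n := by
    intro x y q w
    induction w with
    | nil => intro _; exact ⟨0, by omega, CostWalk.nil _⟩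
    | @cons x z y k q hs w ih =>
      intro hq
      obtain ⟨hs, rfl⟩ := hs
      have hz : nrm D.S z ≤ nrm D.S x + 1 := by
        have h1 := nrm_le_of_walk D.closure
          (CostWalk.single (R := GenStep D.S) (x := x) (y := z) (k := 1) ⟨hs, rfl⟩)
        have h2 := nrm_sub_le D.closure z x
        omega
      obtain ⟨n, hn, w'⟩ := ih (by omega)
      have hnorm : ∀ x, nrm D.S x ≤ c₃ * (E * r) → nrm T x ≤ (E' + E) * r := by
        intro x hx
        refine (hL x).trans ((Nat.mul_le_mul_left L hx).trans ?_)
        have : L * (c₃ * (E * r)) = E' * r := by simp only [E']; ring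
        rw [this, add_mul]
        omega
      have : ∃ n ≤ D.bound * N ^ e, CostWalk (FarStep T L r) (x * u ^ N) (z * u ^ N) n := by
        rcases hs with hs | hs
        · obtain ⟨n, hn, w⟩ := D.walk _ hs N hN
          refine ⟨n, hn, ?_⟩
          have := trans x (hnorm x (by omega)) _ _ _ w
          simpa [mul_assoc] using this
        · obtain ⟨n, hn, w⟩ := D.walk _ hs N hN
          refine ⟨n, hn, ?_⟩
          have := (trans z (hnorm z (by omega)) _ _ _ w).reverse fun _ _ _ h => h.symm hT
          simpa [mul_assoc] using this
      obtain ⟨n', hn', w''⟩ := this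
      exact ⟨n' + n, by rw [add_mul, one_mul]; omega, w''.append w'⟩
  have hq : nrm D.S g ≤ c₃ * (E * r) := (hc g).trans (Nat.mul_le_mul_left _ hgE)
  obtain ⟨n₂, hn₂, w₂⟩ := w₂ (nrm_walk D.closure g) (by simpa using hq)
  rw [one_mul] at w₂
  refine ⟨_, ?_, w₁.append (w₂.reverse fun _ _ _ h => h.symm hT)⟩
  have h1 : r ≤ r ^ (e + 1) := Nat.le_self_pow (by omega) r
  calc n₁ + n₂ ≤ 5 * (M * r) + c₃ * (E * r) * (D.bound * (M * r) ^ e) :=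
        add_le_add hn₁ (hn₂.trans (Nat.mul_le_mul_right _ hq))
    _ = 5 * M * r + c₃ * E * (D.bound * M ^ e) * r ^ (e + 1) := by rw [mul_pow]; ring
    _ ≤ 5 * M * r ^ (e + 1) + c₃ * E * (D.bound * M ^ e) * r ^ (e + 1) := by gcongr
    _ = _ := by ring

end Upper

end CatDiv
end

/-! ### Passing all bounds through one HNN extension -/

noncomputable section

namespace CatDiv

open HNNExtension

section General

variable {G K : Type*} [Group G] [Group K] {f g : K →* G} {hf : Function.Injective f}
  {hg : Function.Injective g}

theorem HNN.t_mul_of (k : K) : (t : HNN f g hf hg) * of (f k) = of (g k) * t := by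
  have := HNNExtension.t_mul_of (φ := (MonoidHom.ofInjective hf).symm.trans
    (MonoidHom.ofInjective hg)) (MonoidHom.ofInjective hf k)
  simpa only [MulEquiv.trans_apply, MulEquiv.symm_apply_apply, MonoidHom.ofInjective_apply]
    using this

theorem closure_hnn {A B : Subgroup G} {φ : A ≃* B} {S : Set G} (hS : Subgroup.closure S = ⊤) :
    Subgroup.closure (of '' S ∪ {t} : Set (HNNExtension G A B φ)) = ⊤ := by
  rw [eq_top_iff]
  rintro x -
  induction x using HNNExtension.induction_on with
  | of g =>
    have h : Subgroup.map (of (φ := φ)) (Subgroup.closure S) ≤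
        Subgroup.closure (of '' S ∪ {t} : Set (HNNExtension G A B φ)) := by
      rw [MonoidHom.map_closure]
      exact Subgroup.closure_mono Set.subset_union_left
    exact h ⟨g, by rw [hS]; trivial, rfl⟩
  | t => exact Subgroup.subset_closure (Or.inr rfl)
  | mul x y hx hy => exact Subgroup.mul_mem _ hx hy
  | inv x hx => exact Subgroup.inv_mem _ hx

theorem exists_additive_extension {η : G → ℤ} (hη : ∀ x y, η (x * y) = η x + η y)
    (hfg : ∀ k, η (f k) = η (g k)) (z : ℤ) :
    ∃ η' : HNN f g hf hg → ℤ, (∀ x y, η' (x * y) = η' x + η' y) ∧ (∀ x, η' (of x) = η x) ∧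
      η' t = z := by
  have h1 : η 1 = 0 := by simpa using map_pow_of_additive hη 1 0
  let F : G →* Multiplicative ℤ :=
    { toFun := fun x => Multiplicative.ofAdd (η x)
      map_one' := by rw [h1]; rfl
      map_mul' := fun x y => by rw [hη]; rfl }
  let F' : HNN f g hf hg →* Multiplicative ℤ :=
    HNNExtension.lift F (Multiplicative.ofAdd z) (by
      intro a
      obtain ⟨k, rfl⟩ := (MonoidHom.ofInjective hf).surjective a
      simp only [MulEquiv.trans_apply, MulEquiv.symm_apply_apply, MonoidHom.ofInjective_apply]
      rw [mul_comm]
      simp [F, hfg])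
  refine ⟨fun x => Multiplicative.toAdd (F' x), fun x y => by simp, fun x => ?_, ?_⟩
  · simp [F', F]
  · simp [F']

theorem nrm_of_le {A B : Subgroup G} {φ : A ≃* B} {S : Set G} (hS : Subgroup.closure S = ⊤) (x : G) :
    nrm (of '' S ∪ {t} : Set (HNNExtension G A B φ)) (of x) ≤ nrm S x := by
  have w := (nrm_walk hS x).map (R' := GenStep (of '' S ∪ {t} : Set (HNNExtension G A B φ))) of
    fun x y k h => ⟨by
      rcases h.1 with h | h
      · exact Or.inl (Or.inl ⟨_, h, by simp⟩)
      · exact Or.inr (Or.inl ⟨_, h, by simp⟩), h.2⟩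
  simpa using nrm_le_of_walk (closure_hnn hS) w

theorem RegionStep.of {A B : Subgroup G} {φ : A ≃* B} {S : Set G} {η θ : G → ℤ}
    {η' θ' : HNNExtension G A B φ → ℤ} (hη : ∀ x, η' (of x) = η x) (hθ : ∀ x, θ' (of x) = θ x)
    {R k : ℕ} {x y : G} (h : RegionStep S η θ R x y k) :
    RegionStep (HNNExtension.of '' S ∪ {t}) η' θ' R (HNNExtension.of x) (HNNExtension.of y) k := by
  refine ⟨⟨?_, h.1.2⟩, by rw [hη, hθ]; exact h.2.1, by rw [hη, hθ]; exact h.2.2⟩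
  rcases h.1.1 with h | h
  · exact Or.inl (Or.inl ⟨_, h, by simp⟩)
  · exact Or.inr (Or.inl ⟨_, h, by simp⟩)

/-- Old walks keep their coordinates in the extension, so only the new generator t needs a walk.
Giving t the same coordinates as u lets η and θ extend again over a later letter that conjugates t
to u. -/
theorem FlatData.exists_hnn {u : G} {e e' : ℕ} (D : FlatData G u e) (he : e ≤ e')
    (hη : ∀ k, D.η (f k) = D.η (g k)) (hθ : ∀ k, D.θ (f k) = D.θ (g k))
    (hwalk : ∃ b : ℕ, ∀ η' θ' : HNN f g hf hg → ℤ, (∀ x y, η' (x * y) = η' x + η' y) →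
      (∀ x y, θ' (x * y) = θ' x + θ' y) → (∀ x, η' (of x) = D.η x) → (∀ x, θ' (of x) = D.θ x) →
      η' t = 1 → θ' t = 0 → ∀ N, 1 ≤ N → ∃ n ≤ b * N ^ e',
        CostWalk (RegionStep (of '' D.S ∪ {t}) η' θ' (N - 1)) (of u ^ N) (t * of u ^ N) n) :
    ∃ D' : FlatData (HNN f g hf hg) (of u) e', D'.S = of '' D.S ∪ {t} ∧ D'.η t = 1 ∧
      D'.θ t = 0 ∧ (∀ x, D'.η (of x) = D.η x) := by
  obtain ⟨η', hη1, hη2, hη3⟩ := exists_additive_extension (hf := hf) (hg := hg) D.η_mul hη 1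
  obtain ⟨θ', hθ1, hθ2, hθ3⟩ := exists_additive_extension (hf := hf) (hg := hg) D.θ_mul hθ 0
  obtain ⟨b, hb⟩ := hwalk
  refine ⟨{ S := of '' D.S ∪ {t}
            finite := (D.finite.image _).union (Set.finite_singleton _)
            closure := closure_hnn D.closure
            η := η'
            θ := θ'
            η_mul := hη1
            θ_mul := hθ1
            p := of D.p
            u_mem := Or.inl ⟨u, D.u_mem, rfl⟩
            p_mem := Or.inl ⟨_, D.p_mem, rfl⟩
            comm := D.comm.map of
            η_u := by rw [hη2, D.η_u]
            θ_u := by rw [hθ2, D.θ_u]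
            η_p := by rw [hη2, D.η_p]
            θ_p := by rw [hθ2, D.θ_p]
            bound := D.bound + b
            walk := ?_ }, rfl, hη3, hθ3, hη2⟩
  rintro _ (⟨w, hw, rfl⟩ | rfl) N hN
  · obtain ⟨n, hn, hwalk⟩ := D.walk w hw N hN
    refine ⟨n, hn.trans ?_, ?_⟩
    · gcongr
      omega
    · have := hwalk.map (R' := RegionStep (of '' D.S ∪ {t}) η' θ' (N - 1)) of
        fun _ _ _ h => h.of hη2 hθ2
      simpa using this
  · obtain ⟨n, hn, hwalk⟩ := hb η' θ' hη1 hθ1 hη2 hθ2 hη3 hθ3 N hN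
    exact ⟨n, hn.trans (by gcongr; omega), hwalk⟩

/-- Walks along generators from `c ^ (-k)` to `c ^ l` that avoid the ball of radius `κ ρ` have length at
least `ρ ^ e`. -/
def AxisBound {G : Type*} [Group G] (S : Set G) (c : G) (e : ℕ) : Prop :=
  ∃ κ : ℕ, 1 ≤ κ ∧ ∀ ρ r n k l : ℕ, 1 ≤ l → κ * ρ ≤ r →
    CostWalk (fun x y k => GenStep S x y k ∧ r ≤ nrm S x ∧ r ≤ nrm S y) ((c ^ k)⁻¹) (c ^ l) n →
    ρ ^ e ≤ n

/-- The endpoints lie on different sides of the edge from 1 to t. The walk crosses it at some b in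
B, which is not 1 because the walk avoids the ball, and from there on it is a walk to the line. -/
theorem axisBound_of_lineBound {A B : Subgroup G} {φ : A ≃* B} {S J : Set G}
    (hS : Subgroup.closure S = ⊤) (hJ : ∀ h ∈ J, h⁻¹ ∈ J) (hSJ : S ⊆ J)
    {e : ℕ} (he : 1 ≤ e)
    (H : LineBound (φ := φ) (nrm (of '' S ∪ {t})) J e) :
    AxisBound (of '' S ∪ {t} : Set (HNNExtension G A B φ)) t e := by
  obtain ⟨κ, hκ, H⟩ := H
  have hS' := closure_hnn (φ := φ) hS
  refine ⟨κ, hκ, fun ρ r n k l hl hr w => ?_⟩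
  rcases Nat.eq_zero_or_pos ρ with rfl | hρ
  · rw [zero_pow (by omega)]
    exact Nat.zero_le _
  have hr0 : 1 ≤ r := le_trans (Nat.mul_pos hκ hρ) hr
  have w' := w.refine (R' := fun x y k => HNNStep (nrm (of '' S ∪ {t})) J r x y k ∧ r ≤ nrm (of '' S ∪ {t}) x)
    (fun x => x) 1 (by
      rintro x y k ⟨⟨hs, rfl⟩, hx, hy⟩
      have inner : ∀ {x y : HNNExtension G A B φ}, x⁻¹ * y ∈ (of '' S ∪ {t} : Set _) →
          r ≤ nrm (of '' S ∪ {t}) x → r ≤ nrm (of '' S ∪ {t}) y →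
          ∃ k' ≤ 1, HNNStep (nrm (of '' S ∪ {t})) J r x y k' := by
        intro x y hs hx hy
        rcases hs with ⟨h, hh, hxy⟩ | hxy
        · refine ⟨_, ?_, Or.inl ⟨h, hSJ hh, by rw [hxy]; simp, hx, hy, rfl⟩⟩
          exact nrm_le_one hS' (Or.inl ⟨h, hh, rfl⟩)
        · exact ⟨1, le_rfl, Or.inr ⟨Or.inl (by rw [← Set.mem_singleton_iff.1 hxy]; simp), rfl⟩⟩
      rcases hs with hs | hs
      · obtain ⟨k', hk', h⟩ := inner hs hx hy
        exact ⟨k', by omega, CostWalk.single ⟨h, hx⟩⟩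
      · obtain ⟨k', hk', h⟩ := inner hs hy hx
        exact ⟨k', by omega, CostWalk.single ⟨h.symm (isNorm_nrm hS') hJ, hx⟩⟩)
  obtain ⟨n', hn', w'⟩ := w'
  obtain ⟨p, q, k', n₁, n₂, -, ⟨hs, hpr⟩, hlt, w₂, rfl⟩ := w'.exists_step_lt (fun x => wall (1 * x)) (by
    rw [one_mul, one_mul, wall_t_pow_neg, ← zpow_natCast, wall_t_zpow_pos (by omega)]
    exact one_pos)
  obtain ⟨hq, b, hb, hp⟩ := hs.wall_lt hlt
  rw [one_mul] at hp
  subst hp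
  have hb1 : b ≠ 1 := by
    rintro rfl
    rw [map_one, nrm_one] at hpr
    omega
  have := H ρ r (k' + n₂) b l hr hb1 (by
    rw [zpow_natCast]
    exact CostWalk.cons hs (w₂.mono fun _ _ _ h => h.1))
  omega

/-- The data about `B_m` that are carried along the tower; here `m = e + 1`. -/
structure StageBounds (T : Stage) (e : ℕ) where
  flat : FlatData T.carrier T.s₁ e
  s_mem : T.s ∈ flat.S
  η_s : flat.η T.s = 1
  θ_s : flat.θ T.s = 0
  disjoint : Subgroup.zpowers T.s ⊓ Subgroup.zpowers T.s₁ = ⊥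
  J : Set T.carrier
  inv_mem : ∀ h ∈ J, h⁻¹ ∈ J
  subset : flat.S ⊆ J
  zpowers_subset : (Subgroup.zpowers T.s₁ : Set T.carrier) ⊆ J
  subset_union : ∀ h ∈ J, h ∈ flat.S ∨ h⁻¹ ∈ flat.S ∨ h ∈ Subgroup.zpowers T.s₁
  subgroup : SubgroupBound (nrm flat.S) J (Subgroup.zpowers T.s) (Subgroup.zpowers T.s₁) (e + 1)
  axis : AxisBound flat.S T.s (e + 1)

end General

section Step

variable {G K : Type} [Group G] [Group K] {f g : K →* G} {hf : Function.Injective f}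
  {hg : Function.Injective g}

/-- An additive function with value 1 at `x` reads off exponents, so ⟨x⟩ is undistorted. -/
theorem natAbs_le_nrm_zpow {G : Type*} [Group G] {S : Set G} {η : G → ℤ} {c : ℕ}
    (hη : ∀ x y, η (x * y) = η x + η y) (hc : ∀ g, (η g).natAbs ≤ c * nrm S g) {x : G}
    (hx : η x = 1) (l : ℤ) : l.natAbs ≤ c * nrm S (x ^ l) := by
  have : η (x ^ l) = l := by
    obtain ⟨k, rfl | rfl⟩ := l.eq_nat_or_neg
    · rw [zpow_natCast, map_pow_of_additive hη, hx, mul_one]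
    · rw [zpow_neg, zpow_natCast, map_inv_of_additive hη, map_pow_of_additive hη, hx, mul_one]
  have h1 := hc (x ^ l)
  rwa [this] at h1

/-- The bounds for an HNN extension from a bound between the associated subgroups. -/
theorem exists_stageBounds {u : G} {e : ℕ} (D : FlatData G u e) {J : Set G}
    (hJ : ∀ h ∈ J, h⁻¹ ∈ J) (hSJ : D.S ⊆ J) (huJ : (Subgroup.zpowers u : Set G) ⊆ J)
    (hJS : ∀ h ∈ J, h ∈ D.S ∨ h⁻¹ ∈ D.S ∨ h ∈ Subgroup.zpowers u)
    (hu : Function.Injective (zpowersHom (HNN f g hf hg) (of u)))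
    (hη : ∀ k, D.η (f k) = D.η (g k)) (hθ : ∀ k, D.θ (f k) = D.θ (g k))
    (hwalk : ∃ b : ℕ, ∀ η' θ' : HNN f g hf hg → ℤ, (∀ x y, η' (x * y) = η' x + η' y) →
      (∀ x y, θ' (x * y) = θ' x + θ' y) → (∀ x, η' (of x) = D.η x) → (∀ x, θ' (of x) = D.θ x) →
      η' t = 1 → θ' t = 0 → ∀ N, 1 ≤ N → ∃ n ≤ b * N ^ (e + 1),
        CostWalk (RegionStep (of '' D.S ∪ {t}) η' θ' (N - 1)) (of u ^ N) (t * of u ^ N) n)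
    (hdist : ∃ c : ℕ, ∀ k, nrm D.S (f k) ≤ c * nrm (of '' D.S ∪ {t} : Set (HNN f g hf hg)) (of (f k)) ∧
      nrm D.S (g k) ≤ c * nrm (of '' D.S ∪ {t} : Set (HNN f g hf hg)) (of (g k)))
    (hdisj : f.range ⊓ g.range = ⊥) (H : SubgroupBound (nrm D.S) J f.range g.range (e + 1)) :
    Nonempty (StageBounds ⟨HNN f g hf hg, of u, t, hu, HNN.t_inj f g hf hg⟩ (e + 1)) := by
  obtain ⟨D', hS', hη', hθ', hηof⟩ := D.exists_hnn (Nat.le_succ e) hη hθ hwalk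
  obtain ⟨c₁, hc₁⟩ := hdist
  obtain ⟨c₂, hc₂, hc₂'⟩ := exists_natAbs_le_nrm D'.closure D'.finite D'.η_mul
  have hN' := isNorm_nrm D'.closure
  have ht1 : nrm D'.S t ≤ 1 := nrm_le_one D'.closure (by rw [hS']; exact Or.inr rfl)
  have hle : ∀ x, nrm D'.S (of x) ≤ nrm D.S x := fun x => by
    rw [hS']
    exact nrm_of_le D.closure x
  have hpos : ∀ x : G, x ≠ 1 → 1 ≤ nrm D'.S (of x) := by
    intro x hx
    rw [Nat.one_le_iff_ne_zero, Ne, nrm_eq_zero D'.closure]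
    intro h
    exact hx (of_injective _ (h.trans (map_one _).symm))
  have hgen : ∀ x : G, x ∈ D.S → nrm D.S x ≤ nrm D'.S (of x) := by
    intro x hx
    by_cases h1 : x = 1
    · simp [h1]
    · exact (nrm_le_one D.closure hx).trans (hpos x h1)
  -- Nontrivial generators have norm at most 1 in the base group and at least 1 in the extension,
  -- powers of u are detected by η, and the associated subgroups are undistorted by assumption.
  have hc : ∀ h ∈ J ∪ f.range ∪ g.range, nrm D.S h ≤ (1 + c₁ + c₂) * nrm D'.S (of h) := by
    have mono : ∀ x : G, ∀ c, c ≤ 1 + c₁ + c₂ → nrm D.S x ≤ c * nrm D'.S (of x) →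
        nrm D.S x ≤ (1 + c₁ + c₂) * nrm D'.S (of x) :=
      fun x c hc h => h.trans (Nat.mul_le_mul_right _ hc)
    rintro h ((hh | ⟨k, rfl⟩) | ⟨k, rfl⟩)
    · rcases hJS h hh with hh | hh | ⟨l, rfl⟩
      · exact mono h 1 (by omega) (by rw [one_mul]; exact hgen h hh)
      · refine mono h 1 (by omega) ?_
        have := hgen _ hh
        rw [nrm_inv D.closure, map_inv, nrm_inv D'.closure] at this
        rwa [one_mul]
      · refine mono _ c₂ (by omega) ?_
        have h1 := natAbs_le_nrm_zpow D'.η_mul hc₂' (x := of u) (by rw [hηof, D.η_u]) l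
        have h2 := nrm_zpow D.closure u l
        have h3 := nrm_le_one D.closure D.u_mem
        rw [map_zpow]
        exact h2.trans ((Nat.mul_le_mul_left _ h3).trans (by rwa [mul_one]))
    · exact mono _ c₁ (by omega) (by rw [hS']; exact (hc₁ k).1)
    · exact mono _ c₁ (by omega) (by rw [hS']; exact (hc₁ k).2)
  have HL := lineBound_of_subgroupBound hN' ht1 hle hJ (by omega) hc hdisj H
  have HS := subgroupBound_of_lineBound hN' hJ (D := Subgroup.zpowers u) (c := c₂) hc₂
    (fun l => natAbs_le_nrm_zpow D'.η_mul hc₂' hη' l) huJ (by omega) HL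
  rw [MonoidHom.map_zpowers] at HS
  refine ⟨{ flat := D'
            s_mem := by rw [hS']; exact Or.inr rfl
            η_s := hη'
            θ_s := hθ'
            disjoint := ?_
            J := of '' J ∪ {t, t⁻¹}
            inv_mem := ?_
            subset := ?_
            zpowers_subset := ?_
            subset_union := ?_
            subgroup := HS
            axis := ?_ }⟩
  · rw [eq_bot_iff]
    rintro x ⟨⟨l, hl⟩, l', hl'⟩
    rw [Subgroup.mem_bot]
    by_cases h0 : l = 0
    · rw [← hl, h0]
      exact zpow_zero _
    · refine absurd (hl.trans hl'.symm) ?_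
      have := t_zpow_ne_of (φ := (MonoidHom.ofInjective hf).symm.trans
        (MonoidHom.ofInjective hg)) h0 (u ^ l')
      rw [map_zpow] at this
      exact this
  · rintro h (⟨x, hx, rfl⟩ | rfl | rfl)
    · exact Or.inl ⟨x⁻¹, hJ x hx, map_inv _ _⟩
    · exact Or.inr (Or.inr rfl)
    · exact Or.inr (Or.inl (inv_inv _))
  · rw [hS']
    rintro h (⟨x, hx, rfl⟩ | rfl)
    · exact Or.inl ⟨x, hSJ hx, rfl⟩
    · exact Or.inr (Or.inl rfl)
  · rintro _ ⟨l, rfl⟩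
    exact Or.inl ⟨u ^ l, huJ ⟨l, rfl⟩, map_zpow _ _ _⟩
  · rw [hS']
    rintro h (⟨x, hx, rfl⟩ | rfl | rfl)
    · rcases hJS x hx with hx | hx | ⟨l, rfl⟩
      · exact Or.inl (Or.inl ⟨x, hx, rfl⟩)
      · exact Or.inr (Or.inl (Or.inl ⟨_, hx, map_inv _ _⟩))
      · exact Or.inr (Or.inr ⟨l, (map_zpow _ _ _).symm⟩)
    · exact Or.inl (Or.inr rfl)
    · exact Or.inr (Or.inl (Or.inr (inv_inv _)))
  · rw [hS'] at HL ⊢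
    exact axisBound_of_lineBound D.closure hJ hSJ (by omega) HL

theorem range_zpowersHom {G : Type*} [Group G] (x : G) :
    (zpowersHom G x).range = Subgroup.zpowers x := by
  ext y
  constructor
  · rintro ⟨k, rfl⟩
    exact ⟨Multiplicative.toAdd k, rfl⟩
  · rintro ⟨k, rfl⟩
    exact ⟨Multiplicative.ofAdd k, rfl⟩

/-- The associated generators s_m and s₁ have equal coordinates, so η and θ extend. The new walk is
u^N, u^N t = t s_m^N, t u^N, its last part being a translate of `FlatData.walk_pow`. The subgroup
bound needed is the one carried from the previous stage. -/
theorem StageBounds.next {T : Stage} {e : ℕ} (D : StageBounds T e) :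
    Nonempty (StageBounds T.next (e + 1)) := by
  have ha : ∀ {η : T.carrier → ℤ} (_ : ∀ x y, η (x * y) = η x + η y) (x : T.carrier) (k : ℤ),
      η (x ^ k) = k * η x := by
    intro η hη x k
    obtain ⟨k, rfl | rfl⟩ := k.eq_nat_or_neg
    · rw [zpow_natCast, map_pow_of_additive hη]
    · rw [zpow_neg, zpow_natCast, map_inv_of_additive hη, map_pow_of_additive hη, neg_mul]
  refine exists_stageBounds D.flat D.inv_mem D.subset D.zpowers_subset D.subset_union
    (HNN.of_inj _ _ _ _ T.s₁_inj) (fun k => ?_) (fun k => ?_) ?_ ?_ ?_ ?_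
  · rw [zpowersHom_apply, zpowersHom_apply, ha D.flat.η_mul, ha D.flat.η_mul, D.η_s, D.flat.η_u]
  · rw [zpowersHom_apply, zpowersHom_apply, ha D.flat.θ_mul, ha D.flat.θ_mul, D.θ_s, D.flat.θ_u]
  · obtain ⟨b, hb⟩ := D.flat.walk_pow D.s_mem D.η_s D.θ_s
    refine ⟨1 + b, fun η' θ' hη' hθ' hη hθ hηt hθt N hN => ?_⟩
    obtain ⟨n, hn, w⟩ := hb N hN
    have hrel : (t : T.next.carrier) * of T.s ^ N = of T.s₁ ^ N * t := by
      have := HNN.t_mul_of (hf := T.s_inj) (hg := T.s₁_inj) (Multiplicative.ofAdd (N : ℤ))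
      simpa only [zpowersHom_apply, toAdd_ofAdd, zpow_natCast, map_pow] using this
    have hη1 : η' (of T.s₁ ^ N) = N := by rw [← map_pow, hη, D.flat.η_u_pow]
    have hη2 : η' (of T.s₁ ^ N * t) = N + 1 := by rw [hη', hη1, hηt]
    refine ⟨1 + n, ?_, CostWalk.cons (y := of T.s₁ ^ N * t) ⟨⟨Or.inl ?_, rfl⟩, ?_, ?_⟩ ?_⟩
    · have : 1 ≤ N ^ (e + 1) := Nat.one_le_pow _ _ hN
      rw [add_mul, one_mul]
      omega
    · rw [inv_mul_cancel_left]
      exact Or.inr rfl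
    · rw [hη1]
      omega
    · rw [hη2]
      omega
    -- Translation by t loses one unit because η t = 1; this is why the walks of `FlatData` are only
    -- required to stay at N - 1.
    · have w₁ := (w.map (R' := RegionStep (of '' D.flat.S ∪ {t}) η' θ' N) of
        fun _ _ _ h => h.of hη hθ).map (R' := RegionStep (of '' D.flat.S ∪ {t}) η' θ' (N - 1))
          (fun x => t * x) fun _ _ _ h => h.translate hη' hθ' (by rw [hηt, hθt]; omega)
      rw [map_pow, map_pow, hrel] at w₁
      exact w₁
  · have hS' := closure_hnn (φ := (MonoidHom.ofInjective T.s_inj).symm.trans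
      (MonoidHom.ofInjective T.s₁_inj)) D.flat.closure
    have hfin : (of '' D.flat.S ∪ {t} : Set T.next.carrier).Finite :=
      (D.flat.finite.image _).union (Set.finite_singleton _)
    obtain ⟨η', hη1, hη2, -⟩ := exists_additive_extension (hf := T.s_inj) (hg := T.s₁_inj)
      D.flat.η_mul (fun k => by
        rw [zpowersHom_apply, zpowersHom_apply, ha D.flat.η_mul, ha D.flat.η_mul, D.η_s,
          D.flat.η_u]) 1
    obtain ⟨c, -, hc⟩ := exists_natAbs_le_nrm hS' hfin hη1
    have key : ∀ x ∈ D.flat.S, D.flat.η x = 1 → ∀ l : ℤ, nrm D.flat.S (x ^ l) ≤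
        c * nrm (of '' D.flat.S ∪ {t} : Set T.next.carrier) (of (x ^ l)) := by
      intro x hx hηx l
      have h1 := natAbs_le_nrm_zpow hη1 hc (x := of x) (by rw [hη2, hηx]) l
      have h2 := nrm_zpow D.flat.closure x l
      have h3 := nrm_le_one D.flat.closure hx
      rw [map_zpow]
      exact h2.trans ((Nat.mul_le_mul_left _ h3).trans (by rwa [mul_one]))
    exact ⟨c, fun k => ⟨key _ D.s_mem D.η_s _, key _ D.flat.u_mem D.flat.η_u _⟩⟩
  · rw [range_zpowersHom, range_zpowersHom]
    exact D.disjoint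
  · rw [range_zpowersHom, range_zpowersHom]
    exact D.subgroup

end Step

end CatDiv
end

/-! ### The start of the induction: B₁ and B₂ -/

noncomputable section

namespace CatDiv

open HNNExtension

theorem fg_semidirectProduct {H Q : Type*} [Group H] [Group Q] [Group.FG H] [Group.FG Q]
    (f : Q →* MulAut H) : Group.FG (H ⋊[f] Q) := by
  obtain ⟨S, hS, hSf⟩ := Group.fg_iff.1 (inferInstance : Group.FG H)
  obtain ⟨R, hR, hRf⟩ := Group.fg_iff.1 (inferInstance : Group.FG Q)
  refine Group.fg_iff.2 ⟨SemidirectProduct.inl '' S ∪ SemidirectProduct.inr '' R, ?_,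
    (hSf.image _).union (hRf.image _)⟩
  rw [eq_top_iff]
  rintro x -
  rw [Subgroup.closure_union, ← MonoidHom.map_closure, ← MonoidHom.map_closure, hS, hR,
    ← SemidirectProduct.inl_left_mul_inr_right x]
  exact Subgroup.mul_mem_sup ⟨_, trivial, rfl⟩ ⟨_, trivial, rfl⟩

instance FreeByCyclic.instFG (n : ℕ) : Group.FG (FreeByCyclic n) := fg_semidirectProduct _

section Base

variable {n : ℕ} {C : Type} [Group C]

theorem amalgam_fg [hC : Group.FG C] (ι : FreeByCyclic n →* C) : Group.FG (Amalgam ι) := by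
  obtain ⟨S, hS, hSf⟩ := Group.fg_iff.1 hC
  obtain ⟨R, hR, hRf⟩ := Group.fg_iff.1
    (inferInstance : Group.FG (FreeByCyclic n × FreeByCyclic n × FreeByCyclic n))
  let i₀ : C →* Amalgam ι := Monoid.PushoutI.of (φ := edgeMap ι) false
  let i₁ : FreeByCyclic n × FreeByCyclic n × FreeByCyclic n →* Amalgam ι :=
    Monoid.PushoutI.of (φ := edgeMap ι) true
  refine Group.fg_iff.2 ⟨i₀ '' S ∪ i₁ '' R, ?_, (hSf.image _).union (hRf.image _)⟩
  rw [eq_top_iff]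
  rintro x -
  rw [Subgroup.closure_union, ← MonoidHom.map_closure, ← MonoidHom.map_closure, hS, hR]
  have h0 : ∀ c, i₀ c ∈ Subgroup.map i₀ ⊤ ⊔ Subgroup.map i₁ ⊤ :=
    fun c => Subgroup.mem_sup_left ⟨c, trivial, rfl⟩
  have h1 : ∀ c, i₁ c ∈ Subgroup.map i₀ ⊤ ⊔ Subgroup.map i₁ ⊤ :=
    fun c => Subgroup.mem_sup_right ⟨c, trivial, rfl⟩
  induction x using Monoid.PushoutI.induction_on with
  | of i g =>
    cases i
    · exact h0 g
    · exact h1 g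
  | base h =>
    rw [← Monoid.PushoutI.of_comp_eq_base (φ := edgeMap ι) false]
    exact h0 _
  | mul x y hx hy => exact Subgroup.mul_mem _ hx hy

/-- The maps of the vertex groups to `C`: the identity, and the projection to `A_x = A_d`. -/
def retractionVertex (ι : FreeByCyclic n →* C) : ∀ i, VertexGroup n C i →* C
  | false => MonoidHom.id C
  | true => ι.comp (MonoidHom.fst (FreeByCyclic n) (FreeByCyclic n × FreeByCyclic n))

/-- The retraction of `B₁` to `C`. -/
def retraction (ι : FreeByCyclic n →* C) : BaseGroup ι →* C :=
  (Monoid.PushoutI.lift (φ := edgeMap ι) (retractionVertex ι) ι (by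
    intro i
    cases i
    · rfl
    · rfl)).comp (MonoidHom.fst _ _)

theorem retraction_triple (ι : FreeByCyclic n →* C)
    (p : FreeByCyclic n × FreeByCyclic n × FreeByCyclic n) : retraction ι (triple ι p) = ι p.1 := by
  simp only [retraction, triple, MonoidHom.comp_apply, MonoidHom.coe_fst]
  erw [Monoid.PushoutI.lift_of]

theorem retraction_diagXZ (ι : FreeByCyclic n →* C) (a : FreeByCyclic n) :
    retraction ι (diagXZ ι a) = ι a := retraction_triple ι _

theorem retraction_diagYZ (ι : FreeByCyclic n →* C) (a : FreeByCyclic n) :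
    retraction ι (diagYZ ι a) = 1 := (retraction_triple ι _).trans (map_one ι)

theorem projZ_diagXZ (ι : FreeByCyclic n →* C) (a : FreeByCyclic n) :
    projZ ι (diagXZ ι a) = a := projZ_triple ι _

theorem projZ_diagYZ (ι : FreeByCyclic n →* C) (a : FreeByCyclic n) :
    projZ ι (diagYZ ι a) = a := projZ_triple ι _

/-- The stable letter of `A`. -/
def stableA (n : ℕ) : FreeByCyclic n := SemidirectProduct.inr (Multiplicative.ofAdd 1)

theorem commute_s₁ (ι : FreeByCyclic n →* C) (x : BaseGroup ι) :
    Commute x (stage₁ ι).s₁ := by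
  apply Prod.ext
  · exact (mul_one x.1).trans (one_mul x.1).symm
  · exact mul_comm _ _

theorem projZ_s₁ (ι : FreeByCyclic n →* C) : projZ ι (stage₁ ι).s₁ = 1 := by
  simp only [projZ, MonoidHom.comp_apply, MonoidHom.coe_fst]
  exact map_one _

/-- Since u = s₁ is central, u^N and w u^N = u^N w are one step apart, so the exponent is 0. The
coordinates are the exponents of s₁ and of t_z. Both t_x t_z and t_y t_z are made generators,
because the walk for s₂ uses the flat of each. -/
theorem exists_baseFlat [Group.FG C] (ι : FreeByCyclic n →* C) :
    ∃ D : FlatData (stage₁ ι).carrier (stage₁ ι).s₁ 0, diagXZ ι (stableA n) ∈ D.S ∧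
      diagYZ ι (stableA n) ∈ D.S ∧ (∀ x, D.η x = Multiplicative.toAdd x.2) ∧
      ∀ x, D.θ x = Multiplicative.toAdd (projZ ι x).right := by
  obtain ⟨S, hS, hSf⟩ := Group.fg_iff.1 (amalgam_fg ι)
  let P : Set (BaseGroup ι) := {diagXZ ι (stableA n), diagYZ ι (stableA n)}
  let R : Set (BaseGroup ι) := MonoidHom.inl _ _ '' S ∪ P ∪ {(stage₁ ι).s₁}
  have hR : Subgroup.closure R = ⊤ := by
    rw [eq_top_iff]
    rintro x -
    have h1 : ∀ a, MonoidHom.inl (Amalgam ι) (Multiplicative ℤ) a ∈ Subgroup.closure R := by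
      intro a
      have : Subgroup.map (MonoidHom.inl (Amalgam ι) (Multiplicative ℤ)) (Subgroup.closure S) ≤
          Subgroup.closure R := by
        rw [MonoidHom.map_closure]
        exact Subgroup.closure_mono fun x hx => Or.inl (Or.inl hx)
      exact this (Subgroup.mem_map_of_mem _ (by rw [hS]; trivial))
    have h2 : (stage₁ ι).s₁ ^ (Multiplicative.toAdd x.2) ∈ Subgroup.closure R :=
      Subgroup.zpow_mem _ (Subgroup.subset_closure (show (stage₁ ι).s₁ ∈ R from Or.inr rfl)) _
    have h3 : x = MonoidHom.inl (Amalgam ι) (Multiplicative ℤ) x.1 *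
        (stage₁ ι).s₁ ^ (Multiplicative.toAdd x.2) := by
      apply Prod.ext
      · exact ((congrArg (x.1 * ·) (one_zpow (Multiplicative.toAdd x.2))).trans (mul_one x.1)).symm
      · show x.2 = 1 * Multiplicative.ofAdd 1 ^ Multiplicative.toAdd x.2
        rw [← ofAdd_zsmul]
        simp
    rw [h3]
    exact Subgroup.mul_mem _ (h1 _) h2
  -- No generator has negative η, so the endpoint w u^N stays in the region.
  have hR2 : ∀ w ∈ R, 0 ≤ Multiplicative.toAdd w.2 := by
    rintro w ((⟨x, -, rfl⟩ | rfl | rfl) | rfl)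
    · exact le_rfl
    · exact le_rfl
    · exact le_rfl
    · exact zero_le_one
  have hη : ∀ k : ℕ, Multiplicative.toAdd ((stage₁ ι).s₁ ^ k).2 = k := by
    intro k
    show Multiplicative.toAdd (Multiplicative.ofAdd (1 : ℤ) ^ k) = k
    rw [← ofAdd_nsmul]
    simp
  refine ⟨{ S := R
            finite := ((hSf.image _).union (by simp [P])).union (Set.finite_singleton _)
            closure := hR
            η := fun x => Multiplicative.toAdd x.2
            θ := fun x => Multiplicative.toAdd (projZ ι x).right
            η_mul := fun x y => rfl
            θ_mul := fun x y => by rw [map_mul]; rfl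
            p := diagXZ ι (stableA n)
            u_mem := Or.inr rfl
            p_mem := Or.inl (Or.inr (Or.inl rfl))
            comm := commute_s₁ ι _
            η_u := rfl
            θ_u := by rw [projZ_s₁]; rfl
            η_p := rfl
            θ_p := by rw [projZ_diagXZ]; rfl
            bound := 1
            walk := ?_ }, Or.inl (Or.inr (Or.inl rfl)), Or.inl (Or.inr (Or.inr rfl)),
            fun _ => rfl, fun _ => rfl⟩
  intro w hw N hN
  refine ⟨1, by simp, CostWalk.single ⟨⟨Or.inl ?_, rfl⟩, ?_, ?_⟩⟩
  · rw [((commute_s₁ ι w).pow_right N).eq, inv_mul_cancel_left]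
    exact hw
  · dsimp only
    rw [hη]
    omega
  · dsimp only
    have h1 := hR2 w hw
    have : Multiplicative.toAdd (w * (stage₁ ι).s₁ ^ N).2 = Multiplicative.toAdd w.2 + N := by
      rw [← hη]
      rfl
    rw [this]
    omega

theorem le_of_jumpWalk {G : Type*} [Group G] {N : G → ℕ} (hN : IsNorm N) {J : Set G} {r k : ℕ}
    {x y : G} (w : CostWalk (JumpStep N J r) x y k) : N (x⁻¹ * y) ≤ k := by
  induction w with
  | nil => simp [hN.one]
  | @cons x z y k n h _ ih =>
    have h1 := hN.mul (x⁻¹ * z) (z⁻¹ * y)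
    rw [mul_assoc, mul_inv_cancel_left] at h1
    have := h.2.2.2
    omega

/-- The homomorphism `B₂ → A_z`. -/
def projZ₂ (ι : FreeByCyclic n →* C) : (stage₂ ι).carrier →* FreeByCyclic n :=
  HNNExtension.lift (projZ ι) 1 (by
    intro a
    obtain ⟨k, rfl⟩ := (MonoidHom.ofInjective (diagYZ_injective ι)).surjective a
    simp only [MulEquiv.trans_apply, MulEquiv.symm_apply_apply, MonoidHom.ofInjective_apply]
    rw [projZ_diagXZ, projZ_diagYZ, one_mul, mul_one])

/-- A subgroup of `C` is undistorted. -/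
def Undistorted (ι : FreeByCyclic n →* C) : Prop :=
  ∃ (R : Set (FreeByCyclic n)) (S : Set C), R.Finite ∧ Subgroup.closure R = ⊤ ∧ S.Finite ∧
    Subgroup.closure S = ⊤ ∧ ∃ c : ℕ, ∀ a, nrm R a ≤ c * nrm S (ι a)

theorem exists_stageBounds₂ [Group.FG C] {ι : FreeByCyclic n →* C} (hι : Function.Injective ι)
    (hu : Undistorted ι) : Nonempty (StageBounds (stage₂ ι) 1) := by
  obtain ⟨D, hp, hq, hDη, hDθ⟩ := exists_baseFlat ι
  obtain ⟨R, SC, hRf, hR, hSCf, hSC, c, hc⟩ := hu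
  let J : Set (stage₁ ι).carrier := D.S ∪ D.S⁻¹ ∪ Subgroup.zpowers (stage₁ ι).s₁
  refine exists_stageBounds (hf := diagYZ_injective ι) (hg := diagXZ_injective ι) D (J := J) ?_ ?_
    ?_ ?_ (stage₂ ι).s₁_inj (fun k => ?_) (fun k => ?_) ?_ ?_ ?_ ?_
  · rintro h ((h1 | h1) | h1)
    · exact Or.inl (Or.inr (by rw [Set.mem_inv, inv_inv]; exact h1))
    · exact Or.inl (Or.inl h1)
    · exact Or.inr (Subgroup.inv_mem _ h1)
  · exact fun h h1 => Or.inl (Or.inl h1)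
  · exact fun h h1 => Or.inr h1
  · rintro h ((h1 | h1) | h1)
    · exact Or.inl h1
    · exact Or.inr (Or.inl h1)
    · exact Or.inr (Or.inr h1)
  · rw [hDη, hDη]
    rfl
  · rw [hDθ, hDθ, projZ_diagXZ, projZ_diagYZ]
  -- With p = t_x t_z and q = t_y t_z the route is u^N, p^N, p^N t = t q^N, t u^N: a flat, one edge,
  -- and a translate of another flat.
  · refine ⟨5, fun η θ hη hθ hηof hθof hηt hθt N hN => ⟨2 * N + 1 + 2 * N, ?_, ?_⟩⟩
    · rw [zero_add, pow_one]
      omega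
    · let p := diagXZ ι (stableA n)
      let q := diagYZ ι (stableA n)
      let u := (stage₁ ι).s₁
      have hηp : D.η p = 0 := by rw [hDη]; rfl
      have hηq : D.η q = 0 := by rw [hDη]; rfl
      have hθp : D.θ p = 1 := by rw [hDθ, projZ_diagXZ]; rfl
      have hθq : D.θ q = 1 := by rw [hDθ, projZ_diagYZ]; rfl
      have pw : ∀ {ζ : (stage₁ ι).carrier → ℤ} (_ : ∀ x y, ζ (x * y) = ζ x + ζ y) x (k : ℕ),
        ζ (x ^ k) = k * ζ x := fun h => map_pow_of_additive h
      have side : ∀ r, r ∈ D.S → D.η r = 0 → D.θ r = 1 →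
          CostWalk (RegionStep D.S D.η D.θ N) (u ^ N) (r ^ N) (2 * N) := by
        intro r hr hηr hθr
        have w₁ := regionWalk_pow (S := D.S) (η := D.η) (θ := D.θ) (u ^ N) r hr N N fun i _ => by
          rw [D.η_mul, pw D.η_mul, pw D.η_mul, D.η_u, hηr]
          omega
        have w₂ := (regionWalk_pow (S := D.S) (η := D.η) (θ := D.θ) (r ^ N) u D.u_mem N N
          fun i _ => by
            rw [D.θ_mul, pw D.θ_mul, pw D.θ_mul, D.θ_u, hθr]
            omega).reverse fun _ _ _ h => h.symm
        rw [((commute_s₁ ι r).pow_pow N N).eq] at w₂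
        have := w₁.append w₂
        rwa [← two_mul] at this
      have up : ∀ {x y m}, CostWalk (RegionStep D.S D.η D.θ N) x y m →
          CostWalk (RegionStep (of '' D.S ∪ {t}) η θ N) (of x : (stage₂ ι).carrier) (of y) m :=
        fun w => w.map of fun _ _ _ h => h.of hηof hθof
      have w₁ := (up (side p hp hηp hθp)).mono fun _ _ _ h => h.mono (Nat.sub_le N 1)
      have w₂ := ((up (side q hq hηq hθq)).map
        (R' := RegionStep (of '' D.S ∪ {t}) η θ (N - 1)) (fun x => t * x) fun _ _ _ h =>
          h.translate hη hθ (by rw [hηt, hθt]; omega)).reverse fun _ _ _ h => h.symm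
      have hrel : (t : (stage₂ ι).carrier) * of (q ^ N) = of (p ^ N) * t := by
        have := HNN.t_mul_of (hf := diagYZ_injective ι) (hg := diagXZ_injective ι) (stableA n ^ N)
        rwa [(diagYZ ι).map_pow, (diagXZ ι).map_pow] at this
      have h1 : θ (of (p ^ N)) = N := by rw [hθof, pw D.θ_mul, hθp, mul_one]
      have w₃ : CostWalk (RegionStep (of '' D.S ∪ {t}) η θ (N - 1))
          (of (p ^ N) : (stage₂ ι).carrier) (t * of (q ^ N)) 1 := by
        refine CostWalk.single ⟨⟨Or.inl ?_, rfl⟩, ?_, ?_⟩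
        · rw [hrel, inv_mul_cancel_left]
          exact Or.inr rfl
        · rw [h1]
          omega
        · rw [hrel, hθ, h1, hθt]
          omega
      have w := (w₁.append w₃).append w₂
      simpa only [map_pow] using w
  -- The projection to A_z has the same values on both diagonals, so it extends to B₂ with t ↦ 1. It
  -- is a left inverse of both diagonal maps, which makes the associated subgroups undistorted.
  · have hS' := closure_hnn (φ := (MonoidHom.ofInjective (diagYZ_injective ι)).symm.trans
      (MonoidHom.ofInjective (diagXZ_injective ι))) D.closure
    have hfin : (of '' D.S ∪ {t} : Set (stage₂ ι).carrier).Finite :=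
      (D.finite.image _).union (Set.finite_singleton _)
    obtain ⟨c₁, -, h₁⟩ := exists_nrm_map_le hS' hfin hR (projZ₂ ι)
    obtain ⟨c₂, -, h₂⟩ := exists_nrm_map_le hR hRf D.closure (diagYZ ι)
    obtain ⟨c₃, -, h₃⟩ := exists_nrm_map_le hR hRf D.closure (diagXZ ι)
    have hp₁ : ∀ x, projZ₂ ι (of x) = projZ ι x := fun x => HNNExtension.lift_of _ _ _ _
    refine ⟨(c₂ + c₃) * c₁, fun k => ⟨?_, ?_⟩⟩
    · have := h₁ (of (diagYZ ι k))
      rw [hp₁, projZ_diagYZ] at this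
      rw [mul_assoc]
      exact (h₂ k).trans (Nat.mul_le_mul (by omega) this)
    · have := h₁ (of (diagXZ ι k))
      rw [hp₁, projZ_diagXZ] at this
      rw [mul_assoc]
      exact (h₃ k).trans (Nat.mul_le_mul (by omega) this)
  -- The retraction to C is trivial on A_yz and injective on A_xz.
  · rw [eq_bot_iff]
    rintro _ ⟨⟨a, rfl⟩, b, hb⟩
    have h1 := congrArg (retraction ι) hb
    rw [retraction_diagXZ, retraction_diagYZ, ← map_one ι] at h1
    have h2 := hι h1
    subst h2
    rw [Subgroup.mem_bot, ← hb, map_one]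
  -- The retraction sends a⁻¹b to the image of b alone. As A_d is undistorted in C, the distance
  -- from a to b is at least a constant times the norm of b; `c + 1` only ensures a positive factor.
  · obtain ⟨c₁, hc₁, h₁⟩ := exists_nrm_map_le D.closure D.finite hSC (retraction ι)
    obtain ⟨c₂, hc₂, h₂⟩ := exists_nrm_map_le hR hRf D.closure (diagXZ ι)
    refine ⟨(c₂ * (c + 1) * c₁), Nat.mul_pos (Nat.mul_pos hc₂ (by omega)) hc₁, ?_⟩
    rintro ρ r m _ ⟨a, rfl⟩ _ ⟨b, rfl⟩ hr - hb w
    have h3 := le_of_jumpWalk (isNorm_nrm D.closure) w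
    have h4 := h₁ ((diagYZ ι a)⁻¹ * diagXZ ι b)
    rw [map_mul, map_inv, retraction_diagXZ, retraction_diagYZ, inv_one, one_mul] at h4
    have h5 : c₂ * (c + 1) * c₁ * ρ ≤ c₂ * (c + 1) * c₁ * m := by
      calc c₂ * (c + 1) * c₁ * ρ ≤ c₂ * nrm R b := hr.trans (hb.trans (h₂ b))
        _ ≤ c₂ * ((c + 1) * nrm SC (ι b)) := by
          gcongr
          exact (hc b).trans (Nat.mul_le_mul_right _ (by omega))
        _ ≤ c₂ * ((c + 1) * (c₁ * m)) := by
          gcongr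
          exact h4.trans (Nat.mul_le_mul_left _ h3)
        _ = _ := by ring
    rw [zero_add, pow_one]
    exact Nat.le_of_mul_le_mul_left h5 (Nat.mul_pos (Nat.mul_pos hc₂ (by omega)) hc₁)

theorem exists_tower_bounds [Group.FG C] {ι : FreeByCyclic n →* C} (hι : Function.Injective ι)
    (hu : Undistorted ι) (e : ℕ) : Nonempty (StageBounds (tower ι (e + 2)) (e + 1)) := by
  induction e with
  | zero => exact exists_stageBounds₂ hι hu
  | succ e ih => exact ih.some.next

end Base

end CatDiv
end

/-! ### The Milnor-Schwarz argument and undistortion of A_d -/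

noncomputable section

namespace CatDiv

section MilnorSchwarz

variable {X : Type*} [MetricSpace X] [ProperSpace X] {C : Type*} [Group C] [MulAction C X]
  [IsIsometricSMul C X] [ProperlyDiscontinuousSMul C X]

/-- The Milnor-Schwarz lemma for a subgroup acting cocompactly on a geodesically convex subset. -/
theorem exists_generators_of_cocompact {A : Type*} [Group A] {f : A →* C}
    (hf : Function.Injective f) (hgeo : ∀ x y : X, ∃ c : ℝ → X, IsGeodesic c x y) {Y : Set X}
    (hY : Y.Nonempty) (hconv : IsGeodesicallyConvex Y) (hact : ActsCocompactlyOn f Y) :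
    ∃ S : Set A, S.Finite ∧ Subgroup.closure S = ⊤ ∧ ∃ x : X, ∀ a : A,
      (nrm S a : ℝ) ≤ dist x (f a • x) + 1 := by
  obtain ⟨hpres, K, hKY, hK, hcov⟩ := hact
  obtain ⟨y, hy⟩ := hY
  obtain ⟨-, x, hx, -⟩ := hcov y hy
  let K' := Metric.cthickening 1 K
  have hK' : IsCompact K' := hK.cthickening
  -- Elements of `S` move some point of `K` into the 1-neighbourhood of `K`, which is compact as `X`
  -- is proper; proper discontinuity then makes `S` finite.
  let S : Set A := {a | ∃ k ∈ K, ∃ k' ∈ K, dist k (f a • k') ≤ 1}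
  have hSfin : S.Finite := by
    have h1 := ProperlyDiscontinuousSMul.finite_disjoint_inter_image (Γ := C) hK hK'
    refine (h1.preimage hf.injOn).subset ?_
    rintro a ⟨k, hk, k', hk', hd⟩
    show ((f a • ·) '' K ∩ K' : Set X).Nonempty
    refine ⟨f a • k', ⟨k', hk', rfl⟩, ?_⟩
    exact Metric.mem_cthickening_of_dist_le _ k 1 K hk (by rwa [dist_comm])
  have hwalk : ∀ (a : A) (n : ℕ), 1 ≤ n → dist x (f a • x) ≤ n → CostWalk (GenStep S) 1 a n := by
    intro a n hn hd
    obtain ⟨c, hc0, hc1, hc⟩ := hgeo x (f a • x)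
    have hxa : f a • x ∈ Y := hpres a x (hKY hx)
    have hn0 : (0 : ℝ) < n := by exact_mod_cast hn
    have hmem : ∀ i : ℕ, i ≤ n → (i / n : ℝ) ∈ Set.Icc (0 : ℝ) 1 := fun i hi =>
      ⟨by positivity, by rw [div_le_one hn0]; exact_mod_cast hi⟩
    have hpt : ∀ i : ℕ, ∃ g : A, i ≤ n → ∃ k ∈ K, f g • k = c (i / n) := by
      intro i
      by_cases hi : i ≤ n
      · obtain ⟨g, hg⟩ := hcov _ (hconv x (hKY hx) _ hxa c ⟨hc0, hc1, hc⟩ _ (hmem i hi))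
        exact ⟨g, fun _ => hg⟩
      · exact ⟨1, fun h => absurd h hi⟩
    choose g hg using hpt
    -- The endpoints of the geodesic are translates of x ∈ K by 1 and a. Prescribing these values
    -- makes the walk run from 1 to a exactly.
    let g' : ℕ → A := fun i => if i = 0 then 1 else if i = n then a else g i
    have hg' : ∀ i ≤ n, ∃ k ∈ K, f (g' i) • k = c (i / n) := by
      intro i hi
      by_cases h0 : i = 0
      · subst h0
        exact ⟨x, hx, by simp [g', hc0]⟩
      · by_cases h1 : i = n
        · subst h1
          refine ⟨x, hx, ?_⟩
          simp [g', h0, hc1]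
        · simpa [g', h0, h1] using hg i hi
    have := CostWalk.of_nat (R := GenStep S) g' n fun i hi => by
      refine ⟨Or.inl ?_, rfl⟩
      obtain ⟨k, hk, hk1⟩ := hg' i hi.le
      obtain ⟨k', hk', hk1'⟩ := hg' (i + 1) hi
      refine ⟨k, hk, k', hk', ?_⟩
      rw [map_mul, map_inv, mul_smul, ← dist_smul (f (g' i)), smul_inv_smul, hk1, hk1',
        hc _ (hmem i hi.le) _ (hmem _ hi)]
      have h2 : (i / n : ℝ) - ((i + 1 : ℕ) : ℝ) / n = -(1 / n) := by
        push_cast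
        field_simp
        ring
      rw [h2, abs_neg, abs_of_pos (by positivity), div_mul_eq_mul_div, one_mul, div_le_one hn0]
      exact hd
    have e0 : g' 0 = 1 := by simp [g']
    have en : g' n = a := by
      have : n ≠ 0 := by omega
      simp [g', this]
    rwa [e0, en] at this
  have hceil : ∀ a : A, CostWalk (GenStep S) 1 a ⌊dist x (f a • x) + 1⌋₊ := by
    intro a
    apply hwalk
    · rw [Nat.one_le_floor_iff]
      have := dist_nonneg (x := x) (y := f a • x)
      linarith
    · have := Nat.lt_floor_add_one (dist x (f a • x) + 1)
      linarith
  have hS : Subgroup.closure S = ⊤ := by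
    have key : ∀ {u v : A} {n : ℕ}, CostWalk (GenStep S) u v n → u⁻¹ * v ∈ Subgroup.closure S := by
      intro u v n w
      induction w with
      | nil => simp
      | @cons u z v k n h _ ih =>
        have h1 : u⁻¹ * z ∈ Subgroup.closure S := by
          rcases h.1 with h | h
          · exact Subgroup.subset_closure h
          · have := Subgroup.inv_mem _ (Subgroup.subset_closure h)
            simpa using this
        have := Subgroup.mul_mem _ h1 ih
        rwa [mul_assoc, mul_inv_cancel_left] at this
    rw [eq_top_iff]
    rintro a -
    simpa using key (hceil a)
  refine ⟨S, hSfin, hS, x, fun a => ?_⟩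
  have h1 := nrm_le_of_walk hS (hceil a)
  rw [inv_one, one_mul] at h1
  have h2 := Nat.floor_le (a := dist x (f a • x) + 1) (by positivity)
  exact le_trans (by exact_mod_cast h1) h2

end MilnorSchwarz

/-- The norm in A is bounded by the displacement of a point of Y, and displacement is at most linear
in the norm of C. The additive constant is absorbed because the image of a ≠ 1 has norm at least 1.
-/
theorem fg_and_undistorted {n : ℕ} {C : Type} [Group C] {X : Type*} [MetricSpace X] [ProperSpace X]
    [MulAction C X] (hX : IsCAT0 X) (hC : ActsGeometrically C X) {ι : FreeByCyclic n →* C}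
    (hι : Function.Injective ι) {Y : Set X} (hY : Y.Nonempty) (hYconv : IsGeodesicallyConvex Y)
    (hYA : ActsCocompactlyOn ι Y) : Group.FG C ∧ Undistorted ι := by
  obtain ⟨h1, h2, h3⟩ := hC
  obtain ⟨SC, hSCf, hSC, -⟩ := exists_generators_of_cocompact (f := MonoidHom.id C)
    Function.injective_id hX.1 (hY.mono (Set.subset_univ Y)) (fun _ _ _ _ _ _ _ _ => trivial) h3
  obtain ⟨R, hRf, hR, x, hx⟩ := exists_generators_of_cocompact hι hX.1 hY hYconv hYA
  refine ⟨Group.fg_iff.2 ⟨SC, hSC, hSCf⟩, R, SC, hRf, hR, hSCf, hSC, ?_⟩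
  obtain ⟨D, hD⟩ := (hSCf.image fun c => dist x (c • x)).bddAbove
  have hd : ∀ c : C, dist x (c • x) ≤ D * nrm SC c := by
    refine le_mul_nrm hSC (fun c => dist x (c • x)) D (by simp) (fun c c' => ?_) (fun s hs => ?_)
    · have := dist_triangle x (c • x) ((c * c') • x)
      rwa [mul_smul, dist_smul, ← mul_smul] at this
    · have h4 : dist x (s • x) ≤ D := hD ⟨s, hs, rfl⟩
      refine ⟨h4, ?_⟩
      rwa [← dist_smul s, smul_inv_smul, dist_comm]
  refine ⟨⌈D⌉₊ + 1, fun a => ?_⟩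
  by_cases ha : a = 1
  · simp [ha]
  · have h5 : 1 ≤ nrm SC (ι a) := by
      rw [Nat.one_le_iff_ne_zero, Ne, nrm_eq_zero hSC]
      intro h
      exact ha (hι (h.trans (map_one ι).symm))
    have h6 := (hx a).trans (add_le_add_left (hd (ι a)) 1)
    have h7 : (1 : ℝ) ≤ nrm SC (ι a) := by exact_mod_cast h5
    have h8 : D * nrm SC (ι a) ≤ ⌈D⌉₊ * nrm SC (ι a) := by
      gcongr
      exact Nat.le_ceil D
    have : (nrm R a : ℝ) ≤ (⌈D⌉₊ + 1) * nrm SC (ι a) := by linarith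
    exact_mod_cast this

end CatDiv
end

noncomputable section

namespace CatDiv

/-! ### Paths outside balls in metric spaces -/

section Avoid

variable {X : Type*} [MetricSpace X] {x₀ x y z : X} {r : ℝ}

theorem avoidDist_comm_le : avoidDist x₀ r x y ≤ avoidDist x₀ r y x := by
  refine le_iInf₂ fun γ hγ => (iInf₂_le γ.symm fun t => hγ _).trans ?_
  exact eVariationOn.comp_le_of_antitoneOn γ unitInterval.symm
    (fun s _ t _ h => unitInterval.symm_le_symm.2 h) (Set.mapsTo_univ _ _)

theorem eVariationOn_trans_le (γ : Path x y) (γ' : Path y z) :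
    eVariationOn (γ.trans γ') Set.univ ≤ eVariationOn γ Set.univ + eVariationOn γ' Set.univ := by
  let h : unitInterval := ⟨1 / 2, by norm_num, by norm_num⟩
  have hu : (Set.univ : Set unitInterval) = Set.Iic h ∪ Set.Ici h := Set.Iic_union_Ici.symm
  rw [hu, eVariationOn.union (γ.trans γ') (x := h) isGreatest_Iic isLeast_Ici, ← hu]
  refine add_le_add ?_ ?_
  · let φ : unitInterval → unitInterval := fun t => Set.projIcc 0 1 zero_le_one (2 * (t : ℝ))
    have : Set.EqOn (γ.trans γ') (γ ∘ φ) (Set.Iic h) := fun t ht => by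
      have ht' : (t : ℝ) ≤ 1 / 2 := ht
      rw [Path.trans_apply, dif_pos ht', Function.comp_apply]
      congr 1
      exact (Set.projIcc_of_mem _ _).symm
    rw [eVariationOn.congr this]
    exact eVariationOn.comp_le_of_monotoneOn γ φ
      (fun s _ t _ h => Set.monotone_projIcc _ (by simpa using h)) (Set.mapsTo_univ _ _)
  · let φ : unitInterval → unitInterval := fun t => Set.projIcc 0 1 zero_le_one (2 * (t : ℝ) - 1)
    have : Set.EqOn (γ.trans γ') (γ' ∘ φ) (Set.Ici h) := fun t ht => by
      have ht' : 1 / 2 ≤ (t : ℝ) := ht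
      rw [Path.trans_apply, Function.comp_apply]
      split_ifs with h1
      · have h2 : (t : ℝ) = 1 / 2 := le_antisymm h1 ht'
        have e1 : φ t = 0 := by
          simp only [φ, h2]
          norm_num
        have e2 : (⟨2 * (t : ℝ), (unitInterval.mul_pos_mem_iff zero_lt_two).2 ⟨t.2.1, h1⟩⟩ :
            unitInterval) = 1 := Subtype.ext (by simp [h2])
        rw [e1, e2, γ.target, γ'.source]
      · congr 1
        exact (Set.projIcc_of_mem _ _).symm
    rw [eVariationOn.congr this]
    exact eVariationOn.comp_le_of_monotoneOn γ' φ
      (fun s _ t _ h => Set.monotone_projIcc _ (by simpa using h)) (Set.mapsTo_univ _ _)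

theorem avoidDist_triangle : avoidDist x₀ r x z ≤ avoidDist x₀ r x y + avoidDist x₀ r y z := by
  have key : ∀ (γ : Path x y) (_ : ∀ t, γ t ∉ Metric.ball x₀ r) (γ' : Path y z)
      (_ : ∀ t, γ' t ∉ Metric.ball x₀ r),
      avoidDist x₀ r x z ≤ eVariationOn γ Set.univ + eVariationOn γ' Set.univ :=
    fun γ hγ γ' hγ' => (iInf₂_le (γ.trans γ') fun t => by
      rw [Path.trans_apply]; split_ifs; exacts [hγ _, hγ' _]).trans (eVariationOn_trans_le γ γ')
  simp only [avoidDist, ENNReal.iInf_add, ENNReal.add_iInf]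
  exact le_iInf₂ fun γ hγ => le_iInf₂ fun γ' hγ' => key _ ‹_› _ ‹_›

theorem avoidDist_le_of_dist_le {f : ℝ → X} {a b : ℝ} (hab : a ≤ b)
    (hf : ∀ s ∈ Set.Icc a b, ∀ t ∈ Set.Icc a b, dist (f s) (f t) ≤ |s - t|)
    (hout : ∀ t ∈ Set.Icc a b, f t ∉ Metric.ball x₀ r) :
    avoidDist x₀ r (f a) (f b) ≤ ENNReal.ofReal (b - a) := by
  let g : unitInterval → ℝ := fun t => a + t * (b - a)
  have hg : ∀ t, g t ∈ Set.Icc a b := fun t => by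
    have h1 := t.2.1
    have h2 := t.2.2
    exact ⟨by simp only [g]; nlinarith, by simp only [g]; nlinarith⟩
  have hL : LipschitzOnWith 1 f (Set.Icc a b) := LipschitzOnWith.of_dist_le_mul fun s hs t ht => by
    simpa [Real.dist_eq] using hf s hs t ht
  have hgc : Continuous g := by fun_prop
  have hc : Continuous (f ∘ g) := hL.continuousOn.comp_continuous hgc hg
  let γ : Path (f a) (f b) :=
    { toFun := f ∘ g
      continuous_toFun := hc
      source' := by simp [g]
      target' := by simp [g] }
  refine (iInf₂_le γ fun t => hout _ (hg t)).trans ?_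
  refine (hL.comp_eVariationOn_le (g := g) (s := Set.univ) fun t _ => hg t).trans ?_
  have hm : MonotoneOn g Set.univ := fun s _ t _ h => by
    have h : (s : ℝ) ≤ t := h
    simp only [g]
    nlinarith
  have := hm.eVariationOn_eq (Set.mem_univ 0) (Set.mem_univ 1)
  have hI : (Set.univ ∩ Set.Icc (0 : unitInterval) 1) = Set.univ := by
    rw [Set.univ_inter]; exact Set.Icc_bot_top
  rw [hI] at this
  rw [this]
  simp [g]

/-- A jump of length at most one in the complement of a ball. -/
def Jump (x₀ : X) (r : ℝ) (p q : X) (k : ℕ) : Prop :=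
  dist p q ≤ 1 ∧ r ≤ dist p x₀ ∧ r ≤ dist q x₀ ∧ k = 1

/-- As long as the endpoint is more than 1 away, the intermediate value theorem gives a later point
at distance exactly 1, and the piece cut off uses up at least one unit of variation. The final short
piece is the extra jump. -/
theorem exists_jump_walk_of_path (γ : Path x y) (hγ : ∀ t, γ t ∉ Metric.ball x₀ r) (k : ℕ) :
    ∀ t, eVariationOn γ (Set.Icc t 1) ≤ k → ∃ m ≤ k + 1, CostWalk (Jump x₀ r) (γ t) y m := by
  have hout : ∀ t, r ≤ dist (γ t) x₀ := fun t => not_lt.1 fun h => hγ t (Metric.mem_ball.2 h)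
  have hy : γ 1 = y := γ.target
  have near : ∀ t, dist (γ t) y ≤ 1 → CostWalk (Jump x₀ r) (γ t) y 1 := fun t h =>
    CostWalk.single ⟨h, hout t, hy ▸ hout 1, rfl⟩
  induction k with
  | zero =>
    intro t ht
    refine ⟨1, le_rfl, near t ?_⟩
    have := (eVariationOn.edist_le γ (Set.left_mem_Icc.2 t.2.2)
      (Set.right_mem_Icc.2 t.2.2)).trans ht
    rw [hy] at this
    simp only [Nat.cast_zero, nonpos_iff_eq_zero, edist_eq_zero] at this
    simp [this]
  | succ k ih =>
    intro t ht
    by_cases h : dist (γ t) y ≤ 1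
    · exact ⟨1, by omega, near t h⟩
    have h1 : t ≤ 1 := t.2.2
    have hcont : ContinuousOn (fun s => dist (γ t) (γ s)) (Set.Icc t 1) := by fun_prop
    obtain ⟨s, hs, hs1⟩ := intermediate_value_Icc h1 hcont
      (show (1 : ℝ) ∈ Set.Icc _ _ from ⟨by simp, by rw [hy]; exact (not_le.1 h).le⟩)
    have hsplit := eVariationOn.Icc_add_Icc γ (s := Set.univ) hs.1 hs.2 (Set.mem_univ s)
    simp only [Set.univ_inter] at hsplit
    have hed := eVariationOn.edist_le γ (Set.left_mem_Icc.2 hs.1) (Set.right_mem_Icc.2 hs.1)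
    have hs1' : dist (γ t) (γ s) = 1 := hs1
    rw [edist_dist, hs1', ENNReal.ofReal_one] at hed
    have hle : 1 + eVariationOn γ (Set.Icc s 1) ≤ 1 + (k : ℝ≥0∞) := by
      rw [add_comm 1 (k : ℝ≥0∞)]
      push_cast at ht
      exact (add_le_add_left hed _).trans (hsplit.le.trans ht)
    obtain ⟨m, hm, w⟩ := ih s ((ENNReal.add_le_add_iff_left ENNReal.one_ne_top).1 hle)
    have step : CostWalk (Jump x₀ r) (γ t) (γ s) 1 :=
      CostWalk.single ⟨hs1'.le, hout t, hout s, rfl⟩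
    exact ⟨1 + m, by omega, step.append w⟩

theorem exists_jump_walk {k : ℕ} (h : avoidDist x₀ r x y < k) :
    ∃ m ≤ k + 1, CostWalk (Jump x₀ r) x y m := by
  simp only [avoidDist, iInf_lt_iff] at h
  obtain ⟨γ, hγ, hlt⟩ := h
  have := exists_jump_walk_of_path γ hγ k 0
    ((eVariationOn.mono γ (Set.subset_univ _)).trans hlt.le)
  rwa [γ.source] at this

end Avoid

/-! ### Paths in metric graphs -/

section Graph

variable {V : Type*} {H : SimpleGraph V} (hH : H.Connected)

theorem dist_mk_vertex_le (p : GraphPt H) (e : Bool) :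
    dist (MetricGraph.mk hH p) (MetricGraph.vertex hH (p.vert e)) ≤ p.off e := by
  refine (GraphPt.d_le_viaVertices _ _).trans ((GraphPt.viaVertices_le _ _ e false).trans ?_)
  simp [GraphPt.vert, GraphPt.off]

theorem dist_vertex (u v : V) :
    dist (MetricGraph.vertex hH u) (MetricGraph.vertex hH v) = H.dist u v := by
  change GraphPt.d _ _ = _
  unfold GraphPt.d
  by_cases h : u = v
  · subst h
    simp
  · have hv : ∀ e e' : Bool, GraphPt.off (H := H) ⟨u, u, Or.inl rfl, 0, by simp⟩ e +
      (H.dist (GraphPt.vert (H := H) ⟨u, u, Or.inl rfl, 0, by simp⟩ e)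
        (GraphPt.vert (H := H) ⟨v, v, Or.inl rfl, 0, by simp⟩ e') : ℝ) +
        GraphPt.off (H := H) ⟨v, v, Or.inl rfl, 0, by simp⟩ e' = H.dist u v := by
      intro e e'
      cases e <;> cases e' <;> simp [GraphPt.off, GraphPt.vert, GraphPt.len]
    obtain ⟨e, e', he⟩ := GraphPt.exists_viaVertices_eq (H := H) ⟨u, u, Or.inl rfl, 0, by simp⟩
      ⟨v, v, Or.inl rfl, 0, by simp⟩
    rw [hv] at he
    simp [h, he]

theorem len_le_one (p : GraphPt H) : p.len ≤ 1 := by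
  unfold GraphPt.len
  rcases p.edge with h | h
  · simp [h]
  · simp [SimpleGraph.dist_eq_one_iff_adj.2 h]

theorem off_le_one (p : GraphPt H) (e : Bool) : p.off e ≤ 1 := by
  have h1 := p.off_add e
  have h2 := p.off_nonneg (!e)
  have h3 := len_le_one p
  linarith

theorem exists_dist_vertex_le_one (x : MetricGraph hH) :
    ∃ v, dist x (MetricGraph.vertex hH v) ≤ 1 := by
  obtain ⟨p, rfl⟩ := SeparationQuotient.surjective_mk x
  exact ⟨_, (dist_mk_vertex_le hH p false).trans (off_le_one p false)⟩

/-- The edge from `u` to `v`, extended by constants. -/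
def edgePath {u v : V} (h : u = v ∨ H.Adj u v) (t : ℝ) : MetricGraph hH :=
  MetricGraph.mk hH ⟨u, v, h, Set.projIcc (0 : ℝ) 1 zero_le_one t,
    (Set.projIcc (0 : ℝ) 1 zero_le_one t).2⟩

theorem dist_edgePath_le {u v : V} (h : u = v ∨ H.Adj u v) (s t : ℝ) :
    dist (edgePath hH h s) (edgePath hH h t) ≤ |s - t| := by
  change GraphPt.d _ _ ≤ _
  rw [GraphPt.d, if_pos ⟨rfl, rfl⟩]
  refine (mul_le_of_le_one_right (abs_nonneg _) (len_le_one _)).trans ?_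
  exact Set.abs_projIcc_sub_projIcc zero_le_one

theorem edgePath_zero {u v : V} (h : u = v ∨ H.Adj u v) :
    edgePath hH h 0 = MetricGraph.vertex hH u := by
  refine dist_le_zero.1 ((dist_mk_vertex_le hH _ false).trans ?_)
  simp [GraphPt.off]

theorem edgePath_one {u v : V} (h : u = v ∨ H.Adj u v) :
    edgePath hH h 1 = MetricGraph.vertex hH v := by
  refine dist_le_zero.1 ((dist_mk_vertex_le hH _ true).trans ?_)
  simp [GraphPt.off]

theorem avoidDist_edge_le {u v w : V} {R : ℝ} (h : u = v ∨ H.Adj u v)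
    (hu : R + 1 ≤ H.dist w u) :
    avoidDist (MetricGraph.vertex hH w) R (MetricGraph.vertex hH u) (MetricGraph.vertex hH v) ≤
      1 := by
  have := avoidDist_le_of_dist_le (f := edgePath hH h) (x₀ := MetricGraph.vertex hH w) (r := R)
    zero_le_one (fun s _ t _ => dist_edgePath_le hH h s t) fun t ht hb => by
      have h1 := dist_edgePath_le hH h 0 t
      rw [edgePath_zero, zero_sub, abs_neg, abs_of_nonneg ht.1] at h1
      have h2 := dist_triangle_right (MetricGraph.vertex hH w) (MetricGraph.vertex hH u)
        (edgePath hH h t)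
      rw [dist_vertex, dist_comm] at h2
      have h3 : dist (edgePath hH h t) _ < R := hb
      linarith [ht.2]
  rw [edgePath_zero, edgePath_one] at this
  simpa using this

end Graph

/-! ### Paths and walks in Cayley graphs -/

section Cayley

variable {G : Type*} [Group G] {S : Set G} (hS : Subgroup.closure S = ⊤)

theorem dist_cayley_vertex (g h : G) :
    dist (CayleyGraph.vertex hS g) (CayleyGraph.vertex hS h) = nrm S (g⁻¹ * h) := by
  rw [← dist_eq_nrm hS]
  exact dist_vertex _ g h

theorem dist_cayley_vertex_one (g : G) :
    dist (CayleyGraph.vertex hS g) (CayleyGraph.vertex hS 1) = nrm S g := by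
  rw [dist_cayley_vertex, mul_one, nrm_inv hS]

theorem edge_of_genStep {x y : G} {k : ℕ} (h : GenStep S x y k) :
    x = y ∨ (SimpleGraph.mulCayley S).Adj x y := by
  by_cases hxy : x = y
  · exact Or.inl hxy
  · exact Or.inr ((SimpleGraph.mulCayley_adj S x y).2 ⟨hxy, h.1.imp
      (fun h => by simpa using h) (fun h => by simpa using h)⟩)

theorem avoidDist_genStep_le {x y : G} {k : ℕ} {R : ℝ} (h : GenStep S x y k)
    (hx : R + 1 ≤ nrm S x) :
    avoidDist (CayleyGraph.vertex hS 1) R (CayleyGraph.vertex hS x) (CayleyGraph.vertex hS y) ≤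
      1 :=
  avoidDist_edge_le _ (edge_of_genStep h) hx

/-- A step along an edge outside a ball. -/
def OuterStep (S : Set G) (R : ℝ) (x y : G) (k : ℕ) : Prop :=
  GenStep S x y k ∧ R ≤ nrm S x ∧ R ≤ nrm S y

theorem avoidDist_outer_le {x y : G} {k : ℕ} {R : ℝ} (hx : R ≤ nrm S x)
    (w : CostWalk (OuterStep S (R + 1)) x y k) :
    avoidDist (CayleyGraph.vertex hS 1) R (CayleyGraph.vertex hS x) (CayleyGraph.vertex hS y) ≤
      k := by
  induction w with
  | nil x =>
    have := avoidDist_le_of_dist_le (f := fun _ => CayleyGraph.vertex hS x)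
      (x₀ := CayleyGraph.vertex hS 1) (r := R) (le_refl (0 : ℝ)) (by simp) fun t _ hb => by
        have h3 : dist (CayleyGraph.vertex hS x) _ < R := hb
        rw [dist_cayley_vertex_one] at h3
        linarith
    simpa using this
  | cons h _ ih =>
    refine avoidDist_triangle.trans ((add_le_add (avoidDist_genStep_le hS h.1 h.2.1)
      (ih (by linarith [h.2.2]))).trans ?_)
    rw [h.1.2]
    push_cast
    exact le_rfl

theorem FarStep.exists_outer (hS : Subgroup.closure S = ⊤) {D k r : ℕ} {R : ℝ} {x y : G} (hR : R + D ≤ r)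
    (h : FarStep S D r x y k) : ∃ n ≤ D * k, CostWalk (OuterStep S R) x y n := by
  have w := exists_genWalk hS x y
  rw [dist_eq_nrm hS] at w
  have hx := h.2.1
  have hk := h.2.2.2
  have hD := h.1
  refine ⟨nrm S (x⁻¹ * y), by rwa [hk, mul_one], ?_⟩
  have key : ∀ {a b : G} {n : ℕ}, CostWalk (GenStep S) a b n → R + n ≤ nrm S a →
      CostWalk (OuterStep S R) a b n := by
    intro a b n w
    induction w with
    | nil a => exact fun _ => CostWalk.nil a
    | @cons a c b k n h w ih =>
      intro ha
      have h1 := nrm_sub_le hS a c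
      have h2 := nrm_le_of_walk hS (CostWalk.single h.symm)
      have h3 : (nrm S a : ℝ) ≤ nrm S c + k := by exact_mod_cast h1.trans (by omega)
      push_cast at ha
      refine CostWalk.cons ⟨h, ?_, ?_⟩ (ih (by linarith))
      · linarith [(Nat.cast_nonneg k : (0 : ℝ) ≤ k), (Nat.cast_nonneg n : (0 : ℝ) ≤ n)]
      · linarith [(Nat.cast_nonneg n : (0 : ℝ) ≤ n)]
  refine key w ?_
  have h1 : (nrm S (x⁻¹ * y) : ℝ) ≤ D := by exact_mod_cast hD
  have h2 : (r : ℝ) ≤ nrm S x := by exact_mod_cast hx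
  linarith

theorem avoidDist_far_le {x y : G} {D r k : ℕ} {R : ℝ} (hR : R + 1 + D ≤ r) (hx : R ≤ nrm S x)
    (w : CostWalk (FarStep S D r) x y k) :
    avoidDist (CayleyGraph.vertex hS 1) R (CayleyGraph.vertex hS x) (CayleyGraph.vertex hS y) ≤
      (D * k : ℕ) := by
  obtain ⟨n, hn, w'⟩ := w.refine (R' := OuterStep S (R + 1)) id D
    fun x y k h => h.exists_outer hS hR
  exact (avoidDist_outer_le hS hx w').trans (by exact_mod_cast hn)

/-- The points of a jump walk are replaced by nearby vertices. Two further jumps attach the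
prescribed vertices `g` and `h`, whence k + 3. -/
theorem exists_far_walk_of_avoidDist_lt {x y : CayleyGraph hS} {g h : G} {r : ℝ}
    {Q R k : ℕ} (hQ : 1 ≤ Q) (hx : dist x (CayleyGraph.vertex hS g) ≤ Q)
    (hy : dist y (CayleyGraph.vertex hS h) ≤ Q) (hR : (R : ℝ) + Q ≤ r) (hk : avoidDist (CayleyGraph.vertex hS 1) r x y < k) :
    ∃ m ≤ k + 3, CostWalk (FarStep S (2 * Q + 1) R) g h m := by
  choose v hv using exists_dist_vertex_le_one (mulCayley_connected hS)
  obtain ⟨m, hm, w⟩ := exists_jump_walk hk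
  have hQ' : (1 : ℝ) ≤ Q := by exact_mod_cast hQ
  have hv' : ∀ p, dist p (CayleyGraph.vertex hS (v p)) ≤ Q := fun p => (hv p).trans hQ'
  have far : ∀ (p : CayleyGraph hS) (a : G), dist p (CayleyGraph.vertex hS a) ≤ Q →
      r ≤ dist p (CayleyGraph.vertex hS 1) → R ≤ nrm S a := by
    intro p a h1 h2
    have h3 := dist_triangle p (CayleyGraph.vertex hS a) (CayleyGraph.vertex hS 1)
    rw [dist_cayley_vertex_one] at h3
    have : (R : ℝ) ≤ nrm S a := by linarith
    exact_mod_cast this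
  have step : ∀ (p q : CayleyGraph hS) (a b : G), dist p (CayleyGraph.vertex hS a) ≤ Q →
      dist q (CayleyGraph.vertex hS b) ≤ Q → dist p q ≤ 1 →
      r ≤ dist p (CayleyGraph.vertex hS 1) → r ≤ dist q (CayleyGraph.vertex hS 1) →
      FarStep S (2 * Q + 1) R a b 1 := by
    intro p q a b ha hb hpq hp hq
    refine ⟨?_, far p a ha hp, far q b hb hq, rfl⟩
    have h1 := dist_triangle4 (CayleyGraph.vertex hS a) p q (CayleyGraph.vertex hS b)
    rw [dist_cayley_vertex, dist_comm _ p] at h1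
    have : (nrm S (a⁻¹ * b) : ℝ) ≤ 2 * Q + 1 := by linarith
    exact_mod_cast this
  have hxr : r ≤ dist x (CayleyGraph.vertex hS 1) := by
    simp only [avoidDist, iInf_lt_iff] at hk
    obtain ⟨γ, hγ, -⟩ := hk
    have := hγ 0
    rw [γ.source] at this
    exact not_lt.1 this
  have hyr : r ≤ dist y (CayleyGraph.vertex hS 1) := by
    simp only [avoidDist, iInf_lt_iff] at hk
    obtain ⟨γ, hγ, -⟩ := hk
    have := hγ 1
    rw [γ.target] at this
    exact not_lt.1 this
  have w' : CostWalk (FarStep S (2 * Q + 1) R) (v x) (v y) m :=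
    w.map v fun p q k h => by
      rw [h.2.2.2]
      exact step p q _ _ (hv' p) (hv' q) h.1 h.2.1 h.2.2.1
  have w0 := CostWalk.single (step x x g (v x) hx (hv' x) (by simp) hxr hxr)
  have w1 := CostWalk.single (step y y (v y) h (hv' y) hy (by simp) hyr hyr)
  exact ⟨1 + (m + 1), by omega, w0.append (w'.append w1)⟩

variable {c : G} (hc : c ∈ S)

theorem dist_cyclicPath_floor (x : ℝ) :
    dist (CayleyGraph.cyclicPath hS hc x) (CayleyGraph.vertex hS (c ^ ⌊x⌋)) ≤ Int.fract x := by
  refine (dist_mk_vertex_le _ _ false).trans ?_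
  simpa [GraphPt.off, CayleyGraph.cyclicPath] using
    mul_le_of_le_one_right (Int.fract_nonneg x) (len_le_one _)

theorem dist_cyclicPath_floor_add_one (x : ℝ) :
    dist (CayleyGraph.cyclicPath hS hc x) (CayleyGraph.vertex hS (c ^ (⌊x⌋ + 1))) ≤
      1 - Int.fract x := by
  refine (dist_mk_vertex_le _ _ true).trans ?_
  simpa [GraphPt.off, CayleyGraph.cyclicPath] using
    mul_le_of_le_one_right (sub_nonneg.2 (Int.fract_lt_one x).le) (len_le_one _)

theorem cyclicPath_intCast (k : ℤ) :
    CayleyGraph.cyclicPath hS hc k = CayleyGraph.vertex hS (c ^ k) := by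
  have := dist_cyclicPath_floor hS hc (k : ℝ)
  rw [Int.floor_intCast, Int.fract_intCast] at this
  exact dist_le_zero.1 this

theorem cyclicPath_zero : CayleyGraph.cyclicPath hS hc 0 = CayleyGraph.vertex hS 1 := by
  have := cyclicPath_intCast hS hc 0
  simpa using this

theorem dist_zpow_le {c : G} (hc : c ∈ S) (k l : ℤ) :
    dist (CayleyGraph.vertex hS (c ^ k)) (CayleyGraph.vertex hS (c ^ l)) ≤ |(l : ℝ) - k| := by
  rw [dist_cayley_vertex, ← zpow_neg, ← zpow_add]
  have h1 := nrm_zpow hS c (-k + l)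
  have h2 := nrm_le_one hS hc
  have h3 : nrm S (c ^ (-k + l)) ≤ (-k + l).natAbs := h1.trans
    ((Nat.mul_le_mul_left _ h2).trans_eq (mul_one _))
  have h4 : ((-k + l).natAbs : ℝ) = |(l : ℝ) - k| := by
    rw [Nat.cast_natAbs]
    push_cast
    congr 1
    ring
  rw [← h4]
  exact_mod_cast h3

theorem dist_cyclicPath_le (s t : ℝ) :
    dist (CayleyGraph.cyclicPath hS hc s) (CayleyGraph.cyclicPath hS hc t) ≤ |s - t| := by
  wlog h : s ≤ t generalizing s t
  · rw [dist_comm, abs_sub_comm]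
    exact this t s (not_le.1 h).le
  rw [abs_sub_comm, abs_of_nonneg (sub_nonneg.2 h)]
  have hs := Int.floor_add_fract s
  have ht := Int.floor_add_fract t
  rcases (Int.floor_mono h).eq_or_lt with he | hlt
  · have he' : (⌊s⌋ : ℝ) = ⌊t⌋ := by exact_mod_cast he
    change GraphPt.d _ _ ≤ _
    rw [GraphPt.d, if_pos ⟨by simp [he], by simp [he]⟩]
    refine (mul_le_of_le_one_right (abs_nonneg _) (len_le_one _)).trans ?_
    change |Int.fract s - Int.fract t| ≤ _
    rw [abs_sub_comm, abs_of_nonneg] <;> linarith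
  · have h1 := dist_cyclicPath_floor_add_one hS hc s
    have h2 := dist_cyclicPath_floor hS hc t
    have h3 := dist_zpow_le hS hc (⌊s⌋ + 1) ⌊t⌋
    have hlt' : (⌊s⌋ : ℝ) + 1 ≤ ⌊t⌋ := by exact_mod_cast hlt
    push_cast at h3
    rw [abs_of_nonneg (by linarith)] at h3
    have h4 := dist_triangle4 (CayleyGraph.cyclicPath hS hc s)
      (CayleyGraph.vertex hS (c ^ (⌊s⌋ + 1))) (CayleyGraph.vertex hS (c ^ ⌊t⌋))
      (CayleyGraph.cyclicPath hS hc t)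
    rw [dist_comm (CayleyGraph.vertex hS (c ^ ⌊t⌋))] at h4
    linarith

end Cayley

end CatDiv
end

noncomputable section

namespace CatDiv

/-! ### Divergence from flats and axis bounds -/

/-- The factor `C` is absorbed by rescaling the argument, as C ≤ max(C, 1)^m for m ≥ 1. -/
theorem dominated_powFun_of_le {f : ℝ → ℝ≥0∞} {m : ℕ} (hm : 1 ≤ m) {C K : ℝ}
    (h : ∀ r, K < r → f r ≤ ENNReal.ofReal (C * r ^ m)) : Dominated f (powFun m) := by
  refine ⟨max C 1, 1, max K 1, by positivity, one_pos, by positivity, fun r hr => ?_⟩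
  have hr0 : 0 ≤ r := by linarith [le_max_right K 1]
  refine (h r ((le_max_left _ _).trans_lt hr)).trans (le_add_right (ENNReal.ofReal_le_ofReal ?_))
  rw [mul_pow]
  gcongr
  exact (le_max_left _ _).trans (le_self_pow₀ (le_max_right _ _) (by omega))

/-- The linear term in `Dominated` already dominates r, which settles the lower bounds for m = 1. -/
theorem powFun_one_dominated (f : ℝ → ℝ≥0∞) : Dominated (powFun 1) f :=
  ⟨1, 1, 1, one_pos, one_pos, one_pos, fun r _ => by simp [powFun]⟩

theorem avoidDist_mono {X : Type*} [MetricSpace X] {x₀ x y : X} {r r' : ℝ} (h : r ≤ r') :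
    avoidDist x₀ r x y ≤ avoidDist x₀ r' x y :=
  le_iInf₂ fun γ hγ => iInf₂_le γ fun t ht => hγ t (Metric.ball_subset_ball h ht)

variable {G : Type*} [Group G] {u : G} {e : ℕ}

theorem AxisBound.far {S T : Set G} {c : G} (h : AxisBound S c (e + 1))
    (hS : Subgroup.closure S = ⊤) (hfinS : S.Finite)
    (hT : Subgroup.closure T = ⊤) (hfinT : T.Finite) (Q : ℕ) :
    ∃ κ : ℕ, ∀ ρ R n k l : ℕ, 1 ≤ l → κ * ρ ≤ R →
      CostWalk (FarStep T Q R) ((c ^ k)⁻¹) (c ^ l) n → ρ ^ (e + 1) ≤ n := by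
  obtain ⟨κ, -, h⟩ := h
  obtain ⟨a, -, ha⟩ := exists_nrm_map_le hT hfinT hS (MonoidHom.id G)
  obtain ⟨b, hb1, hb⟩ := exists_nrm_map_le hS hfinS hT (MonoidHom.id G)
  simp only [MonoidHom.id_apply] at ha hb
  -- A jump of `T`-norm at most `Q` becomes an `S`-walk of length at most `L`, and `+ 1` keeps `L`
  -- positive. The axis bound is used at scale Lρ to regain this factor.
  set L := a * Q + 1 with hL
  refine ⟨b * (κ * L + L), fun ρ R n k l hl hR w => ?_⟩
  rcases Nat.eq_zero_or_pos ρ with rfl | hρ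
  · simp
  have hr0 : κ * (L * ρ) + L ≤ R / b := by
    rw [Nat.le_div_iff_mul_le hb1]
    refine le_trans ?_ hR
    have : L ≤ L * ρ := Nat.le_mul_of_pos_right _ hρ
    calc (κ * (L * ρ) + L) * b ≤ (κ * (L * ρ) + L * ρ) * b := by gcongr
      _ = b * (κ * L + L) * ρ := by ring
  have far : ∀ x y k, FarStep T Q R x y k → FarStep S L (R / b) x y k := fun x y k hk =>
    ⟨(ha _).trans ((Nat.mul_le_mul_left _ hk.1).trans (by omega)),
      Nat.div_le_of_le_mul (hk.2.1.trans (hb _)), Nat.div_le_of_le_mul (hk.2.2.1.trans (hb _)),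
      hk.2.2.2⟩
  obtain ⟨n', hn', w'⟩ := (w.mono far).refine
    (R' := OuterStep S ((κ * (L * ρ) : ℕ) : ℝ)) id L fun x y k hk =>
      hk.exists_outer hS (by exact_mod_cast hr0)
  have := h (L * ρ) (κ * (L * ρ)) n' k l hl le_rfl
    (w'.mono fun x y k hk => ⟨hk.1, by exact_mod_cast hk.2.1, by exact_mod_cast hk.2.2⟩)
  have h2 : L * ρ ^ (e + 1) ≤ L * n := by
    refine le_trans ?_ (this.trans hn')
    rw [mul_pow]
    exact Nat.mul_le_mul_right _ (Nat.le_self_pow (by omega) _)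
  exact Nat.le_of_mul_le_mul_left h2 (by omega)

/-- A path distance d yields a jump walk with at most ⌊d⌋ + 1 + 3 steps, which explains the summand
4. -/
theorem AxisBound.le_avoidDist {S T : Set G} {c : G} (h : AxisBound S c (e + 1))
    (hS : Subgroup.closure S = ⊤) (hfinS : S.Finite)
    (hT : Subgroup.closure T = ⊤) (hfinT : T.Finite) {Q : ℕ} (hQ : 1 ≤ Q) :
    ∃ κ : ℝ, 1 ≤ κ ∧ ∀ r, 0 ≤ r → ∀ R, κ * (r + 1) ≤ R → ∀ k l : ℕ, 1 ≤ l → ∀ x y,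
      dist x (CayleyGraph.vertex hT ((c ^ k)⁻¹)) ≤ Q → dist y (CayleyGraph.vertex hT (c ^ l)) ≤ Q →
      powFun (e + 1) r ≤ avoidDist (CayleyGraph.vertex hT 1) R x y + 4 := by
  obtain ⟨κ, hκ⟩ := h.far hS hfinS hT hfinT (2 * Q + 1)
  have hQ' : (1 : ℝ) ≤ Q := by exact_mod_cast hQ
  have hκ0 : (0 : ℝ) ≤ κ := Nat.cast_nonneg _
  refine ⟨κ + Q, by linarith, fun r hr R hR k l hl x y hx hy => ?_⟩
  by_contra! hlt
  set d := avoidDist (CayleyGraph.vertex hT 1) R x y with hd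
  have hd_top : d ≠ ⊤ := fun h => by simp [h] at hlt
  have hdk : d < ((⌊d.toReal⌋₊ + 1 : ℕ) : ℝ≥0∞) := by
    rw [← ENNReal.ofReal_toReal hd_top, ← ENNReal.ofReal_natCast,
      ENNReal.ofReal_lt_ofReal_iff (by positivity), ENNReal.toReal_ofReal ENNReal.toReal_nonneg]
    push_cast
    exact Nat.lt_floor_add_one _
  have hceil : (⌈r⌉₊ : ℝ) < r + 1 := Nat.ceil_lt_add_one hr
  obtain ⟨m, hm, w⟩ := exists_far_walk_of_avoidDist_lt hT (R := κ * ⌈r⌉₊) hQ hx hy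
    (by push_cast; nlinarith) hdk
  have hfin := (hκ _ _ _ k l hl le_rfl w).trans hm
  refine absurd hlt (not_lt.2 ?_)
  rw [powFun, ← ENNReal.ofReal_toReal hd_top, show (4 : ℝ≥0∞) = ENNReal.ofReal 4 by simp,
    ← ENNReal.ofReal_add ENNReal.toReal_nonneg (by norm_num)]
  refine ENNReal.ofReal_le_ofReal ?_
  have h1 : r ^ (e + 1) ≤ (⌈r⌉₊ : ℝ) ^ (e + 1) := by
    gcongr
    exact Nat.le_ceil r
  have h2 : ((⌈r⌉₊ : ℝ)) ^ (e + 1) ≤ ⌊d.toReal⌋₊ + 1 + 3 := by exact_mod_cast hfin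
  have h3 := Nat.floor_le (ENNReal.toReal_nonneg (a := d))
  linarith

theorem exists_cyclicPath_near {T : Set G} (hT : Subgroup.closure T = ⊤) {c : G} (hc : c ∈ T)
    {s : ℝ} (hs : 1 ≤ s) :
    (∃ l : ℕ, 1 ≤ l ∧
      dist (CayleyGraph.cyclicPath hT hc s) (CayleyGraph.vertex hT (c ^ l)) ≤ 1) ∧
    ∃ k : ℕ, dist (CayleyGraph.cyclicPath hT hc (-s)) (CayleyGraph.vertex hT (c ^ k)⁻¹) ≤ 1 := by
  have near : ∀ x, dist (CayleyGraph.cyclicPath hT hc x) (CayleyGraph.vertex hT (c ^ ⌊x⌋)) ≤ 1 :=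
    fun x => (dist_cyclicPath_floor hT hc x).trans (Int.fract_lt_one x).le
  obtain ⟨k, hk⟩ : ∃ k : ℕ, ⌊-s⌋ = -k :=
    Int.exists_eq_neg_ofNat (Int.floor_nonpos (by linarith))
  obtain ⟨l, hl⟩ := Int.eq_ofNat_of_zero_le (Int.floor_nonneg.2 (zero_le_one.trans hs))
  have hl1 : 1 ≤ l := by
    have : (1 : ℤ) ≤ ⌊s⌋ := Int.le_floor.2 (by simpa using hs)
    omega
  have h1 := near s
  have h2 := near (-s)
  rw [hl, zpow_natCast] at h1
  rw [hk, zpow_neg, zpow_natCast] at h2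
  exact ⟨⟨l, hl1, h1⟩, k, h2⟩

theorem exists_vertex_avoidDist_le {V : Type*} {H : SimpleGraph V} (hH : H.Connected)
    (x : MetricGraph hH) : ∃ v, dist x (MetricGraph.vertex hH v) ≤ 1 ∧ ∀ x₀ R,
      R + 1 ≤ dist x x₀ → avoidDist x₀ R (MetricGraph.vertex hH v) x ≤ 1 := by
  obtain ⟨p, rfl⟩ := SeparationQuotient.surjective_mk x
  have hp : SeparationQuotient.mk (X := PreMetricGraph hH) p = edgePath hH p.edge p.t := by
    simp only [edgePath, Set.projIcc_of_mem zero_le_one p.t_mem]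
    rfl
  rw [hp]
  refine ⟨p.src, ?_, fun x₀ R hR => ?_⟩
  · rw [← edgePath_zero hH p.edge]
    refine (dist_edgePath_le hH _ _ _).trans ?_
    rw [sub_zero, abs_of_nonneg p.t_mem.1]
    exact p.t_mem.2
  · have := avoidDist_le_of_dist_le (f := edgePath hH p.edge) (x₀ := x₀) (r := R)
      p.t_mem.1 (fun s _ t _ => dist_edgePath_le hH _ s t) fun t ht hb => by
        have h1 := dist_edgePath_le hH p.edge p.t t
        rw [abs_of_nonneg (sub_nonneg.2 ht.2)] at h1
        have h2 := dist_triangle (edgePath hH p.edge p.t) (edgePath hH p.edge t) x₀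
        have h3 : dist (edgePath hH p.edge t) x₀ < R := hb
        linarith [ht.1, p.t_mem.2]
    rw [edgePath_zero] at this
    refine this.trans ?_
    rw [sub_zero, ← ENNReal.ofReal_one]
    exact ENNReal.ofReal_le_ofReal p.t_mem.2

theorem FlatData.exists_avoidDist_le (D : FlatData G u e) {T : Set G}
    (hT : Subgroup.closure T = ⊤) (hfin : T.Finite) :
    ∃ κ : ℕ, 1 ≤ κ ∧ ∀ E, ∃ K L : ℕ, ∀ r : ℕ, 1 ≤ r → ∀ g h, κ * r ≤ nrm T g → nrm T g ≤ E * r →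
      κ * r ≤ nrm T h → nrm T h ≤ E * r →
      avoidDist (CayleyGraph.vertex hT 1) (r - L) (CayleyGraph.vertex hT g)
        (CayleyGraph.vertex hT h) ≤ (K * r ^ (e + 1) : ℕ) := by
  obtain ⟨κ, hκ, hw⟩ := D.exists_far_walk hT hfin
  refine ⟨κ, hκ, fun E => ?_⟩
  obtain ⟨M, K, L, hw⟩ := hw E
  refine ⟨2 * L * K, L + 1, fun r hr g h hg hg' hh hh' => ?_⟩
  obtain ⟨n, hn, w⟩ := hw r hr g hg hg'
  obtain ⟨n', hn', w'⟩ := hw r hr h hh hh'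
  have hrg : (r : ℝ) ≤ nrm T g := by
    exact_mod_cast (Nat.le_mul_of_pos_left r hκ).trans hg
  refine (avoidDist_far_le hT (by push_cast; linarith) (by push_cast; linarith)
    (w.append (w'.reverse fun x y k h => h.symm hT))).trans ?_
  refine Nat.cast_le.2 ?_
  calc L * (n + n') ≤ L * (K * r ^ (e + 1) + K * r ^ (e + 1)) := by gcongr
    _ = 2 * L * K * r ^ (e + 1) := by ring

theorem FlatData.exists_sphere_bound (D : FlatData G u e) {T : Set G}
    (hT : Subgroup.closure T = ⊤) (hfin : T.Finite) :
    ∃ b : ℝ, 0 < b ∧ b ≤ 1 ∧ ∃ C K : ℝ, ∀ ρ, 0 < ρ → ρ ≤ b → ∀ r, K < r → ∀ x₁ x₂,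
      dist x₁ (CayleyGraph.vertex hT 1) = r → dist x₂ (CayleyGraph.vertex hT 1) = r →
      avoidDist (CayleyGraph.vertex hT 1) (ρ * r) x₁ x₂ ≤ ENNReal.ofReal (C * r ^ (e + 1)) := by
  obtain ⟨κ, hκ, hw⟩ := D.exists_avoidDist_le hT hfin
  obtain ⟨K, L, hw⟩ := hw (4 * κ)
  have hκ' : (1 : ℝ) ≤ κ := by exact_mod_cast hκ
  have hκ0 : (0 : ℝ) < κ := by linarith
  refine ⟨1 / (2 * κ), by positivity, by rw [div_le_one (by positivity)]; linarith, K + 2,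
    6 + 4 * κ + 2 * κ * (2 + L), fun ρ hρ hρb r hr x₁ x₂ h₁ h₂ => ?_⟩
  have hL0 : (0 : ℝ) ≤ L := Nat.cast_nonneg _
  have hκL : 0 ≤ 2 * κ * (2 + (L : ℝ)) := by positivity
  -- This is the largest N with κN ≤ r - 1, so vertices within 1 of the sphere have norm between κN
  -- and 4κN. For large r the radius ρr ≤ r/(2κ) is at most N - L.
  set N := ⌊(r - 1) / κ⌋₊ with hN
  have hN1 : (N : ℝ) ≤ (r - 1) / κ := Nat.floor_le (div_nonneg (by linarith) hκ0.le)
  have hN2 : (r - 1) / κ < N + 1 := Nat.lt_floor_add_one _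
  rw [le_div_iff₀ hκ0] at hN1
  rw [div_lt_iff₀ hκ0] at hN2
  have hNpos : 1 ≤ N := by
    have : (0 : ℝ) < N := by
      by_contra hneg
      nlinarith
    exact_mod_cast this
  have hρr : 2 * κ * (ρ * r) ≤ r := by
    have : 2 * κ * ρ ≤ 1 := by
      rw [le_div_iff₀ (by positivity)] at hρb
      linarith
    nlinarith
  have hNr : (N : ℝ) ≤ r - 1 := by nlinarith [(Nat.cast_nonneg N : (0 : ℝ) ≤ N)]
  have hball : ρ * r ≤ N - L := by
    by_contra! hlt
    nlinarith
  have hball1 : ρ * r + 1 ≤ r := by linarith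
  obtain ⟨v₁, hv₁, ha₁⟩ := exists_vertex_avoidDist_le (mulCayley_connected hT) x₁
  obtain ⟨v₂, hv₂, ha₂⟩ := exists_vertex_avoidDist_le (mulCayley_connected hT) x₂
  have bounds : ∀ (x : CayleyGraph hT) (v : G), dist x (CayleyGraph.vertex hT 1) = r →
      dist x (CayleyGraph.vertex hT v) ≤ 1 → κ * N ≤ nrm T v ∧ nrm T v ≤ 4 * κ * N := by
    intro x v hx hv
    have h3 := dist_triangle x (CayleyGraph.vertex hT v) (CayleyGraph.vertex hT 1)
    have h4 := dist_triangle_left (CayleyGraph.vertex hT v) (CayleyGraph.vertex hT 1) x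
    rw [dist_cayley_vertex_one] at h3 h4
    have h5 : (κ : ℝ) * N ≤ nrm T v := by linarith
    have h6 : (nrm T v : ℝ) ≤ 4 * κ * N := by linarith
    exact ⟨by exact_mod_cast h5, by exact_mod_cast h6⟩
  have hmid := hw N hNpos v₁ v₂ (bounds x₁ v₁ h₁ hv₁).1 (bounds x₁ v₁ h₁ hv₁).2
    (bounds x₂ v₂ h₂ hv₂).1 (bounds x₂ v₂ h₂ hv₂).2
  have h1 := avoidDist_comm_le.trans (ha₁ (CayleyGraph.vertex hT 1) (ρ * r) (by rwa [h₁]))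
  have h2 := ha₂ (CayleyGraph.vertex hT 1) (ρ * r) (by rwa [h₂])
  refine (avoidDist_triangle.trans (add_le_add h1
    (avoidDist_triangle.trans (add_le_add ((avoidDist_mono hball).trans hmid) h2)))).trans ?_
  rw [← ENNReal.ofReal_one, ← ENNReal.ofReal_natCast, ← ENNReal.ofReal_add (by positivity)
    (by positivity), ← ENNReal.ofReal_add (by positivity) (by positivity)]
  refine ENNReal.ofReal_le_ofReal ?_
  have hr1 : 1 ≤ r := by linarith
  have hp : 1 ≤ r ^ (e + 1) := one_le_pow₀ hr1
  have hq : (N : ℝ) ^ (e + 1) ≤ r ^ (e + 1) := by gcongr; linarith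
  have hq' : (K : ℝ) * N ^ (e + 1) ≤ K * r ^ (e + 1) := by gcongr
  push_cast
  linarith

variable {T : Set G} (hT : Subgroup.closure T = ⊤) {c : G} (hc : c ∈ T)

theorem isQuasiGeodesic_cyclicPath {a : ℕ} (ha : 1 ≤ a)
    (h : ∀ l : ℤ, l.natAbs ≤ a * nrm T (c ^ l)) :
    IsQuasiGeodesic a 3 (CayleyGraph.cyclicPath hT hc) := by
  have ha' : (1 : ℝ) ≤ a := by exact_mod_cast ha
  refine ⟨ha', by norm_num, fun s t => ⟨?_, ?_⟩⟩
  · have h1 := dist_cyclicPath_floor hT hc s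
    have h2 := dist_cyclicPath_floor hT hc t
    have h3 := dist_triangle4 (CayleyGraph.vertex hT (c ^ ⌊s⌋)) (CayleyGraph.cyclicPath hT hc s)
      (CayleyGraph.cyclicPath hT hc t) (CayleyGraph.vertex hT (c ^ ⌊t⌋))
    rw [dist_comm _ (CayleyGraph.cyclicPath hT hc s), dist_cayley_vertex, ← zpow_neg,
      ← zpow_add] at h3
    have h4 : ((-⌊s⌋ + ⌊t⌋).natAbs : ℝ) ≤ a * nrm T (c ^ (-⌊s⌋ + ⌊t⌋)) := by
      exact_mod_cast h (-⌊s⌋ + ⌊t⌋)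
    rw [Nat.cast_natAbs] at h4
    push_cast at h4
    have h5 : |s - t| ≤ |-(⌊s⌋ : ℝ) + ⌊t⌋| + 1 := by
      have hs := Int.floor_add_fract s
      have ht := Int.floor_add_fract t
      have := (abs_sub_le_iff (a := Int.fract s) (b := Int.fract t) (c := 1)).2
        ⟨by linarith [Int.fract_lt_one s, Int.fract_nonneg t],
          by linarith [Int.fract_lt_one t, Int.fract_nonneg s]⟩
      calc |s - t| = |-(-(⌊s⌋ : ℝ) + ⌊t⌋) + (Int.fract s - Int.fract t)| := by
            congr 1; linarith
        _ ≤ |-(-(⌊s⌋ : ℝ) + ⌊t⌋)| + |Int.fract s - Int.fract t| := abs_add_le _ _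
        _ ≤ _ := by rw [abs_neg]; linarith
    have h6 : |s - t| / a ≤ nrm T (c ^ (-⌊s⌋ + ⌊t⌋)) + 1 := by
      rw [div_le_iff₀ (by linarith)]
      linarith
    linarith [Int.fract_lt_one s, Int.fract_lt_one t]
  · have := dist_cyclicPath_le hT hc s t
    nlinarith [abs_nonneg (s - t)]

theorem FlatData.cyclic_upper (D : FlatData G u e) (hfin : T.Finite) {a : ℕ}
    (h : ∀ l : ℤ, l.natAbs ≤ a * nrm T (c ^ l)) {Λ C₀ : ℝ}
    (hq : IsQuasiGeodesic Λ C₀ (CayleyGraph.cyclicPath hT hc)) :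
    Dominated (quasiGeodesicDivergence Λ C₀ (CayleyGraph.cyclicPath hT hc)) (powFun (e + 1)) := by
  obtain ⟨hΛ, hC₀, hq⟩ := hq
  obtain ⟨κ, hκ, hw⟩ := D.exists_avoidDist_le hT hfin
  set E := a * κ with hE
  obtain ⟨K, L, hw⟩ := hw E
  have ha : 1 ≤ a := by
    have := h 1
    rcases Nat.eq_zero_or_pos a with rfl | h
    · simp at this
    · exact h
  refine dominated_powFun_of_le (K := 1) (C := 2 * (E * (L + 2)) + K * (L + 2 : ℝ) ^ (e + 1))
    (by omega) fun r hr => ?_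
  -- The detour joins c^(-N) to c^N for N = aκr', where undistortion gives norm at least κr'. The
  -- shift by `L` offsets the loss of radius, and the pieces of the axis between ±r and ±N avoid the
  -- ball by the quasi-geodesic inequality.
  set r' := ⌈r⌉₊ + L with hr'
  set N := E * r' with hN
  have hE1 : 1 ≤ E := Nat.mul_pos ha hκ
  have hr1 : r ≤ ⌈r⌉₊ := Nat.le_ceil r
  have hr2 : (⌈r⌉₊ : ℝ) < r + 1 := Nat.ceil_lt_add_one (by linarith)
  have hr'1 : 1 ≤ r' := by
    have : (0 : ℝ) < r' := by rw [hr']; push_cast; linarith [(Nat.cast_nonneg L : (0 : ℝ) ≤ L)]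
    exact_mod_cast this
  have hrN : r ≤ N := by
    have h1 : r' ≤ N := Nat.le_mul_of_pos_left _ hE1
    have h2 : (r' : ℝ) ≤ N := by exact_mod_cast h1
    have h3 : (⌈r⌉₊ : ℝ) ≤ r' := by rw [hr']; push_cast; linarith [(Nat.cast_nonneg L : (0 : ℝ) ≤ L)]
    linarith
  have bounds : ∀ l : ℤ, l.natAbs = N → κ * r' ≤ nrm T (c ^ l) ∧ nrm T (c ^ l) ≤ E * r' := by
    intro l hl
    constructor
    · refine le_of_mul_le_mul_left (a := a) ?_ ha
      rw [← mul_assoc, ← hE, ← hN, ← hl]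
      exact h l
    · refine (nrm_zpow hT c l).trans ?_
      rw [hl]
      exact (Nat.mul_le_mul_left _ (nrm_le_one hT hc)).trans_eq (mul_one _)
  have hmid := hw r' hr'1 (c ^ (-(N : ℤ))) (c ^ (N : ℤ)) (bounds _ (by simp)).1
    (bounds _ (by simp)).2 (bounds _ (by simp)).1 (bounds _ (by simp)).2
  rw [← cyclicPath_intCast hT hc, ← cyclicPath_intCast hT hc, ← cyclicPath_zero hT hc] at hmid
  push_cast at hmid
  have hball : r / Λ - C₀ ≤ r' - L := by
    have : r / Λ ≤ r := div_le_self (by linarith) hΛ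
    rw [hr']
    push_cast
    linarith
  have out : ∀ t : ℝ, r ≤ |t| → CayleyGraph.cyclicPath hT hc t ∉
      Metric.ball (CayleyGraph.cyclicPath hT hc 0) (r / Λ - C₀) := by
    intro t ht hb
    have h1 := (hq t 0).1
    have h2 : dist _ _ < r / Λ - C₀ := hb
    rw [sub_zero] at h1
    have h3 : r / Λ ≤ |t| / Λ := by gcongr
    linarith
  have hpos := avoidDist_le_of_dist_le hrN (fun s _ t _ => dist_cyclicPath_le hT hc s t)
    fun t ht => out t (ht.1.trans (le_abs_self t))
  have hneg := avoidDist_le_of_dist_le (neg_le_neg hrN)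
    (fun s _ t _ => dist_cyclicPath_le hT hc s t)
    fun t ht => out t ((by linarith [ht.2] : r ≤ -t).trans (neg_le_abs t))
  refine (avoidDist_triangle.trans (add_le_add (avoidDist_comm_le.trans hneg)
    (avoidDist_triangle.trans (add_le_add ((avoidDist_mono hball).trans hmid)
      (avoidDist_comm_le.trans hpos))))).trans ?_
  have hcast : (K : ℝ≥0∞) * (r' : ℝ≥0∞) ^ (e + 1) = ENNReal.ofReal (K * (r' : ℝ) ^ (e + 1)) := by
    rw [← Nat.cast_pow, ← Nat.cast_mul, ← ENNReal.ofReal_natCast]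
    push_cast
    rfl
  have e1 : -r - -(N : ℝ) = N - r := by ring
  have e2 : 0 ≤ (N : ℝ) - r := sub_nonneg.2 hrN
  rw [hcast, e1, ← ENNReal.ofReal_add (by positivity) e2, ← ENNReal.ofReal_add e2 (by positivity)]
  refine ENNReal.ofReal_le_ofReal ?_
  have hL0 : (0 : ℝ) ≤ L := Nat.cast_nonneg _
  have hr'2 : (r' : ℝ) ≤ (L + 2) * r := by rw [hr']; push_cast; nlinarith
  have hpow : r ≤ r ^ (e + 1) := le_self_pow₀ hr.le (by omega)
  have hN2 : (N : ℝ) ≤ E * (L + 2) * r ^ (e + 1) := by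
    rw [hN]
    push_cast
    calc (E : ℝ) * r' ≤ E * ((L + 2) * r) := by gcongr
      _ ≤ E * ((L + 2) * r ^ (e + 1)) := by gcongr
      _ = _ := by ring
  have hK2 : (K : ℝ) * r' ^ (e + 1) ≤ K * (L + 2) ^ (e + 1) * r ^ (e + 1) := by
    calc (K : ℝ) * r' ^ (e + 1) ≤ K * ((L + 2) * r) ^ (e + 1) := by gcongr
      _ = _ := by rw [mul_pow]; ring
  linarith

theorem FlatData.cyclicDivergenceEquivalent (D : FlatData G u e) {c : G} (hηc : D.η c = 1)
    (hlow : e = 0 ∨ AxisBound D.S c (e + 1)) :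
    CyclicDivergenceEquivalent c (powFun (e + 1)) := by
  refine ⟨Group.fg_iff.2 ⟨D.S, D.closure, D.finite⟩, fun T hT hc hfin => ?_⟩
  obtain ⟨a, ha, hη⟩ := exists_natAbs_le_nrm hT hfin D.η_mul
  have hnat := natAbs_le_nrm_zpow D.η_mul hη hηc
  refine ⟨⟨a, 3, isQuasiGeodesic_cyclicPath hT hc ha hnat⟩, fun Λ C₀ hq =>
    ⟨D.cyclic_upper hT hc hfin hnat hq, ?_⟩⟩
  rcases hlow with rfl | hlow
  · exact powFun_one_dominated _
  obtain ⟨κ, hκ, h⟩ := hlow.le_avoidDist D.closure D.finite hT hfin le_rfl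
  obtain ⟨hΛ, hC₀, -⟩ := hq
  have hA : 2 ≤ Λ * (2 * κ + C₀) := by nlinarith
  -- At this scale the ball has radius (2κ + C₀)x - C₀ ≥ κ(x + 1) for x > 1, and the additive 4 goes
  -- into the linear term.
  refine ⟨Λ * (2 * κ + C₀), 4, 1, by linarith, by norm_num, one_pos, fun x hx => ?_⟩
  have h1 : 1 ≤ Λ * (2 * κ + C₀) * x := by nlinarith
  have h2 : Λ * (2 * κ + C₀) * x / Λ = (2 * κ + C₀) * x := by
    field_simp
  obtain ⟨⟨l, hl, hpos⟩, k, hneg⟩ := exists_cyclicPath_near hT hc h1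
  refine (h x (by linarith) (Λ * (2 * κ + C₀) * x / Λ - C₀) (by rw [h2]; nlinarith) k l hl _ _
    (by simpa using hneg) (by simpa using hpos)).trans ?_
  rw [quasiGeodesicDivergence, cyclicPath_zero]
  gcongr
  rw [show (4 : ℝ≥0∞) = ENNReal.ofReal 4 by simp]
  exact ENNReal.ofReal_le_ofReal (by linarith)

/-- On a shortest walk from g to 1 some edge starts at norm at least r and ends below it; this edge
meets the sphere. The case r = 0 is the end of the walk. -/
theorem exists_mem_sphere_near (g : G) {r : ℝ} (hr : 0 ≤ r) (hg : r ≤ nrm T g) :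
    ∃ x, dist x (CayleyGraph.vertex hT 1) = r ∧
      dist x (CayleyGraph.vertex hT g) ≤ nrm T g + 1 - r := by
  have key : ∀ {a b : G} {n : ℕ}, CostWalk (GenStep T) a b n → b = 1 → r ≤ nrm T a →
      ∃ x, dist x (CayleyGraph.vertex hT 1) = r ∧
        dist x (CayleyGraph.vertex hT a) ≤ n + 1 - r := by
    intro a b n w hb
    induction w with
    | nil a =>
      intro ha
      rw [hb, nrm_one, Nat.cast_zero] at ha
      obtain rfl : r = 0 := le_antisymm ha hr
      exact ⟨CayleyGraph.vertex hT 1, by simp, by simp [hb]⟩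
    | @cons a a' b k n h w ih =>
      intro ha
      by_cases ha' : r ≤ nrm T a'
      · obtain ⟨x, hx, hx'⟩ := ih hb ha'
        refine ⟨x, hx, ?_⟩
        have h1 := dist_triangle x (CayleyGraph.vertex hT a') (CayleyGraph.vertex hT a)
        have h2 := nrm_le_of_walk hT (CostWalk.single h.symm)
        rw [dist_cayley_vertex] at h1
        have h3 : (nrm T (a'⁻¹ * a) : ℝ) ≤ k := by exact_mod_cast h2
        push_cast
        linarith
      · have hedge := edge_of_genStep h
        have hcont : Continuous (edgePath (mulCayley_connected hT) hedge) :=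
          (LipschitzWith.of_dist_le_mul (K := 1) fun s t => by
            simpa [Real.dist_eq] using dist_edgePath_le _ hedge s t).continuous
        obtain ⟨t, ht, htr⟩ := intermediate_value_Icc' (zero_le_one (α := ℝ))
          (f := fun t => dist (edgePath (mulCayley_connected hT) hedge t)
            (CayleyGraph.vertex hT 1)) (by fun_prop)
          (show r ∈ Set.Icc _ _ by
            rw [edgePath_zero, edgePath_one]
            change r ∈ Set.Icc (dist (CayleyGraph.vertex hT a') _)
              (dist (CayleyGraph.vertex hT a) _)
            rw [dist_cayley_vertex_one, dist_cayley_vertex_one]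
            exact ⟨(not_le.1 ha').le, ha⟩)
        refine ⟨_, htr, ?_⟩
        have h1 := dist_edgePath_le (mulCayley_connected hT) hedge t 0
        rw [edgePath_zero, sub_zero, abs_of_nonneg ht.1] at h1
        have h2 := nrm_le_of_walk hT (CostWalk.cons h w)
        rw [hb, mul_one, nrm_inv hT] at h2
        have h3 : (nrm T a : ℝ) ≤ (k + n : ℕ) := by exact_mod_cast h2
        exact h1.trans (by linarith [ht.2])
  have w := (nrm_walk hT g).reverse fun x y k h => h.symm
  exact key w rfl hg

/-- Take the first power of norm at least r. The power before it has norm below r, so the overshoot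
is less than the norm of `c`. -/
theorem exists_pow_mem_sphere_near {c : G} {a Q : ℕ}
    (h : ∀ l : ℤ, l.natAbs ≤ a * nrm T (c ^ l)) (hQ : nrm T c + 1 ≤ Q) {r : ℝ} (hr : 0 < r) :
    ∃ l : ℕ, 1 ≤ l ∧ ∃ x, dist x (CayleyGraph.vertex hT 1) = r ∧
      dist x (CayleyGraph.vertex hT (c ^ l)) ≤ Q := by
  classical
  have hex : ∃ l : ℕ, r ≤ nrm T (c ^ l) := by
    refine ⟨a * ⌈r⌉₊, (Nat.le_ceil r).trans ?_⟩
    have h1 := h (a * ⌈r⌉₊ : ℕ)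
    have ha : 0 < a := by
      have := h 1
      rcases Nat.eq_zero_or_pos a with rfl | h
      · simp at this
      · exact h
    rw [Int.natAbs_natCast, zpow_natCast] at h1
    exact_mod_cast Nat.le_of_mul_le_mul_left h1 ha
  obtain ⟨l, hl⟩ : ∃ l, Nat.find hex = l + 1 := by
    refine Nat.exists_eq_succ_of_ne_zero fun h0 => ?_
    have := Nat.find_spec hex
    rw [h0, pow_zero, nrm_one, Nat.cast_zero] at this
    linarith
  have h1 := Nat.find_spec hex
  have h2 := not_le.1 (Nat.find_min hex (m := l) (by omega))
  rw [hl] at h1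
  obtain ⟨x, hx, hx'⟩ := exists_mem_sphere_near hT (c ^ (l + 1)) hr.le h1
  refine ⟨l + 1, by omega, x, hx, hx'.trans ?_⟩
  have h3 : (nrm T (c ^ (l + 1)) : ℝ) ≤ nrm T (c ^ l) + nrm T c := by
    rw [pow_succ]
    exact_mod_cast nrm_mul hT _ _
  have h4 : (nrm T c : ℝ) + 1 ≤ Q := by exact_mod_cast hQ
  linarith

theorem FlatData.groupDivergenceEquivalent (D : FlatData G u e)
    (hlow : e = 0 ∨ ∃ c, D.η c = 1 ∧ AxisBound D.S c (e + 1)) :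
    GroupDivergenceEquivalent G (powFun (e + 1)) := by
  refine ⟨Group.fg_iff.2 ⟨D.S, D.closure, D.finite⟩, fun T hT hfin => ?_⟩
  obtain ⟨b, hb, hb1, C, K, hup⟩ := D.exists_sphere_bound hT hfin
  refine ⟨b, hb, hb1, fun ρ hρ hρb => ⟨dominated_powFun_of_le (by omega) (C := C) (K := K)
    fun r hr => iSup₂_le fun x₁ x₂ => iSup₂_le fun h₁ h₂ => iSup_le fun _ =>
      hup ρ hρ hρb r hr x₁ x₂ h₁ h₂, ?_⟩⟩
  rcases hlow with rfl | ⟨c, hηc, hlow⟩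
  · exact powFun_one_dominated _
  obtain ⟨a, ha, hη⟩ := exists_natAbs_le_nrm hT hfin D.η_mul
  have hnat := natAbs_le_nrm_zpow D.η_mul hη hηc
  obtain ⟨κ, hκ, h⟩ := hlow.le_avoidDist D.closure D.finite hT hfin (Q := nrm T c + 1) (by omega)
  have hA : 0 < 2 * κ / ρ := by positivity
  -- At this scale the ball has radius 2κx ≥ κ(x + 1). The supremum is tested on two points of the
  -- sphere near c^(-k) and c^l; the upper bound supplies the finiteness that admits this pair.
  refine ⟨2 * κ / ρ, 4, max 1 (K / (2 * κ / ρ)), hA, by norm_num, by positivity, fun x hx => ?_⟩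
  have hx1 : 1 < x := (le_max_left _ _).trans_lt hx
  have hKx : K < 2 * κ / ρ * x := by
    have := (le_max_right _ _).trans_lt hx
    rw [div_lt_iff₀ hA] at this
    linarith
  have hr : 0 < 2 * κ / ρ * x := by positivity
  obtain ⟨l, hl, y, hy, hy'⟩ := exists_pow_mem_sphere_near hT hnat le_rfl hr
  obtain ⟨k, -, z, hz, hz'⟩ := exists_pow_mem_sphere_near hT (c := c⁻¹) (a := a)
    (fun l => by simpa using hnat (-l)) (by rw [nrm_inv hT]) hr
  rw [inv_pow] at hz'
  have hle := h x (by linarith) (ρ * (2 * κ / ρ * x))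
    (by rw [show ρ * (2 * κ / ρ * x) = 2 * κ * x by field_simp]; nlinarith) k l hl z y hz' hy'
  have hfinite := (hup ρ hρ hρb _ hKx z y hz hy).trans_lt ENNReal.ofReal_lt_top
  refine hle.trans (add_le_add ?_ ?_)
  · exact le_iSup₂_of_le z y (le_iSup₂_of_le hz hy (le_iSup_of_le hfinite le_rfl))
  · rw [show (4 : ℝ≥0∞) = ENNReal.ofReal 4 by simp]
    exact ENNReal.ofReal_le_ofReal (by linarith)

end CatDiv
end

/-! ### The proposition -/

theorem proposition5p11 (n : ℕ) (hn : 1 ≤ n) {C : Type} [Group C]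
    {X : Type*} [MetricSpace X] [ProperSpace X] [MulAction C X]
    (hX : CatDiv.IsCAT0 X) (hC : CatDiv.ActsGeometrically C X)
    (ι : CatDiv.FreeByCyclic n →* C) (hι : Function.Injective ι)
    (Y : Set X) (hY : Y.Nonempty) (hYconv : CatDiv.IsGeodesicallyConvex Y)
    (hYA : CatDiv.ActsCocompactlyOn ι Y)
    (m : ℕ) (hm : 1 ≤ m) :
    CatDiv.CyclicDivergenceEquivalent (CatDiv.s ι m) (CatDiv.powFun m) ∧
      CatDiv.GroupDivergenceEquivalent (CatDiv.B ι m) (CatDiv.powFun m) := by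
  obtain ⟨hCfg, hu⟩ := CatDiv.fg_and_undistorted hX hC hι hY hYconv hYA
  match m, hm with
  | 1, _ =>
    obtain ⟨D, -⟩ := CatDiv.exists_baseFlat ι
    exact ⟨D.cyclicDivergenceEquivalent D.η_u (Or.inl rfl),
      D.groupDivergenceEquivalent (Or.inl rfl)⟩
  | e + 2, _ =>
    obtain ⟨W⟩ := CatDiv.exists_tower_bounds hι hu e
    exact ⟨W.flat.cyclicDivergenceEquivalent W.η_s (Or.inr W.axis),
      W.flat.groupDivergenceEquivalent (Or.inr ⟨_, W.η_s, W.axis⟩)⟩
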